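/- **Setting.** Let $\Psi$ be a countably infinite set, either a plain set or (endowed with) a vector space over a finite field. Let $G$ be the group of all automorphisms of $\Psi$ (all permutations, resp. all linear automorphisms) fixing pointwise a given finite subset of $\Psi$. Let $k$ be a field of characteristic zero. For $T\subseteq\Psi$ let $G_T$ be the pointwise stabilizer of $T$ in $G$; $T$ is *$G$-closed* if $T=\Psi^{G_T}$. Below $T,T'$ run over the finite $G$-closed subsets of $\Psi$. Put $\mathrm{Aut}(T):=N_G(G_T)/G_T$. A $k\langle G\rangle$-module is *smooth* if the stabilizer of each of its elements contains $G_S$ for some finite $S\subset\Psi$; $\mathrm{Sm}_k(G)$ is the category of smooth $k\langle G\rangle$-modules. For a set $X$ and a commutative ring $R$, $R\langle X\rangle$ is the free $R$-module on $X$; $k\langle G/G_T\rangle$ is a module over $k\langle G\times\mathrm{Aut}(T)\rangle$, where $G$ acts by left translations and $[n]\in\mathrm{Aut}(T)$ by $[x]\mapsto[xn^{-1}]$. Let $V^\Psi_T\subseteq\mathbb Z\langle G/G_T\rangle$ be the common kernel of all morphisms of $G$-modules $\mathbb Z\langle G/G_T\rangle\to\mathbb Z\langle G/G_{T'}\rangle$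 for all $G$-closed $T'\subsetneq T$; $k\otimes V^\Psi_T$ is considered as a submodule of $k\langle G/G_T\rangle$. Let $\Pi(T)$ be the set of isomorphism classes of simple $k\langle\mathrm{Aut}(T)\rangle$-modules. For $\alpha\in\Pi(T)$, represented by $\Gamma_{T,\alpha}$, put $$S^\Psi_{T,\alpha}:=\mathrm{Hom}_{k\langle\mathrm{Aut}(T)\rangle}(\Gamma_{T,\alpha},k\langle G/G_T\rangle),\qquad V^\Psi_{T,\alpha}:=\mathrm{Hom}_{k\langle\mathrm{Aut}(T)\rangle}(\Gamma_{T,\alpha},k\otimes V^\Psi_T)\subseteq S^\Psi_{T,\alpha}.$$ Say that $g\in G$ with $T'=g(T)$ transforms $\alpha\in\Pi(T)$ to $\alpha'\in\Pi(T')$ if $\Gamma_{T,\alpha}$ becomes isomorphic to $\Gamma_{T',\alpha'}$ when $\mathrm{Aut}(T)$ is identified with $\mathrm{Aut}(T')$ by $[n]\mapsto[gng^{-1}]$. The *Gabriel spectrum* of $\mathrm{Sm}_k(G)$ is the space of isomorphism classes of indecomposable injective objects $E$, with the topology generated by the sets $[X]=\{E\mid\mathrm{Hom}(X,E)=0\}$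 for all compact (finitely presented) objects $X$. **Theorem.** The topology of the Gabriel spectrum of $\mathrm{Sm}_k(G)$ is the cofinite one (the non-empty open subsets are exactly the non-empty subsets with finite complement), and the following holds. 1. The $k\langle G\rangle$-module $V^\Psi_{T,\alpha}$ is smooth and simple for all $T$ and $\alpha\in\Pi(T)$; the $k\langle G\rangle$-module $k\otimes V^\Psi_T$ is semisimple. One has $V^\Psi_{T,\alpha}\cong V^\Psi_{T',\alpha'}$ if and only if $T'=g(T)$ for some $g\in G$ transforming $\alpha$ to $\alpha'$. 2. Any simple smooth $k\langle G\rangle$-module is isomorphic to $V^\Psi_{T,\alpha}$ for some $T$ and $\alpha\in\Pi(T)$. 3. Any $k\langle G\rangle$-module of finite length has a smallest essential submodule and a largest semisimple submodule, and they coincide (the socle). The $k\langle G\rangle$-module $k\langle G/G_T\rangle$ is of finite length, and its socle is $k\otimes V^\Psi_T$. 4. $S^\Psi_{T,\alpha}$ is an injective hull of $V^\Psi_{T,\alpha}$ in $\mathrm{Sm}_k(G)$: it is an injective object of $\mathrm{Sm}_k(G)$ in which $V^\Psi_{T,\alpha}$ is essential. 5. $S^\Psi_{T,\alpha}$ is indecomposable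 for all $T$ and $\alpha\in\Pi(T)$. One has $S^\Psi_{T,\alpha}\cong S^\Psi_{T',\alpha'}$ if and only if $T'=g(T)$ for some $g\in G$ transforming $\alpha$ to $\alpha'$. Any indecomposable injective object of $\mathrm{Sm}_k(G)$ is isomorphic to $S^\Psi_{T,\alpha}$ for some $T$ and $\alpha\in\Pi(T)$. 6. The simple subquotients of the $k\langle G\rangle$-module $k\langle G/G_T\rangle$ are, up to isomorphism, exactly the modules $V^\Psi_{T',\alpha}$ for all $G$-closed $T'\subseteq T$ and all $\alpha\in\Pi(T')$. In particular, passing to injective hulls is a bijection from the set of isomorphism classes of simple objects of $\mathrm{Sm}_k(G)$ to the set of isomorphism classes of its indecomposable injective objects. -/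

import Mathlib

universe u v

noncomputable section

namespace SmoothRep

/-! ### Permutation modules and their two commuting actions -/

section Permutation

variable (R : Type*) [CommRing R] {G : Type*} [Group G] (H : Subgroup G)

/-- The group `N_G(H)/H`. -/
abbrev WeylGroup : Type _ :=
  ↥(Subgroup.normalizer (H : Set G)) ⧸ (H.subgroupOf (Subgroup.normalizer (H : Set G)))

/-- `n ∈ N_G(H)` acts on `G/H` by `[x] ↦ [x n⁻¹]`. -/
def normalizerPerm : ↥(Subgroup.normalizer (H : Set G)) →* Equiv.Perm (G ⧸ H) :=
  MonoidHom.toHomPerm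
    { toFun := fun n => Quotient.map' (fun x : G => x * (n : G)⁻¹) (by
        intro x y hxy
        rw [QuotientGroup.leftRel_apply] at hxy ⊢
        have := (n.2 (x⁻¹ * y)).1 hxy
        simpa [mul_assoc] using this)
      map_one' := by
        funext x
        induction x using QuotientGroup.induction_on with
        | H x => exact congrArg QuotientGroup.mk (by simp)
      map_mul' := by
        intro m n
        funext x
        induction x using QuotientGroup.induction_on with
        | H x => exact congrArg QuotientGroup.mk (by simp [mul_assoc]) }

theorem normalizerPerm_mk (n : ↥(Subgroup.normalizer (H : Set G))) (x : G) :
    normalizerPerm H n (x : G ⧸ H) = ((x * (n : G)⁻¹ : G) : G ⧸ H) := rfl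

/-- The induced action of `N_G(H)/H` on `G/H`. -/
def weylPerm : WeylGroup H →* Equiv.Perm (G ⧸ H) :=
  QuotientGroup.lift _ (normalizerPerm H) (by
    intro n hn
    ext x
    induction x using QuotientGroup.induction_on with
    | H x =>
      rw [normalizerPerm_mk]
      refine QuotientGroup.eq.2 ?_
      have : (n : G) ∈ H := hn
      simpa [mul_assoc] using this)

/-- The module `R⟨G/H⟩` of finite formal `R`-linear combinations of elements of `G/H`. -/
def PermModule : Type _ := (G ⧸ H) →₀ R

instance : AddCommGroup (PermModule R H) := inferInstanceAs (AddCommGroup ((G ⧸ H) →₀ R))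

instance : Module R (PermModule R H) := inferInstanceAs (Module R ((G ⧸ H) →₀ R))

/-- The element `c [x]` of `R⟨G/H⟩`. -/
def PermModule.single (x : G ⧸ H) (c : R) : PermModule R H := Finsupp.single x c

/-- The linear extension to `R⟨G/H⟩` of a self-map of `G/H`. -/
def mapLin (f : G ⧸ H → G ⧸ H) : PermModule R H →ₗ[R] PermModule R H := Finsupp.lmapDomain R R f

theorem mapLin_single (f : G ⧸ H → G ⧸ H) (x : G ⧸ H) (c : R) :
    mapLin R H f (PermModule.single R H x c) = PermModule.single R H (f x) c :=
  Finsupp.mapDomain_single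

theorem mapLin_comp (f g : G ⧸ H → G ⧸ H) :
    mapLin R H (f ∘ g) = mapLin R H f * mapLin R H g :=
  LinearMap.ext fun _ => Finsupp.mapDomain_comp

theorem mapLin_id : mapLin R H id = 1 :=
  LinearMap.ext fun _ => Finsupp.mapDomain_id

/-- The action of `G` on `R⟨G/H⟩` by left translations. -/
def leftRep : Representation R G (PermModule R H) where
  toFun g := mapLin R H (fun x => g • x)
  map_one' := by
    rw [← mapLin_id]
    exact congrArg _ (funext fun x => one_smul G x)
  map_mul' a b := by
    rw [← mapLin_comp]
    exact congrArg _ (funext fun x => mul_smul a b x)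

/-- The action of `N_G(H)/H` on `R⟨G/H⟩`, `[n] : [x] ↦ [x n⁻¹]`. -/
def rightRep : Representation R (WeylGroup H) (PermModule R H) where
  toFun w := mapLin R H (weylPerm H w)
  map_one' := by
    rw [← mapLin_id, map_one]
    rfl
  map_mul' a b := by
    rw [← mapLin_comp, map_mul]
    rfl

/-- `R⟨G/H⟩` as a module over the group algebra `R⟨G⟩`. -/
instance : Module (MonoidAlgebra R G) (PermModule R H) :=
  Module.compHom _ (leftRep R H).asAlgebraHom.toRingHom

/-- `R⟨G/H⟩` as a module over the group algebra `R⟨N_G(H)/H⟩`. -/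
instance : Module (MonoidAlgebra R (WeylGroup H)) (PermModule R H) :=
  Module.compHom _ (rightRep R H).asAlgebraHom.toRingHom

theorem left_smul_def (a : MonoidAlgebra R G) (m : PermModule R H) :
    a • m = (leftRep R H).asAlgebraHom a m := rfl

theorem left_smul_single (g : G) (c d : R) (x : G ⧸ H) :
    MonoidAlgebra.single g c • PermModule.single R H x d = PermModule.single R H (g • x) (c * d) := by
  rw [left_smul_def, Representation.asAlgebraHom_single]
  change c • mapLin R H _ _ = _
  rw [mapLin_single]
  exact Finsupp.smul_single c _ d

theorem right_smul_def (b : MonoidAlgebra R (WeylGroup H)) (m : PermModule R H) :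
    b • m = (rightRep R H).asAlgebraHom b m := rfl

theorem right_smul_single (n : ↥(Subgroup.normalizer (H : Set G))) (c d : R) (x : G) :
    MonoidAlgebra.single (n : WeylGroup H) c • PermModule.single R H (x : G ⧸ H) d =
      PermModule.single R H ((x * (n : G)⁻¹ : G) : G ⧸ H) (c * d) := by
  rw [right_smul_def, Representation.asAlgebraHom_single]
  change c • mapLin R H _ _ = _
  rw [mapLin_single]
  exact Finsupp.smul_single c _ d

theorem weylPerm_smul (w : WeylGroup H) (g : G) (x : G ⧸ H) :
    weylPerm H w (g • x) = g • weylPerm H w x := by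
  induction w using QuotientGroup.induction_on with
  | H n =>
    induction x using QuotientGroup.induction_on with
    | H x => exact congrArg QuotientGroup.mk (mul_assoc g x _)

theorem leftRep_rightRep_comm (g : G) (w : WeylGroup H) :
    Commute (rightRep R H w) (leftRep R H g) := by
  change mapLin R H _ * mapLin R H _ = mapLin R H _ * mapLin R H _
  rw [← mapLin_comp, ← mapLin_comp]
  exact congrArg _ (funext fun x => weylPerm_smul H w g x)

/-- The actions of `R⟨G⟩` and `R⟨N_G(H)/H⟩` on `R⟨G/H⟩` commute. -/
instance : SMulCommClass (MonoidAlgebra R (WeylGroup H)) (MonoidAlgebra R G) (PermModule R H) where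
  smul_comm b a m := by
    have key : Commute ((rightRep R H).asAlgebraHom b) ((leftRep R H).asAlgebraHom a) := by
      induction b using MonoidAlgebra.induction_linear with
      | zero => simp
      | add f g hf hg => rw [map_add]; exact hf.add_left hg
      | single w c =>
        induction a using MonoidAlgebra.induction_linear with
        | zero => simp
        | add f g hf hg => rw [map_add]; exact hf.add_right hg
        | single g d =>
          rw [Representation.asAlgebraHom_single, Representation.asAlgebraHom_single]
          exact ((leftRep_rightRep_comm R H g w).smul_left c).smul_right d
    exact LinearMap.congr_fun key.eq m

end Permutation

/-! ### Permutation groups, closed subsets, the modules `V_T`, `S_{T,α}` and `V_{T,α}` -/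

section Closed

variable (k : Type u) [Field k] {Ψ : Type v} (G : Subgroup (Equiv.Perm Ψ))

/-- `G_T`: the pointwise stabilizer of `T` in `G`. -/
abbrev stab (T : Set Ψ) : Subgroup G := fixingSubgroup G T

/-- `T` is a finite `G`-closed subset: `T` is finite and `T = Ψ^{G_T}`. -/
def FinClosed (T : Set Ψ) : Prop :=
  T.Finite ∧ MulAction.fixedPoints (stab G T) Ψ = T

/-- `Aut(T) = N_G(G_T)/G_T`. -/
abbrev AutT (T : Set Ψ) : Type v := WeylGroup (stab G T)

/-- The common kernel `V_T ⊆ ℤ⟨G/G_T⟩` of all morphisms of `G`-modules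
`ℤ⟨G/G_T⟩ → ℤ⟨G/G_{T'}⟩` for all proper `G`-closed subsets `T' ⊊ T`. -/
def VInt (T : Set Ψ) : Submodule (MonoidAlgebra ℤ G) (PermModule ℤ (stab G T)) :=
  ⨅ (T' : Set Ψ) (_ : FinClosed G T' ∧ T' ⊂ T)
    (π : PermModule ℤ (stab G T) →ₗ[MonoidAlgebra ℤ G] PermModule ℤ (stab G T')),
    LinearMap.ker π

/-- The map `ℤ⟨G/H⟩ → k⟨G/H⟩`. -/
def intToField {G : Type*} [Group G] (H : Subgroup G) : PermModule ℤ H →+ PermModule k H :=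
  Finsupp.mapRange.addMonoidHom (Int.castAddHom k)

/-- `k ⊗ V_T`, as a `k⟨G⟩`-submodule of `k ⊗ ℤ⟨G/G_T⟩ = k⟨G/G_T⟩`. (As `k` is flat over `ℤ`, the map
`k ⊗ V_T → k⟨G/G_T⟩` is injective; its image is spanned by the image of `V_T`.) -/
def VField (T : Set Ψ) : Submodule (MonoidAlgebra k G) (PermModule k (stab G T)) :=
  Submodule.span _ (intToField k (stab G T) '' (VInt G T : Set (PermModule ℤ (stab G T))))

variable (T : Set Ψ) (Γ : Type*) [AddCommGroup Γ] [Module (MonoidAlgebra k (AutT G T)) Γ]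

/-- `S_{T,α} = Hom_{k⟨Aut(T)⟩}(Γ, k⟨G/G_T⟩)`, a `k⟨G⟩`-module through the action on the target,
where `Γ` is a `k⟨Aut(T)⟩`-module in the class `α`. -/
abbrev SMod : Type _ :=
  Γ →ₗ[MonoidAlgebra k (AutT G T)] PermModule k (stab G T)

/-- `V_{T,α} = Hom_{k⟨Aut(T)⟩}(Γ, k ⊗ V_T)`, as a `k⟨G⟩`-submodule of `S_{T,α}`. -/
def VMod : Submodule (MonoidAlgebra k G) (SMod k G T Γ) where
  carrier := {f | ∀ x, f x ∈ VField k G T}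
  add_mem' hf hg x := add_mem (hf x) (hg x)
  zero_mem' _ := zero_mem _
  smul_mem' a _ hf x := Submodule.smul_mem _ a (hf x)

/-- `T' = g(T)` and `g` transforms the class of the `k⟨Aut(T)⟩`-module `Γ` to the class of the
`k⟨Aut(T')⟩`-module `Γ'`: there is a `k`-linear isomorphism `φ : Γ → Γ'` which is equivariant
with respect to the isomorphism `Aut(T) → Aut(T')`, `[n] ↦ [g n g⁻¹]`. -/
def Transforms (g : G) (T T' : Set Ψ)
    (Γ : Type*) [AddCommGroup Γ] [Module (MonoidAlgebra k (AutT G T)) Γ]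
    (Γ' : Type*) [AddCommGroup Γ'] [Module (MonoidAlgebra k (AutT G T')) Γ'] : Prop :=
  (fun x => g • x) '' T = T' ∧
  ∃ φ : Γ ≃+ Γ', ∀ (c : k)
    (n : ↥(Subgroup.normalizer (stab G T : Set G)))
    (n' : ↥(Subgroup.normalizer (stab G T' : Set G))),
    (n' : G) = g * (n : G) * g⁻¹ → ∀ x : Γ,
      φ (MonoidAlgebra.single (n : AutT G T) c • x) =
        MonoidAlgebra.single (n' : AutT G T') c • φ x

end Closed

/-! ### The category of smooth modules and its Gabriel spectrum -/

section Smooth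

variable (k : Type u) [Field k] {Ψ : Type v} (G : Subgroup (Equiv.Perm Ψ))

/-- A `k⟨G⟩`-module is smooth if every stabilizer is open, i.e. contains the pointwise stabilizer of
a finite subset of `Ψ`. -/
def IsSmooth (M : Type*) [AddCommGroup M] [Module (MonoidAlgebra k G) M] : Prop :=
  ∀ m : M, ∃ S : Finset Ψ, ∀ g ∈ stab G (S : Set Ψ), MonoidAlgebra.single g (1 : k) • m = m

/-- `E` is an injective object of the category of smooth `k⟨G⟩`-modules. -/
def IsInjectiveSmooth (E : Type (max u v)) [AddCommGroup E] [Module (MonoidAlgebra k G) E] : Prop :=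
  IsSmooth k G E ∧
  ∀ (X Y : Type (max u v)) [AddCommGroup X] [Module (MonoidAlgebra k G) X]
    [AddCommGroup Y] [Module (MonoidAlgebra k G) Y],
    IsSmooth k G X → IsSmooth k G Y →
    ∀ (i : X →ₗ[MonoidAlgebra k G] Y) (f : X →ₗ[MonoidAlgebra k G] E),
      Function.Injective i → ∃ h : Y →ₗ[MonoidAlgebra k G] E, h ∘ₗ i = f

/-- `X` is a compact (finitely presented) object of the category of smooth `k⟨G⟩`-modules:
`X` is smooth and `Hom(X, -)` commutes with direct limits of directed systems of smooth
`k⟨G⟩`-modules. -/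
def IsCompactSmooth (X : Type (max u v)) [AddCommGroup X] [Module (MonoidAlgebra k G) X] : Prop :=
  IsSmooth k G X ∧
  ∀ (ι : Type (max u v)) [DecidableEq ι] [Preorder ι] [IsDirectedOrder ι] [Nonempty ι]
    (M : ι → Type (max u v)) [∀ i, AddCommGroup (M i)] [∀ i, Module (MonoidAlgebra k G) (M i)]
    (f : ∀ i j, i ≤ j → M i →ₗ[MonoidAlgebra k G] M j) [DirectedSystem M (f · · ·)],
    (∀ i, IsSmooth k G (M i)) →
    (∀ φ : X →ₗ[MonoidAlgebra k G] Module.DirectLimit M f,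
      ∃ (i : ι) (ψ : X →ₗ[MonoidAlgebra k G] M i),
        φ = Module.DirectLimit.of (MonoidAlgebra k G) ι M f i ∘ₗ ψ) ∧
    (∀ (i : ι) (ψ : X →ₗ[MonoidAlgebra k G] M i),
      Module.DirectLimit.of (MonoidAlgebra k G) ι M f i ∘ₗ ψ = 0 →
      ∃ (j : ι) (hij : i ≤ j), f i j hij ∘ₗ ψ = 0)

/-- A non-zero module which is not a direct sum of two non-zero submodules. -/
def IsIndecomposable (A : Type*) [Ring A] (M : Type*) [AddCommGroup M] [Module A M] : Prop :=
  Nontrivial M ∧ ∀ N N' : Submodule A M, IsCompl N N' → N = ⊥ ∨ N' = ⊥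

/-- A submodule meeting every non-zero submodule non-trivially. -/
def IsEssential {A : Type*} [Ring A] {M : Type*} [AddCommGroup M] [Module A M]
    (N : Submodule A M) : Prop :=
  ∀ N' : Submodule A M, N ⊓ N' = ⊥ → N' = ⊥

/-- Smooth `k⟨G⟩`-modules, bundled. -/
structure SmoothModule where
  /-- The underlying type. -/
  carrier : Type (max u v)
  [addCommGroup : AddCommGroup carrier]
  [module : Module (MonoidAlgebra k G) carrier]
  smooth : IsSmooth k G carrier

attribute [instance] SmoothModule.addCommGroup SmoothModule.module

/-- Isomorphism of smooth `k⟨G⟩`-modules, on the modules with a given property. -/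
def isoSetoid (P : SmoothModule k G → Prop) : Setoid {E : SmoothModule k G // P E} where
  r E E' := Nonempty (E.1.carrier ≃ₗ[MonoidAlgebra k G] E'.1.carrier)
  iseqv :=
    { refl := fun _ => ⟨LinearEquiv.refl _ _⟩
      symm := fun ⟨e⟩ => ⟨e.symm⟩
      trans := fun ⟨e⟩ ⟨e'⟩ => ⟨e.trans e'⟩ }

/-- The indecomposable injective smooth `k⟨G⟩`-modules. -/
abbrev IndecInjective : Type _ :=
  {E : SmoothModule k G // IsInjectiveSmooth k G E.carrier ∧
    IsIndecomposable (MonoidAlgebra k G) E.carrier}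

/-- The simple smooth `k⟨G⟩`-modules. -/
abbrev SimpleSmooth : Type _ :=
  {W : SmoothModule k G // IsSimpleModule (MonoidAlgebra k G) W.carrier}

/-- The set of isomorphism classes of simple smooth `k⟨G⟩`-modules. -/
def SimpleClass : Type _ :=
  Quotient (isoSetoid k G fun W => IsSimpleModule (MonoidAlgebra k G) W.carrier)

/-- The set of isomorphism classes of indecomposable injective smooth `k⟨G⟩`-modules. -/
def GabrielSpectrum : Type _ :=
  Quotient (isoSetoid k G fun E => IsInjectiveSmooth k G E.carrier ∧
    IsIndecomposable (MonoidAlgebra k G) E.carrier)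

variable {k G}

/-- The isomorphism class of a simple smooth module. -/
def SimpleClass.mk (W : SimpleSmooth k G) : SimpleClass k G := Quotient.mk _ W

/-- The isomorphism class of an indecomposable injective smooth module. -/
def GabrielSpectrum.mk (E : IndecInjective k G) : GabrielSpectrum k G := Quotient.mk _ E

/-- `[X]`, the set of points `E` with `Hom(X, E) = 0`. -/
def homVanishing (X : SmoothModule k G) : Set (GabrielSpectrum k G) :=
  {p | ∀ E : IndecInjective k G, GabrielSpectrum.mk E = p →
    ∀ f : X.carrier →ₗ[MonoidAlgebra k G] E.1.carrier, f = 0}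

/-- The topology of the Gabriel spectrum, generated by the sets `[X]` for compact objects `X`. -/
instance : TopologicalSpace (GabrielSpectrum k G) :=
  TopologicalSpace.generateFrom
    {U | ∃ X : SmoothModule k G, IsCompactSmooth k G X.carrier ∧ U = homVanishing X}

/-- `E` is an injective hull of `W` in the category of smooth `k⟨G⟩`-modules: `E` is injective and
there is an embedding of `W` onto an essential submodule of `E`. -/
def IsInjectiveHull (W E : SmoothModule k G) : Prop :=
  IsInjectiveSmooth k G E.carrier ∧
  ∃ i : W.carrier →ₗ[MonoidAlgebra k G] E.carrier,
    Function.Injective i ∧ IsEssential (LinearMap.range i)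

end Smooth

/-- `G` is the group of all automorphisms of `Ψ` fixing pointwise a finite subset of `Ψ`, where `Ψ`
is either a plain set or a vector space over a finite field. -/
def IsAutGroupFixingFinite {Ψ : Type v} (G : Subgroup (Equiv.Perm Ψ)) : Prop :=
  ∃ J : Finset Ψ,
    (∀ g : Equiv.Perm Ψ, g ∈ G ↔ ∀ x ∈ J, g x = x) ∨
    (∃ (F : Type) (_ : Field F) (_ : Finite F) (_ : AddCommGroup Ψ) (_ : Module F Ψ),
      ∀ g : Equiv.Perm Ψ, g ∈ G ↔ IsLinearMap F g ∧ ∀ x ∈ J, g x = x)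

end SmoothRep

end

noncomputable section

namespace SmoothRep

/-! ### Finitary properties of the automorphism groups -/

/-! Plain sets and vector spaces over finite fields enter only through the three facts collected in
`Tame`. All later arguments are common to both cases.

The key point is that the modules k⟨G/G_T⟩, for T finite and closed, are injective, cogenerate the
smooth modules, and have very few morphisms between them. Functions on G/G_T invariant under some
G_S form a smooth coinduced module, and morphisms from a smooth M to it are the same as
G_T-invariant functionals on M. Gluing and Neumann's lemma split this coinduced module into the
direct sum of the k⟨G/G_K⟩ over the closed K ⊆ T (`Tame.expand_injective`, `Tame.exists_expand_eq`).
In characteristic zero, averaging over finite subgroups shows that invariant functionals extend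
along injections and detect invariant vectors. Hence each summand k⟨G/G_T⟩ is injective
(`Tame.exists_extension`), and together they cogenerate (`Tame.exists_hom_ne_zero`).

Since orbits are infinite away from fixed points, a morphism k⟨G/G_T⟩ → k⟨G/G_{T'}⟩ is a combination
of right translations by elements x with x(T') ⊆ T. So there are none from k⟨G/G_K⟩ to k⟨G/G_T⟩ when
|K| < |T|, and the endomorphisms of k⟨G/G_T⟩ come from the semisimple algebra k⟨Aut(T)⟩. Let V be
the common kernel of the restrictions to proper closed subsets. The quotient by V embeds into a
product of modules k⟨G/G_K⟩ with K smaller, and by injectivity no submodule of that product maps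
non-trivially to k⟨G/G_T⟩. Therefore V is essential and k⟨Aut(T)⟩ acts on it faithfully.
Cogeneration shows that submodules of V are determined by their annihilators in k⟨Aut(T)⟩, so V is
semisimple of finite length, and induction on |T| gives finite length of k⟨G/G_T⟩. A Morita-type
argument for the two commuting actions makes Hom(Γ, V) simple and Hom(Γ, k⟨G/G_T⟩) its injective
hull, and shows that every simple smooth module is of the first form.

For the spectrum, compact objects are the finitely generated smooth modules, and these have finite
length. Such a module maps non-trivially to only finitely many indecomposable injectives, at most
one for each composition factor, while a simple one maps non-trivially to its hull alone. This
forces the cofinite topology. -/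

/-- The properties of a permutation group used for the study of its smooth representations. -/
structure Tame {Ψ : Type v} (G : Subgroup (Equiv.Perm Ψ)) : Prop where
  /-- Pointwise stabilizers of finite sets fix finitely many points, the other orbits being
  infinite. -/
  orbit : ∀ A : Set Ψ, A.Finite → ∃ D : Set Ψ, D.Finite ∧
    (∀ g ∈ stab G A, ∀ x ∈ D, g • x = x) ∧ ∀ b ∉ D, {y : Ψ | ∃ g ∈ stab G A, g • b = y}.Infinite
  /-- Partial maps inside of a finite set are realized by elements of a finite subgroup. -/
  ext : ∀ R : Set Ψ, R.Finite → ∃ H : Subgroup G, Finite H ∧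
    ∀ (g : G) (S : Set Ψ), S ⊆ R → (∀ s ∈ S, g • s ∈ R) → ∃ h ∈ H, ∀ s ∈ S, h • s = g • s
  /-- Compatible partial maps can be glued with the identity. -/
  glue : ∀ S B : Set Ψ, FinClosed G S → FinClosed G B → ∀ z : G,
    (∀ x ∈ S, x ∈ B → z • x = x) → (∀ b ∈ B, z • b ∈ S → z • b ∈ B) →
    ∃ g ∈ stab G S, ∀ b ∈ B, g • b = z • b

variable {Ψ : Type v}

/-- Complements in a finite set can be matched by counting, and the permutation is then extended by
the identity. Keeping the support inside R is what produces finite subgroups in `Tame.ext`. -/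
theorem exists_perm_extending {R A : Set Ψ} (hR : R.Finite) (hA : A ⊆ R) (f : Ψ → Ψ)
    (hf : Set.InjOn f A) (hfR : ∀ a ∈ A, f a ∈ R) :
    ∃ h : Equiv.Perm Ψ, (∀ a ∈ A, h a = f a) ∧ ∀ x ∉ R, h x = x := by
  classical
  have := hR.to_subtype
  have := Fintype.ofFinite R
  obtain ⟨e, he⟩ := Set.MapsTo.exists_equiv_extend_of_card_eq (α := R) (β := Ψ)
    (t := R.toFinset) (by simp [Set.toFinset_card]) (s := {x : R | (x : Ψ) ∈ A})
    (f := fun x => f x)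
    (by intro x hx; simpa using hfR x hx)
    (by intro x hx y hy h; exact Subtype.ext (hf hx hy h))
  let e' : R ≃ R := e.trans (Equiv.subtypeEquivRight (by simp))
  refine ⟨Equiv.Perm.ofSubtype (p := (· ∈ R)) e', fun a ha => ?_, fun x hx => ?_⟩
  · rw [Equiv.Perm.ofSubtype_apply_of_mem (p := (· ∈ R)) e' (hA ha)]
    exact he ⟨a, hA ha⟩ ha
  · exact Equiv.Perm.ofSubtype_apply_of_not_mem (p := (· ∈ R)) e' hx

theorem mem_stab {G : Subgroup (Equiv.Perm Ψ)} {T : Set Ψ} {g : G} :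
    g ∈ stab G T ↔ ∀ x ∈ T, g • x = x := by
  simp [stab, mem_fixingSubgroup_iff]

open scoped Pointwise in
/-- The elements of `G` that preserve `R` and fix `C` pointwise. -/
def localSubgroup (G : Subgroup (Equiv.Perm Ψ)) (R C : Set Ψ) : Subgroup G :=
  stab G C ⊓ MulAction.stabilizer G R

open scoped Pointwise in
theorem mem_localSubgroup {G : Subgroup (Equiv.Perm Ψ)} {R C : Set Ψ} (hR : R.Finite) {g : G} :
    g ∈ localSubgroup G R C ↔ (∀ x ∈ C, g • x = x) ∧ ∀ x ∈ R, g • x ∈ R := by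
  rw [localSubgroup, Subgroup.mem_inf, mem_stab, MulAction.mem_stabilizer_set' hR]

/-- Such an element is determined by the self-map it induces on the finite set R. In the
applications C is the set-theoretic or the linear complement of R. -/
theorem finite_localSubgroup {G : Subgroup (Equiv.Perm Ψ)} {R C : Set Ψ} (hR : R.Finite)
    (h : ∀ g h : G, (∀ x ∈ C, g • x = h • x) → (∀ x ∈ R, g • x = h • x) → g = h) :
    Finite (localSubgroup G R C) := by
  have := hR.to_subtype
  refine Finite.of_injective
    (fun (g : localSubgroup G R C) (x : R) =>
      (⟨(g : G) • (x : Ψ), ((mem_localSubgroup hR).1 g.2).2 x x.2⟩ : R)) ?_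
  intro g g' hgg
  refine Subtype.ext (h _ _ (fun x hx => ?_) fun x hx => ?_)
  · rw [((mem_localSubgroup hR).1 g.2).1 x hx, ((mem_localSubgroup hR).1 g'.2).1 x hx]
  · exact congrArg Subtype.val (congrFun hgg ⟨x, hx⟩)

theorem tame_of_set [Infinite Ψ] (G : Subgroup (Equiv.Perm Ψ)) (J : Finset Ψ)
    (hG : ∀ g : Equiv.Perm Ψ, g ∈ G ↔ ∀ x ∈ J, g x = x) : Tame G where
  orbit A hA := by
    classical
    have hD : (A ∪ (J : Set Ψ)).Finite := hA.union J.finite_toSet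
    refine ⟨A ∪ J, hD, ?_, ?_⟩
    · rintro g hg x (hx | hx)
      · exact mem_stab.1 hg x hx
      · exact (hG g).1 g.2 x hx
    · intro b hb
      -- The transposition of b with any c outside D lies in G_A, so the orbit of b contains the
      -- infinite complement of D.
      refine hD.infinite_compl.mono fun c hc => ?_
      have hfix : ∀ x ∈ A ∪ (J : Set Ψ), Equiv.swap b c x = x := fun x hx =>
        Equiv.swap_apply_of_ne_of_ne (fun h => hb (h ▸ hx)) (fun h => hc (h ▸ hx))
      exact ⟨⟨Equiv.swap b c, (hG _).2 fun x hx => hfix x (Or.inr hx)⟩,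
        mem_stab.2 fun x hx => hfix x (Or.inl hx), Equiv.swap_apply_left b c⟩
  ext R hR := by
    have hR' : (R ∪ (J : Set Ψ)).Finite := hR.union J.finite_toSet
    refine ⟨localSubgroup G (R ∪ J) (R ∪ J)ᶜ, finite_localSubgroup hR' ?_, ?_⟩
    · intro g h h1 h2
      refine Subtype.ext (Equiv.ext fun x => ?_)
      by_cases hx : x ∈ R ∪ (J : Set Ψ)
      · exact h2 x hx
      · exact h1 x hx
    · intro g S hS hgS
      obtain ⟨h, h1, h2⟩ := exists_perm_extending hR' (A := S ∪ J)
        (Set.union_subset_union_left _ hS) g (g : Equiv.Perm Ψ).injective.injOn (by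
          rintro a (ha | ha)
          · exact Or.inl (hgS a ha)
          · exact Or.inr (by rw [(hG g).1 g.2 a ha]; exact ha))
      have hh : h ∈ G := (hG h).2 fun x hx => by
        rw [h1 x (Or.inr hx)]; exact (hG g).1 g.2 x hx
      refine ⟨⟨h, hh⟩, (mem_localSubgroup hR').2 ⟨h2, fun x hx => ?_⟩,
        fun s hs => h1 s (Or.inl hs)⟩
      -- If h x were outside the finite set, h would fix it, and injectivity would give h x = x.
      by_contra hx'
      have : h (h x) = h x := h2 _ hx'
      exact hx' (by rw [Subgroup.mk_smul, Equiv.Perm.smul_def, h.injective this]; exact hx)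
  glue S B hS hB z h1 h2 := by
    classical
    have hfin := (hS.1.union hB.1).union ((hB.1.image z).union J.finite_toSet)
    have hJS : ∀ x ∈ J, x ∈ S := fun x hx => by
      rw [← hS.2]; exact fun g => (hG g.1).1 g.1.2 x hx
    -- The glued map is the identity on S and z on the rest of B. A collision z • b = s with s in S
    -- puts s in B, so z fixes s and therefore b = s. This gives injectivity.
    obtain ⟨h, h3, -⟩ := exists_perm_extending hfin (A := S ∪ B)
      Set.subset_union_left (fun x => if x ∈ S then x else z • x) (by
        intro a ha b hb hab
        simp only at hab
        split_ifs at hab with haS hbS hbS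
        · exact hab
        · have hbB := hb.resolve_left hbS
          have := h1 _ (hab ▸ haS) (h2 b hbB (hab ▸ haS))
          exact hab.trans ((z : Equiv.Perm Ψ).injective this)
        · have haB := ha.resolve_left haS
          have := h1 _ (hab.symm ▸ hbS) (h2 a haB (hab.symm ▸ hbS))
          exact ((z : Equiv.Perm Ψ).injective this).symm.trans hab
        · exact (z : Equiv.Perm Ψ).injective hab) (by
        intro a ha
        split_ifs with haS
        · exact Or.inl (Or.inl haS)
        · exact Or.inr (Or.inl ⟨a, ha.resolve_left haS, rfl⟩))
    have hS' : ∀ x ∈ S, h x = x := fun x hx => (h3 x (Or.inl hx)).trans (if_pos hx)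
    refine ⟨⟨h, (hG h).2 fun x hx => hS' x (hJS x hx)⟩, mem_stab.2 hS', fun b hb => ?_⟩
    refine (h3 b (Or.inr hb)).trans ?_
    split_ifs with hbS
    · exact (h1 b hbS hb).symm
    · rfl

/-! ### Vector spaces over a finite field. -/

section Linear

variable {F : Type*} [Field F]

theorem exists_linearEquiv_extending {V : Type*} [AddCommGroup V] [Module F V]
    [FiniteDimensional F V] (W : Submodule F V) (f : W →ₗ[F] V) (hf : Function.Injective f) :
    ∃ e : V ≃ₗ[F] V, ∀ w : W, e w = f w := by
  obtain ⟨W₁, h₁⟩ := W.exists_isCompl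
  obtain ⟨W₂, h₂⟩ := (LinearMap.range f).exists_isCompl
  have hdim : Module.finrank F W₁ = Module.finrank F W₂ := by
    have a₁ := Submodule.finrank_add_eq_of_isCompl h₁
    have a₂ := Submodule.finrank_add_eq_of_isCompl h₂
    rw [LinearMap.finrank_range_of_inj hf] at a₂
    omega
  let e₀ := LinearEquiv.ofFinrankEq W₁ W₂ hdim
  let g := LinearMap.ofIsCompl h₁ f (W₂.subtype ∘ₗ e₀.toLinearMap)
  have hg : Function.Surjective g := by
    rw [← LinearMap.range_eq_top, eq_top_iff, ← h₂.sup_eq_top]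
    refine sup_le ?_ ?_
    · rintro _ ⟨w, rfl⟩
      exact ⟨w, LinearMap.ofIsCompl_apply_left h₁ w⟩
    · intro w hw
      refine ⟨e₀.symm ⟨w, hw⟩, (LinearMap.ofIsCompl_apply_right h₁ _).trans ?_⟩
      simp
  exact ⟨LinearEquiv.ofBijective g ⟨LinearMap.injective_iff_surjective.2 hg, hg⟩,
    fun w => LinearMap.ofIsCompl_apply_left h₁ w⟩

variable [AddCommGroup Ψ] [Module F Ψ]

/-- Linear counterpart of `exists_perm_extending`: extend inside the finite-dimensional R, then by
the identity on C. -/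
theorem exists_linearEquiv_extending_of_isCompl {R C W : Submodule F Ψ} [FiniteDimensional F R]
    (hRC : IsCompl R C) (hW : W ≤ R) (f : W →ₗ[F] Ψ) (hf : Function.Injective f)
    (hfR : ∀ w, f w ∈ R) :
    ∃ h : Ψ ≃ₗ[F] Ψ, (∀ w : W, h w = f w) ∧ (∀ x ∈ C, h x = x) ∧ ∀ x ∈ R, h x ∈ R := by
  let f' : Submodule.comap R.subtype W →ₗ[F] R :=
    (f.codRestrict R hfR) ∘ₗ (Submodule.comapSubtypeEquivOfLe hW).toLinearMap
  obtain ⟨e, he⟩ := exists_linearEquiv_extending _ f' (by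
    intro x y hxy
    have : f _ = f _ := congrArg Subtype.val hxy
    exact (Submodule.comapSubtypeEquivOfLe hW).injective (hf this))
  let p := Submodule.prodEquivOfIsCompl R C hRC
  have hp1 : ∀ x : R, p.symm x = (x, 0) := Submodule.prodEquivOfIsCompl_symm_apply_left R C hRC
  have hp2 : ∀ x : C, p.symm x = (0, x) := Submodule.prodEquivOfIsCompl_symm_apply_right R C hRC
  let h := p.symm ≪≫ₗ (e.prodCongr (LinearEquiv.refl F C)) ≪≫ₗ p
  have hR : ∀ x : R, h x = e x := fun x => by simp [h, hp1, p]
  refine ⟨h, fun w => ?_, fun x hx => ?_, fun x hx => ?_⟩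
  · refine (hR ⟨w, hW w.2⟩).trans ?_
    rw [he ⟨⟨w, hW w.2⟩, w.2⟩]
    rfl
  · have := hp2 ⟨x, hx⟩
    simp only at this
    simp [h, this, p]
  · rw [hR ⟨x, hx⟩]
    exact (e _).2

theorem finite_span [Finite F] {A : Set Ψ} (hA : A.Finite) :
    (Submodule.span F A : Set Ψ).Finite := by
  have : Module.Finite F (Submodule.span F A) := Module.Finite.span_of_finite F hA
  have : Finite (Submodule.span F A) := Module.finite_of_finite F
  exact Set.toFinite _

/-- Spans of finite sets are finite over a finite field, so span(A ∪ J) plays the role that A ∪ J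
has for plain sets. Closed sets are subspaces containing J, and linear extensions replace extensions
of injections. -/
theorem tame_of_linear [Finite F] [Infinite Ψ] (G : Subgroup (Equiv.Perm Ψ)) (J : Finset Ψ)
    (hG : ∀ g : Equiv.Perm Ψ, g ∈ G ↔ IsLinearMap F g ∧ ∀ x ∈ J, g x = x) : Tame G := by
  have hlin : ∀ g : G, IsLinearMap F (g : Equiv.Perm Ψ) := fun g => ((hG g).1 g.2).1
  have hJ : ∀ g : G, ∀ x ∈ J, g • x = x := fun g => ((hG g).1 g.2).2
  have hfin : ∀ A : Set Ψ, A.Finite → (Submodule.span F (A ∪ J) : Set Ψ).Finite := fun A hA =>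
    finite_span (hA.union J.finite_toSet)
  have hmk : ∀ h : Ψ ≃ₗ[F] Ψ, (∀ x ∈ J, h x = x) → h.toEquiv ∈ G := fun h hh =>
    (hG _).2 ⟨⟨h.map_add, h.map_smul⟩, hh⟩
  have hfix : ∀ (A : Set Ψ), ∀ g ∈ stab G A, ∀ x ∈ Submodule.span F (A ∪ J), g • x = x := by
    intro A g hg x hx
    induction hx using Submodule.span_induction with
    | mem x hx => exact hx.elim (mem_stab.1 hg x) (hJ g x)
    | zero => exact (hlin g).map_zero
    | add x y _ _ hx hy => exact ((hlin g).map_add x y).trans (congrArg₂ _ hx hy)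
    | smul c x _ hx => exact ((hlin g).map_smul c x).trans (congrArg _ hx)
  have hclosed : ∀ A : Set Ψ, FinClosed G A →
      (Submodule.span F (A ∪ J) : Set Ψ) = A := by
    intro A hA
    refine subset_antisymm (fun x hx => ?_) fun x hx => Submodule.subset_span (Or.inl hx)
    rw [← hA.2]
    exact fun g => hfix A g.1 g.2 x hx
  refine ⟨fun A hA => ⟨_, hfin A hA, hfix A, fun b hb => ?_⟩, fun R hR => ?_, ?_⟩
  -- Take a functional φ vanishing on the span with φ b ≠ 0. By pigeonhole it has an infinite fibre,
  -- whose differences x - x₀ lie in its kernel. The transvections z ↦ z + φ(z)(x - x₀) fix the span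
  -- and move b to infinitely many places.
  · obtain ⟨φ, hφ, hφA⟩ := Submodule.exists_le_ker_of_notMem hb
    obtain ⟨y, hy⟩ := Finite.exists_infinite_fiber φ
    obtain ⟨⟨x₀, hx₀⟩⟩ : Nonempty (φ ⁻¹' {y}) := inferInstance
    refine Set.infinite_of_injective_forall_mem (α := φ ⁻¹' {y})
      (f := fun x => b + φ b • ((x : Ψ) - x₀)) ?_ ?_
    · intro x x' hxx
      simpa [hφ, Subtype.ext_iff] using hxx
    · rintro ⟨x, hx⟩
      have hd : φ (x - x₀) = 0 := by
        rw [map_sub, show φ x = y from hx, show φ x₀ = y from hx₀, sub_self]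
      have ht : ∀ z ∈ Submodule.span F (A ∪ J), LinearEquiv.transvection hd z = z := fun z hz => by
        rw [LinearEquiv.transvection.apply, show φ z = 0 from hφA hz, zero_smul, add_zero]
      refine ⟨⟨_, hmk (LinearEquiv.transvection hd) fun x hx =>
        ht x (Submodule.subset_span (Or.inr hx))⟩,
        mem_stab.2 fun x hx => ht x (Submodule.subset_span (Or.inl hx)), ?_⟩
      exact LinearEquiv.transvection.apply hd b
  · have hR' := hfin R hR
    have : Finite (Submodule.span F (R ∪ J)) := hR'.to_subtype
    obtain ⟨C, hC⟩ := (Submodule.span F (R ∪ J)).exists_isCompl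
    refine ⟨localSubgroup G (Submodule.span F (R ∪ J)) C, finite_localSubgroup hR' ?_, ?_⟩
    · intro g h h1 h2
      have h3 : (hlin g).mk' = (hlin h).mk' :=
        LinearMap.ext_on_codisjoint hC.codisjoint (fun x hx => h2 x hx) (fun x hx => h1 x hx)
      exact Subtype.ext (Equiv.ext fun x => LinearMap.congr_fun h3 x)
    · intro g S hS hgS
      have hmap : ∀ x ∈ Submodule.span F (S ∪ J), g • x ∈ Submodule.span F (R ∪ J) := by
        intro x hx
        induction hx using Submodule.span_induction with
        | mem x hx =>
          refine hx.elim (fun hx => Submodule.subset_span (Or.inl (hgS x hx))) fun hx => ?_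
          rw [hJ g x hx]
          exact Submodule.subset_span (Or.inr hx)
        | zero => exact (congrArg (· ∈ _) (hlin g).map_zero).mpr (zero_mem _)
        | add x y _ _ hx hy => exact (congrArg (· ∈ _) ((hlin g).map_add x y)).mpr (add_mem hx hy)
        | smul c x _ hx =>
          exact (congrArg (· ∈ _) ((hlin g).map_smul c x)).mpr (Submodule.smul_mem _ c hx)
      obtain ⟨h, h1, h2, h3⟩ := exists_linearEquiv_extending_of_isCompl hC
        (W := Submodule.span F (S ∪ J)) (Submodule.span_mono (Set.union_subset_union_left _ hS))
        ((hlin g).mk' ∘ₗ Submodule.subtype _)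
        ((g : Equiv.Perm Ψ).injective.comp Subtype.val_injective) (fun w => hmap w w.2)
      refine ⟨⟨_, hmk h fun x hx => ?_⟩, (mem_localSubgroup hR').2 ⟨h2, h3⟩, fun s hs => ?_⟩
      · exact (h1 ⟨x, Submodule.subset_span (Or.inr hx)⟩).trans (hJ g x hx)
      · exact h1 ⟨s, Submodule.subset_span (Or.inl hs)⟩
  · intro S B hS hB z h1 h2
    set S' := Submodule.span F (S ∪ J)
    set B' := Submodule.span F (B ∪ J)
    have eS : ∀ x, x ∈ S' ↔ x ∈ S := Set.ext_iff.1 (hclosed S hS)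
    have eB : ∀ x, x ∈ B' ↔ x ∈ B := Set.ext_iff.1 (hclosed B hB)
    -- The identity on S and z on B agree on the intersection, so they glue to a linear map on the
    -- sum of the two subspaces.
    let f₁ : Ψ →ₗ.[F] Ψ := ⟨S', S'.subtype⟩
    let f₂ : Ψ →ₗ.[F] Ψ := ⟨B', (hlin z).mk' ∘ₗ B'.subtype⟩
    have H : ∀ (x : f₁.domain) (y : f₂.domain), (x : Ψ) = y → f₁ x = f₂ y := by
      rintro ⟨x, hx⟩ ⟨y, hy⟩ hxy
      obtain rfl : x = y := hxy
      exact (h1 x ((eS _).1 hx) ((eB _).1 hy)).symm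
    have hf : ∀ (x : f₁.domain) (y : f₂.domain) (w : (f₁.sup f₂ H).domain),
        (x : Ψ) + y = w → f₁.sup f₂ H w = f₁ x + f₂ y := fun x y w => LinearPMap.sup_apply H x y w
    have hfS : ∀ x ∈ S, ∀ (w : (f₁.sup f₂ H).domain), x = w → f₁.sup f₂ H w = x := by
      intro x hx w hw
      rw [hf ⟨x, (eS _).2 hx⟩ 0 w (by simpa using hw), f₂.map_zero, add_zero]
      rfl
    have hfB : ∀ x ∈ B, ∀ (w : (f₁.sup f₂ H).domain), x = w → f₁.sup f₂ H w = z • x := by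
      intro x hx w hw
      rw [hf 0 ⟨x, (eB _).2 hx⟩ w (by simpa using hw), f₁.map_zero, zero_add]
      rfl
    have hle₁ : S' ≤ (f₁.sup f₂ H).domain := le_sup_left (a := S')
    have hle₂ : B' ≤ (f₁.sup f₂ H).domain := le_sup_right (b := B')
    -- If s + z • b = 0, then z • b lies in the subspace S. The compatibility hypotheses then give z
    -- • b = b, so s + b = 0.
    have hinj : Function.Injective (f₁.sup f₂ H).toFun := by
      rw [← LinearMap.ker_eq_bot, LinearMap.ker_eq_bot']
      rintro ⟨w, hw⟩ hw0
      obtain ⟨s, hs, b, hb, rfl⟩ := Submodule.mem_sup.1 hw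
      have h4 : s + z • b = 0 := (hf ⟨s, hs⟩ ⟨b, hb⟩ ⟨s + b, hw⟩ rfl).symm.trans hw0
      have h5 : z • b ∈ S := by
        rw [← eS, eq_neg_of_add_eq_zero_right h4]
        exact neg_mem hs
      have h6 := h1 _ h5 (h2 b ((eB _).1 hb) h5)
      have h7 : z • b = b := (z : Equiv.Perm Ψ).injective h6
      exact Subtype.ext ((congrArg (s + ·) h7).symm.trans h4)
    have hfinR := finite_span (F := F) ((hS.1.union hB.1).union ((hB.1.image z).union
      J.finite_toSet))
    set R : Submodule F Ψ := Submodule.span F ((S ∪ B) ∪ ((z : Equiv.Perm Ψ) '' B ∪ J))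
    have : Finite R := hfinR.to_subtype
    obtain ⟨C, hC⟩ := R.exists_isCompl
    have hSR : ∀ s ∈ S', s ∈ R := fun s hs =>
      Submodule.subset_span (Or.inl (Or.inl ((eS s).1 hs)))
    obtain ⟨h, h3, -⟩ := exists_linearEquiv_extending_of_isCompl hC
      (W := (f₁.sup f₂ H).domain) (sup_le hSR fun b hb =>
        Submodule.subset_span (Or.inl (Or.inr ((eB b).1 hb))))
      (f₁.sup f₂ H).toFun hinj (by
        rintro ⟨w, hw⟩
        obtain ⟨s, hs, b, hb, rfl⟩ := Submodule.mem_sup.1 hw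
        refine (congrArg (· ∈ R) (hf ⟨s, hs⟩ ⟨b, hb⟩ ⟨s + b, hw⟩ rfl)).mpr
          (add_mem (hSR s hs) (Submodule.subset_span (Or.inr (Or.inl ⟨b, (eB b).1 hb, rfl⟩)))))
    have hS' : ∀ x ∈ S, h x = x := fun x hx =>
      (h3 ⟨x, hle₁ ((eS _).2 hx)⟩).trans (hfS x hx _ rfl)
    refine ⟨⟨_, hmk h fun x hx => hS' x ?_⟩, mem_stab.2 hS', fun b hb => ?_⟩
    · rw [← eS]
      exact Submodule.subset_span (Or.inr hx)
    · exact (h3 ⟨b, hle₂ ((eB _).2 hb)⟩).trans (hfB b hb _ rfl)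

end Linear

theorem IsAutGroupFixingFinite.tame [Infinite Ψ] {G : Subgroup (Equiv.Perm Ψ)}
    (hG : IsAutGroupFixingFinite G) : Tame G := by
  obtain ⟨J, hJ | ⟨F, _, _, _, _, hJ⟩⟩ := hG
  · exact tame_of_set G J hJ
  · exact tame_of_linear G J hJ

/-! ### Closed subsets and cosets -/

section ClosedSets

open scoped Pointwise

variable {Ψ : Type v} {G : Subgroup (Equiv.Perm Ψ)}

theorem mem_of_finClosed {T : Set Ψ} (hT : FinClosed G T) {x : Ψ}
    (h : ∀ g ∈ stab G T, g • x = x) : x ∈ T := by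
  rw [← hT.2]
  exact fun g => h g.1 g.2

theorem stab_anti {S T : Set Ψ} (h : S ⊆ T) : stab G T ≤ stab G S :=
  fun _ hg => mem_stab.2 fun x hx => mem_stab.1 hg x (h hx)

theorem finClosed_of_mem {T : Set Ψ} (hT : T.Finite)
    (h : ∀ x, (∀ g ∈ stab G T, g • x = x) → x ∈ T) : FinClosed G T :=
  ⟨hT, subset_antisymm (fun x hx => h x fun g hg => hx ⟨g, hg⟩) fun x hx g => mem_stab.1 g.2 x hx⟩

theorem conj_mem_stab {T : Set Ψ} {g h : G} (hh : h ∈ stab G T) : g * h * g⁻¹ ∈ stab G (g • T) := by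
  rw [mem_stab]
  rintro _ ⟨t, ht, rfl⟩
  simp [mul_smul, mem_stab.1 hh t ht]

theorem FinClosed.smul {T : Set Ψ} (hT : FinClosed G T) (g : G) : FinClosed G (g • T) := by
  refine finClosed_of_mem (hT.1.image _) fun x hx => ?_
  rw [Set.mem_smul_set_iff_inv_smul_mem]
  refine mem_of_finClosed hT fun h hh => ?_
  have := hx _ (conj_mem_stab (g := g) hh)
  rw [mul_smul, mul_smul] at this
  exact eq_inv_smul_iff.2 this

theorem FinClosed.inter {S T : Set Ψ} (hS : FinClosed G S) (hT : FinClosed G T) :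
    FinClosed G (S ∩ T) :=
  finClosed_of_mem (hS.1.inter_of_left T) fun _ hx =>
    ⟨mem_of_finClosed hS fun g hg => hx g (stab_anti Set.inter_subset_left hg),
      mem_of_finClosed hT fun g hg => hx g (stab_anti Set.inter_subset_right hg)⟩

/-- The finite set D of `Tame.orbit` works: a point outside it has an infinite orbit and cannot be
fixed. This replaces any finite set by a closed one with the same stabilizer. -/
theorem Tame.exists_finClosed (hG : Tame G) {A : Set Ψ} (hA : A.Finite) :
    ∃ D, FinClosed G D ∧ A ⊆ D ∧ stab G D = stab G A := by
  obtain ⟨D, hD, h1, h2⟩ := hG.orbit A hA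
  have hAD : A ⊆ D := fun a ha => by
    by_contra had
    refine h2 a had ((Set.finite_singleton a).subset ?_)
    rintro y ⟨g, hg, rfl⟩
    exact mem_stab.1 hg a ha
  have hst : stab G D = stab G A :=
    le_antisymm (stab_anti hAD) fun g hg => mem_stab.2 (h1 g hg)
  refine ⟨D, finClosed_of_mem hD fun x hx => ?_, hAD, hst⟩
  by_contra hxD
  refine h2 x hxD ((Set.finite_singleton x).subset ?_)
  rintro y ⟨g, hg, rfl⟩
  exact hx g (hst ▸ hg)

theorem Tame.infinite_orbit (hG : Tame G) {A : Set Ψ} (hA : FinClosed G A) {b : Ψ} (hb : b ∉ A) :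
    {y : Ψ | ∃ g ∈ stab G A, g • b = y}.Infinite := by
  obtain ⟨D, -, h1, h2⟩ := hG.orbit A hA.1
  exact h2 b fun hbD => hb (mem_of_finClosed hA fun g hg => h1 g hg b hbD)

/-- Neumann's lemma. -/
theorem Tame.exists_generic (hG : Tame G) {A B R : Set Ψ} (hA : FinClosed G A) (hB : B.Finite)
    (hR : R.Finite) : ∃ g ∈ stab G A, ∀ b ∈ B, g • b ∈ R → b ∈ A := by
  classical
  by_contra! hcon
  -- If no g works, G_A is covered by the cosets of the elements carrying b to r, one for each b in
  -- B \ A and r in R. One of the point stabilizers then has finite index, so the orbit of some b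
  -- outside A is finite.
  let s : Finset (Ψ × Ψ) := ((hB.sdiff (t := A)).prod hR).toFinset
  let H : Ψ × Ψ → Subgroup (stab G A) := fun p => MulAction.stabilizer (stab G A) p.1
  let c : Ψ × Ψ → stab G A := fun p => if h : ∃ g : stab G A, g • p.1 = p.2 then h.choose else 1
  have hcov : ⋃ p ∈ s, c p • (H p : Set (stab G A)) = Set.univ := by
    refine Set.eq_univ_of_forall fun g => ?_
    obtain ⟨b, hb, hbR, hbA⟩ := hcon g.1 g.2
    have hex : ∃ g' : stab G A, g' • b = g • b := ⟨g, rfl⟩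
    have hc : c (b, g • b) • b = g • b := by
      simp only [c, dif_pos hex]
      exact hex.choose_spec
    refine Set.mem_biUnion (x := (b, g • b)) ?_ ?_
    · simp only [s, Set.Finite.coe_toFinset]
      exact ⟨⟨hb, hbA⟩, hbR⟩
    · rw [Set.mem_smul_set_iff_inv_smul_mem]
      change (c (b, g • b))⁻¹ • g ∈ MulAction.stabilizer (stab G A) b
      rw [MulAction.mem_stabilizer_iff, smul_eq_mul, mul_smul, inv_smul_eq_iff, hc]
  obtain ⟨p, hp, hfin⟩ := Subgroup.exists_finiteIndex_of_leftCoset_cover hcov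
  have hp' : p ∈ (B \ A) ×ˢ R := by simpa only [s, Set.Finite.mem_toFinset] using hp
  refine hG.infinite_orbit hA hp'.1.2 ?_
  have : Finite (MulAction.orbit (stab G A) p.1) :=
    Finite.of_equiv (stab G A ⧸ H p) (MulAction.orbitEquivQuotientStabilizer _ _).symm
  refine (Set.toFinite (MulAction.orbit (stab G A) p.1)).subset ?_
  rintro y ⟨g, hg, rfl⟩
  exact ⟨⟨g, hg⟩, rfl⟩

/-- A coset of G_T is the restriction to T of an element of G. Thus G/G_T is a set of embeddings of
T in Ψ. -/
theorem coset_eq_iff {T : Set Ψ} {x y : G} :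
    (x : G ⧸ stab G T) = y ↔ ∀ t ∈ T, x • t = y • t := by
  rw [QuotientGroup.eq, mem_stab]
  refine forall₂_congr fun t _ => ?_
  rw [mul_smul, inv_smul_eq_iff, eq_comm]

/-- A closed set is recovered from its stabilizer as the set of fixed points, and n • T corresponds
to the conjugate n G_T n⁻¹. -/
theorem mem_normalizer_iff {T : Set Ψ} (hT : FinClosed G T) {n : G} :
    n ∈ Subgroup.normalizer (stab G T : Set G) ↔ n • T = T := by
  constructor
  · intro hn
    refine (hT.1.eq_of_subset_of_card_le ?_ ?_)
    · rintro _ ⟨t, ht, rfl⟩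
      refine mem_of_finClosed hT fun g hg => ?_
      have h1 : n⁻¹ * g * n⁻¹⁻¹ ∈ stab G T := (inv_mem hn g).1 hg
      have := mem_stab.1 h1 t ht
      rwa [inv_inv, mul_smul, mul_smul, inv_smul_eq_iff] at this
    · exact (Set.ncard_image_of_injective T (MulAction.injective n)).ge
  · intro hn g
    have h1 : n⁻¹ • T = T := by rw [inv_smul_eq_iff, hn]
    constructor
    · intro hg
      have := conj_mem_stab (g := n) hg
      rwa [hn] at this
    · intro hg
      have := conj_mem_stab (g := n⁻¹) hg
      rw [h1] at this
      simpa [mul_assoc] using this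

theorem ncard_smul (g : G) (T : Set Ψ) : (g • T).ncard = T.ncard :=
  Set.ncard_image_of_injective T (MulAction.injective g)

theorem smul_eq_of_subset {T : Set Ψ} (hT : T.Finite) {g : G} (h : g • T ⊆ T) : g • T = T :=
  Set.eq_of_subset_of_ncard_le h (ncard_smul g T).ge hT

theorem finite_cosets_subset {T S : Set Ψ} (hT : T.Finite) (hS : S.Finite) :
    {z : G ⧸ stab G T | ∃ x : G, (x : G ⧸ stab G T) = z ∧ x • T ⊆ S}.Finite := by
  have := hT.to_subtype
  have := hS.to_subtype
  choose! r h1 h2 using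
    fun z (hz : z ∈ {z : G ⧸ stab G T | ∃ x : G, (x : G ⧸ stab G T) = z ∧ x • T ⊆ S}) => hz
  refine Set.Finite.of_injOn (f := fun z => fun t : T => r z • (t : Ψ))
    (t := {f : T → Ψ | ∀ t, f t ∈ S}) ?_ ?_ ?_
  · exact fun z hz t => h2 z hz ⟨t, t.2, rfl⟩
  · intro z hz w hw hzw
    rw [← h1 z hz, ← h1 w hw, coset_eq_iff]
    exact fun t ht => congrFun hzw ⟨t, ht⟩
  · exact (Set.Finite.pi' fun _ => hS)

theorem finite_autT {T : Set Ψ} (hT : FinClosed G T) : Finite (AutT G T) := by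
  have hfin := finite_cosets_subset (G := G) hT.1 hT.1
  have := hfin.to_subtype
  refine Finite.of_injective (β := {z : G ⧸ stab G T | ∃ x : G, (x : G ⧸ stab G T) = z ∧ x • T ⊆ T})
    (fun w => ⟨Quotient.liftOn' w (fun n => ((n : G) : G ⧸ stab G T)) ?_, ?_⟩) ?_
  · intro a b hab
    rw [QuotientGroup.leftRel_apply] at hab
    exact QuotientGroup.eq.2 hab
  · induction w using QuotientGroup.induction_on with
    | H n => exact ⟨n, rfl, ((mem_normalizer_iff hT).1 n.2).le⟩
  · intro a b hab
    induction a using QuotientGroup.induction_on with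
    | H a =>
      induction b using QuotientGroup.induction_on with
      | H b =>
        have h : ((a : G) : G ⧸ stab G T) = (b : G) := congrArg Subtype.val hab
        have h' := QuotientGroup.eq.1 h
        exact QuotientGroup.eq.2 h'

end ClosedSets

/-! ### Coefficients and morphisms of permutation modules -/

section PermutationModules

variable {R : Type*} [CommRing R] {G : Type*} [Group G] {H : Subgroup G}

/-- The coefficients of an element of `R⟨G/H⟩`. -/
def PermModule.coeff : PermModule R H →ₗ[R] (G ⧸ H → R) := Finsupp.lcoeFun

/-- The support of an element of `R⟨G/H⟩`. -/
def PermModule.support (p : PermModule R H) : Finset (G ⧸ H) := Finsupp.support p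

theorem PermModule.mem_support {p : PermModule R H} {x : G ⧸ H} :
    x ∈ p.support ↔ PermModule.coeff p x ≠ 0 := Finsupp.mem_support_iff

theorem PermModule.ext {p q : PermModule R H}
    (h : ∀ x, PermModule.coeff p x = PermModule.coeff q x) : p = q := Finsupp.ext h

theorem PermModule.coeff_single [DecidableEq (G ⧸ H)] (x y : G ⧸ H) (c : R) :
    PermModule.coeff (PermModule.single R H x c) y = if x = y then c else 0 := by
  classical
  exact Finsupp.single_apply.trans (by congr)

theorem PermModule.exists_coeff_eq (f : G ⧸ H → R) (hf : (Function.support f).Finite) :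
    ∃ p : PermModule R H, PermModule.coeff p = f :=
  ⟨Finsupp.ofSupportFinite f hf, rfl⟩

@[elab_as_elim]
theorem PermModule.induction {motive : PermModule R H → Prop} (p : PermModule R H)
    (zero : motive 0) (add : ∀ p q, motive p → motive q → motive (p + q))
    (single : ∀ x c, motive (PermModule.single R H x c)) : motive p :=
  Finsupp.induction_linear p zero add single

theorem coeff_smul (g : G) (p : PermModule R H) (x : G ⧸ H) :
    PermModule.coeff (MonoidAlgebra.single g (1 : R) • p) x = PermModule.coeff p (g⁻¹ • x) := by
  classical
  induction p using PermModule.induction with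
  | zero => rw [smul_zero, map_zero]; rfl
  | add p q hp hq => rw [smul_add, map_add, map_add, Pi.add_apply, Pi.add_apply, hp, hq]
  | single y c =>
    rw [left_smul_single, one_mul, PermModule.coeff_single, PermModule.coeff_single]
    simp only [eq_inv_smul_iff]

instance : IsScalarTower R (MonoidAlgebra R G) (PermModule R H) where
  smul_assoc c a p := by
    rw [left_smul_def, left_smul_def, map_smul, LinearMap.smul_apply]

variable {M : Type*} [AddCommGroup M] [Module (MonoidAlgebra R G) M]

theorem single_mul_smul (g h : G) (c d : R) (m : M) :
    MonoidAlgebra.single (g * h) (c * d) • m =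
      MonoidAlgebra.single g c • MonoidAlgebra.single h d • m := by
  rw [smul_smul, MonoidAlgebra.single_mul_single]

/-- The morphism `R⟨G/H⟩ → M` corresponding to an `H`-invariant element of `M`. -/
def PermModule.lift (m : M) (hm : ∀ h ∈ H, MonoidAlgebra.single h (1 : R) • m = m) :
    PermModule R H →ₗ[MonoidAlgebra R G] M :=
  have key : ∀ (x : G) (c : R), MonoidAlgebra.single (Quotient.out (x : G ⧸ H)) c • m =
      MonoidAlgebra.single x c • m := by
    intro x c
    obtain ⟨h, hh⟩ := QuotientGroup.mk_out_eq_mul H x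
    rw [hh, ← mul_one c, single_mul_smul, hm h.1 h.2, mul_one]
  let φ : PermModule R H →+ M := Finsupp.liftAddHom fun x =>
    ((smulAddHom (MonoidAlgebra R G) M).flip m).comp
      (MonoidAlgebra.singleAddHom (Quotient.out x))
  have hφ : ∀ (x : G) (c : R), φ (PermModule.single R H x c) = MonoidAlgebra.single x c • m :=
    fun x c => (Finsupp.liftAddHom_apply_single _ _ _).trans (key x c)
  { φ with
    map_smul' := fun a p => by
      change φ (a • p) = a • φ p
      induction a using MonoidAlgebra.induction_linear with
      | zero => rw [zero_smul, zero_smul, map_zero]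
      | add a b ha hb => rw [add_smul, add_smul, map_add, ha, hb]
      | single g d =>
        induction p using PermModule.induction with
        | zero => rw [smul_zero, map_zero, smul_zero]
        | add p q hp hq => rw [smul_add, map_add, map_add, smul_add, hp, hq]
        | single x c =>
          induction x using QuotientGroup.induction_on with
          | H x =>
            rw [left_smul_single, hφ, ← single_mul_smul]
            exact hφ (g * x) (d * c) }

theorem PermModule.lift_single (m : M) (hm : ∀ h ∈ H, MonoidAlgebra.single h (1 : R) • m = m)
    (x : G) (c : R) :
    PermModule.lift m hm (PermModule.single R H x c) = MonoidAlgebra.single x c • m := by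
  refine (Finsupp.liftAddHom_apply_single _ _ _).trans ?_
  obtain ⟨h, hh⟩ := QuotientGroup.mk_out_eq_mul H x
  change MonoidAlgebra.single (Quotient.out (x : G ⧸ H)) c • m = _
  rw [hh, ← mul_one c, single_mul_smul, hm h.1 h.2, mul_one]

theorem PermModule.single_eq_smul (x : G) (c : R) :
    PermModule.single R H x c = MonoidAlgebra.single x c • PermModule.single R H ((1 : G) : G ⧸ H) 1 := by
  rw [left_smul_single, mul_one]
  exact congrArg (PermModule.single R H · c) (congrArg QuotientGroup.mk (mul_one x).symm)

theorem PermModule.hom_ext {f g : PermModule R H →ₗ[MonoidAlgebra R G] M}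
    (h : f (PermModule.single R H ((1 : G) : G ⧸ H) 1) =
      g (PermModule.single R H ((1 : G) : G ⧸ H) 1)) : f = g := by
  ext p
  induction p using PermModule.induction with
  | zero => rw [map_zero, map_zero]
  | add p q hp hq => rw [map_add, map_add, hp, hq]
  | single x c =>
    induction x using QuotientGroup.induction_on with
    | H x => rw [PermModule.single_eq_smul, map_smul, map_smul, h]

theorem PermModule.single_one_invariant (g : G) (hg : g ∈ H) :
    MonoidAlgebra.single g (1 : R) • PermModule.single R H ((1 : G) : G ⧸ H) 1 =
      PermModule.single R H ((1 : G) : G ⧸ H) 1 := by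
  rw [left_smul_single, mul_one]
  refine congrArg (PermModule.single R H · 1) ?_
  exact QuotientGroup.eq.2 (by simpa using hg)

end PermutationModules

/-! ### Smooth functions on `G/G_T` -/

section Expansion

open scoped Pointwise

variable {k : Type u} [Field k] {Ψ : Type v} {G : Subgroup (Equiv.Perm Ψ)} {T : Set Ψ}

/-- The closed subsets of `T`. -/
def ClosedSub (G : Subgroup (Equiv.Perm Ψ)) (T : Set Ψ) : Type v :=
  {K : Set Ψ // FinClosed G K ∧ K ⊆ T}

theorem finite_closedSub (hT : T.Finite) : Finite (ClosedSub G T) :=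
  (hT.finite_subsets.subset fun _ h => h.2 : {K : Set Ψ | FinClosed G K ∧ K ⊆ T}.Finite).to_subtype

/-- The part of `T` which is mapped by `x` to `S`. -/
def meetSet (S T : Set Ψ) (x : G) : Set Ψ := {t ∈ T | x • t ∈ S}

theorem finClosed_meetSet {S : Set Ψ} (hS : FinClosed G S) (hT : FinClosed G T) (x : G) :
    FinClosed G (meetSet S T x) := by
  have : SmoothRep.meetSet S T x = T ∩ x⁻¹ • S := by
    ext t
    simp [SmoothRep.meetSet, Set.mem_smul_set_iff_inv_smul_mem]
  rw [this]
  exact hT.inter (hS.smul _)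

/-- A function invariant under G_S on the left and G_T on the right sees only the part of the
embedding x of T that lands in S. Gluing the identity of S with y x⁻¹ on x • T gives an element of
G_S that carries the coset of x to that of y. -/
theorem Tame.eq_of_meetSet_eq (hG : Tame G) {S : Set Ψ} (hS : FinClosed G S) (hT : FinClosed G T)
    {β : Type*} {f : G → β} (hfS : ∀ g ∈ stab G S, ∀ x, f (g * x) = f x)
    (hfT : ∀ h ∈ stab G T, ∀ x, f (x * h) = f x) {x y : G} (hxy : meetSet S T x = meetSet S T y)
    (h : ∀ t ∈ meetSet S T x, x • t = y • t) : f x = f y := by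
  obtain ⟨g, hg, hgz⟩ := hG.glue S (x • T) hS (hT.smul x) (y * x⁻¹) (by
    rintro _ hs ⟨t, ht, rfl⟩
    simpa [mul_smul] using (h t ⟨ht, hs⟩).symm) (by
    rintro _ ⟨t, ht, rfl⟩ hs
    simp only [mul_smul, inv_smul_smul] at hs ⊢
    have : t ∈ meetSet S T x := hxy ▸ ⟨ht, hs⟩
    rw [← h t this]
    exact ⟨t, ht, rfl⟩)
  have hcos : ((g * x : G) : G ⧸ stab G T) = y := coset_eq_iff.2 fun t ht => by
    have := hgz (x • t) ⟨t, ht, rfl⟩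
    rwa [mul_smul, inv_smul_smul, ← mul_smul] at this
  have hmem := QuotientGroup.eq.1 hcos
  rw [← hfS g hg x, ← hfT _ hmem (g * x), mul_inv_cancel_left]

variable (k T) in
/-- The function on `G` (in fact, on `G/G_T`) given by a family of finitely supported functions on
`G/G_K` for all closed `K ⊆ T`. -/
def expand [Fintype (ClosedSub G T)] :
    (∀ K : ClosedSub G T, PermModule k (stab G K.1)) →ₗ[k] (G → k) where
  toFun p x := ∑ K : ClosedSub G T, PermModule.coeff (p K) (x : G ⧸ stab G K.1)
  map_add' p q := by
    ext x
    simp [Finset.sum_add_distrib]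
  map_smul' c p := by
    ext x
    simp [Finset.mul_sum]

variable [Fintype (ClosedSub G T)]

theorem expand_apply (p : ∀ K : ClosedSub G T, PermModule k (stab G K.1)) (x : G) :
    expand k T p x = ∑ K : ClosedSub G T, PermModule.coeff (p K) (x : G ⧸ stab G K.1) := rfl

theorem expand_smul (g : G) (p : ∀ K : ClosedSub G T, PermModule k (stab G K.1)) (x : G) :
    expand k T (MonoidAlgebra.single g (1 : k) • p) x = expand k T p (g⁻¹ * x) := by
  simp only [expand_apply, Pi.smul_apply, coeff_smul]
  rfl

/-- Take K minimal among the closed sets with a non-zero component and a coset x in its support.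
Multiply x by a generic g in G_K, which moves the rest of T away from all supports: only the
K-component survives at x g, and its coefficient there is the one at x. -/
theorem Tame.expand_injective (hG : Tame G) (hT : FinClosed G T) :
    Function.Injective (expand (G := G) k T) := by
  rw [← LinearMap.ker_eq_bot, LinearMap.ker_eq_bot']
  intro p hp
  by_contra hne
  obtain ⟨K₀, hK₀⟩ := Function.ne_iff.1 hne
  obtain ⟨K, hK, hmin⟩ := Set.exists_min_image {K : ClosedSub G T | p K ≠ 0} (fun K => K.1.ncard)
    (Set.toFinite _) ⟨K₀, hK₀⟩
  obtain ⟨z, hz⟩ : ∃ z, PermModule.coeff (p K) z ≠ 0 := by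
    by_contra! h
    exact hK (PermModule.ext fun z => by rw [h z, map_zero]; rfl)
  induction z using QuotientGroup.induction_on with
  | H x =>
    -- All images of closed subsets under the cosets occurring in the supports. Transported by x⁻¹,
    -- this is the finite set that g must avoid.
    let R : Set Ψ := ⋃ K' : ClosedSub G T, ⋃ z ∈ (p K').support, z.out • K'.1
    have hR : R.Finite := Set.finite_iUnion fun K' =>
      (p K').support.finite_toSet.biUnion fun z _ => K'.2.1.1.image _
    obtain ⟨g, hg, hgR⟩ := hG.exists_generic K.2.1 hT.1 (hR.image fun r => x⁻¹ • r)
    -- A contribution of K' puts x g K' inside R, so genericity gives K' ⊆ K, and minimality of |K|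
    -- gives K' = K.
    have hzero : ∀ K' ≠ K, PermModule.coeff (p K') ((x * g : G) : G ⧸ stab G K'.1) = 0 := by
      intro K' hK'
      by_contra h0
      have hsub : K'.1 ⊆ K.1 := by
        intro b hb
        refine hgR b (K'.2.2 hb) ⟨x • g • b, ?_, inv_smul_smul _ _⟩
        refine Set.mem_iUnion.2 ⟨K', Set.mem_biUnion (PermModule.mem_support.2 h0) ⟨b, hb, ?_⟩⟩
        rw [← mul_smul]
        exact coset_eq_iff.1 (QuotientGroup.out_eq' _) b hb
      refine hK' (Subtype.ext (Set.eq_of_subset_of_ncard_le hsub (hmin K' fun h => h0 ?_) K.2.1.1))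
      rw [h, map_zero]
      rfl
    have hsum := congrFun hp (x * g)
    rw [expand_apply, Finset.sum_eq_single K (fun K' _ => hzero K') (by simp)] at hsum
    refine hz (Eq.trans ?_ hsum)
    have hxg : (x : G ⧸ stab G K.1) = ((x * g : G) : G ⧸ stab G K.1) :=
      coset_eq_iff.2 fun t ht => by rw [mul_smul, mem_stab.1 hg t ht]
    rw [hxg]

/-- Induction on layers: f is supported where the part of T sent into S has more than |T| - j
elements. The smallest layer allowed is removed by subtracting an expansion with components on the
closed K of that size, since there f depends only on the restriction of x to K. Writing sizes as
sums avoids truncated subtraction. -/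
theorem Tame.exists_expand_eq_aux (hG : Tame G) {S : Set Ψ} (hS : FinClosed G S)
    (hT : FinClosed G T) (j : ℕ) (f : G → k) (hfS : ∀ g ∈ stab G S, ∀ x, f (g * x) = f x)
    (hfT : ∀ h ∈ stab G T, ∀ x, f (x * h) = f x)
    (hj : ∀ x, (meetSet S T x).ncard + j ≤ T.ncard → f x = 0) : ∃ p, expand k T p = f := by
  classical
  induction j generalizing f with
  | zero =>
    refine ⟨0, ?_⟩
    rw [map_zero]
    ext x
    exact (hj x (Set.ncard_le_ncard (Set.sep_subset _ _) hT.1)).symm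
  | succ j ih =>
    -- Q selects the closed sets of the current size together with the cosets that send exactly K
    -- into S for some representative. The function c then reads off the value of f at such a
    -- representative.
    let Q : (K : ClosedSub G T) → G ⧸ stab G K.1 → Prop := fun K z =>
      K.1.ncard + j = T.ncard ∧ ∃ x : G, (x : G ⧸ stab G K.1) = z ∧ meetSet S T x = K.1
    let c : (K : ClosedSub G T) → G ⧸ stab G K.1 → k := fun K z =>
      if h : Q K z then f h.2.choose else 0
    have hQ : ∀ {K : ClosedSub G T} {x : G}, Q K x → ∀ t ∈ K.1, x • t ∈ S := by
      rintro K x ⟨-, y, hyx, hy⟩ t ht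
      rw [← coset_eq_iff.1 hyx t ht]
      exact (hy.symm ▸ ht : t ∈ meetSet S T y).2
    have hc : ∀ {K : ClosedSub G T} {x : G}, K.1.ncard + j = T.ncard → meetSet S T x = K.1 →
        c K x = f x := by
      intro K x hKj hx
      have h : Q K x := ⟨hKj, x, rfl, hx⟩
      simp only [c, dif_pos h]
      obtain ⟨h1, h2⟩ := h.2.choose_spec
      exact hG.eq_of_meetSet_eq hS hT hfS hfT (h2.trans hx.symm) fun t ht =>
        coset_eq_iff.1 h1 t (h2 ▸ ht)
    have hfin : ∀ K, (Function.support (c K)).Finite := by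
      intro K
      refine (finite_cosets_subset K.2.1.1 hS.1).subset fun z hz => ?_
      induction z using QuotientGroup.induction_on with
      | H x =>
        have h : Q K x := by
          by_contra h
          exact hz (dif_neg h)
        refine ⟨x, rfl, ?_⟩
        rintro _ ⟨t, ht, rfl⟩
        exact hQ h t ht
    choose p hp using fun K => PermModule.exists_coeff_eq (c K) (hfin K)
    have hpe : ∀ x, expand k T p x = ∑ K : ClosedSub G T, c K x := fun x =>
      Finset.sum_congr rfl fun K _ => congrFun (hp K) x
    have hcS : ∀ K, ∀ g ∈ stab G S, ∀ x : G, c K ((g * x : G) : G ⧸ stab G K.1) = c K x := by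
      have key : ∀ K, ∀ g ∈ stab G S, ∀ x : G, Q K x →
          ((g * x : G) : G ⧸ stab G K.1) = x := fun K g hg x h => coset_eq_iff.2 fun t ht => by
        rw [mul_smul, mem_stab.1 hg _ (hQ h t ht)]
      intro K g hg x
      by_cases h : Q K x
      · rw [key K g hg x h]
      · have h' : ¬ Q K ((g * x : G) : G ⧸ stab G K.1) := fun h' => by
          have := key K g⁻¹ (inv_mem hg) _ h'
          rw [inv_mul_cancel_left] at this
          exact h (this ▸ h')
        rw [show c K x = 0 from dif_neg h]
        exact dif_neg h'
    obtain ⟨q, hq⟩ := ih (f - expand k T p) (fun g hg x => by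
        simp only [Pi.sub_apply, hpe, hfS g hg, hcS _ g hg]) (fun h hh x => by
        have hKx : ∀ K : ClosedSub G T, ((x * h : G) : G ⧸ stab G K.1) = x := fun K =>
          (QuotientGroup.eq.2 (by simpa using stab_anti K.2.2 hh)).symm
        simp only [Pi.sub_apply, hpe, hfT h hh, hKx]) (by
      intro x hx
      -- Any K' contributing at x is contained in this K and has the size of the current layer,
      -- which is at least that of K. So only K itself can contribute.
      let K : ClosedSub G T := ⟨meetSet S T x, finClosed_meetSet hS hT x, Set.sep_subset _ _⟩
      have hne : ∀ K' ≠ K, c K' x = 0 := by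
        intro K' hK'
        by_contra h0
        have h : Q K' x := by
          by_contra h
          exact h0 (dif_neg h)
        have hsub : K'.1 ⊆ K.1 := fun t ht => ⟨K'.2.2 ht, hQ h t ht⟩
        refine hK' (Subtype.ext (Set.eq_of_subset_of_ncard_le hsub ?_ K.2.1.1))
        have := h.1
        change (meetSet S T x).ncard ≤ _
        omega
      rw [Pi.sub_apply, hpe, Finset.sum_eq_single K (fun K' _ => hne K') (by simp)]
      rcases hx.lt_or_eq with hlt | heq
      · have h : ¬ Q K x := fun h => hlt.ne h.1
        rw [hj x (by omega), show c K x = 0 from dif_neg h, sub_zero]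
      · rw [hc heq rfl, sub_self])
    exact ⟨q + p, by rw [map_add, hq, sub_add_cancel]⟩

theorem Tame.exists_expand_eq (hG : Tame G) {S : Set Ψ} (hS : S.Finite)
    (hT : FinClosed G T) (f : G → k) (hfS : ∀ g ∈ stab G S, ∀ x, f (g * x) = f x)
    (hfT : ∀ h ∈ stab G T, ∀ x, f (x * h) = f x) : ∃ p, expand k T p = f := by
  obtain ⟨D, hD, -, hst⟩ := hG.exists_finClosed hS
  -- For this value of j the vanishing hypothesis is vacuous.
  exact hG.exists_expand_eq_aux hD hT (T.ncard + 1) f (hst ▸ hfS) hfT (by omega)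

end Expansion

/-! ### Averaging, invariant functionals and injectivity -/

section Averaging

variable {k : Type u} [Field k] {Ψ : Type v} {G : Subgroup (Equiv.Perm Ψ)}

/-- `H` is a group of elements of `G_T` realizing all partial maps inside of `R` induced by
elements of `G_T`. -/
def RealizesPartialMaps (H : Subgroup G) (T R : Set Ψ) : Prop :=
  H ≤ stab G T ∧ ∀ g ∈ stab G T, ∀ S ⊆ R, (∀ s ∈ S, g • s ∈ R) → ∃ h ∈ H, ∀ s ∈ S, h • s = g • s

theorem Tame.exists_realizesPartialMaps (hG : Tame G) {T R : Set Ψ} (hT : T.Finite)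
    (hR : R.Finite) : ∃ H : Subgroup G, Finite H ∧ RealizesPartialMaps H T R := by
  obtain ⟨H, hH, h⟩ := hG.ext (R ∪ T) (hR.union hT)
  refine ⟨H ⊓ stab G T, Finite.of_injective (Subgroup.inclusion inf_le_left)
    (Subgroup.inclusion_injective _), inf_le_right, fun g hg S hS hgS => ?_⟩
  -- Adjoining T to the domain of the partial map forces the realizing element to lie in G_T.
  obtain ⟨h, hh, hhg⟩ := h g (S ∪ T) (Set.union_subset_union_left T hS) (by
    rintro s (hs | hs)
    · exact Or.inl (hgS s hs)
    · exact Or.inr ((mem_stab.1 hg s hs).symm ▸ hs))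
  exact ⟨h, ⟨hh, mem_stab.2 fun t ht => (hhg t (Or.inr ht)).trans (mem_stab.1 hg t ht)⟩,
    fun s hs => hhg s (Or.inl hs)⟩

section Module

variable {M : Type*} [AddCommGroup M] [Module (MonoidAlgebra k G) M] [Module k M]
  [IsScalarTower k (MonoidAlgebra k G) M]

theorem single_smul_eq (g : G) (c : k) (m : M) :
    MonoidAlgebra.single g c • m = c • MonoidAlgebra.single g (1 : k) • m := by
  rw [← smul_assoc, MonoidAlgebra.smul_single, smul_eq_mul, mul_one]

variable (k G M) in
/-- The kernel of the projection of `M` to the space of `G_T`-coinvariants. -/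
def coinvKer (T : Set Ψ) : Submodule k M :=
  Submodule.span k {z | ∃ g ∈ stab G T, ∃ m : M, z = MonoidAlgebra.single g (1 : k) • m - m}

/-- If m is fixed by G_S, then g m = h m for any h agreeing with g on S, and such an h exists in H
once R contains S and g(S). The sum over H of h m - m then cancels. Allowing every R containing R₀
lets finitely many such elements share one group. -/
theorem exists_sum_eq_zero_of_mem_coinvKer (hM : IsSmooth k G M) {T : Set Ψ} {z : M}
    (hz : z ∈ coinvKer k G M T) : ∃ R₀ : Set Ψ, R₀.Finite ∧ ∀ R, R₀ ⊆ R →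
      ∀ (H : Subgroup G) [Fintype H], RealizesPartialMaps H T R →
        ∑ h : H, MonoidAlgebra.single (h : G) (1 : k) • z = 0 := by
  have hcomm : SMulCommClass k (MonoidAlgebra k G) M := IsScalarTower.to_smulCommClass
  induction hz using Submodule.span_induction with
  | mem z hz =>
    obtain ⟨g, hg, m, rfl⟩ := hz
    obtain ⟨S, hS⟩ := hM m
    refine ⟨S ∪ (fun x => g • x) '' S, S.finite_toSet.union (S.finite_toSet.image _), ?_⟩
    intro R hR H _ hH
    obtain ⟨h, hhH, hh⟩ := hH.2 g hg S (Set.subset_union_left.trans hR)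
      fun s hs => hR (Or.inr ⟨s, hs, rfl⟩)
    have hgm : MonoidAlgebra.single g (1 : k) • m = MonoidAlgebra.single h (1 : k) • m := by
      have := hS (h⁻¹ * g) (mem_stab.2 fun s hs => by
        rw [mul_smul, inv_smul_eq_iff]
        exact (hh s hs).symm)
      conv_rhs => rw [← this, ← single_mul_smul, mul_inv_cancel_left, mul_one]
    rw [hgm]
    simp only [smul_sub, Finset.sum_sub_distrib, ← single_mul_smul, mul_one]
    rw [sub_eq_zero]
    exact Fintype.sum_equiv (Equiv.mulRight (⟨h, hhH⟩ : H)) _ _ fun _ => rfl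
  | zero => exact ⟨∅, Set.finite_empty, fun _ _ _ _ _ => by simp⟩
  | add x y _ _ hx hy =>
    obtain ⟨R₁, h₁, hx⟩ := hx
    obtain ⟨R₂, h₂, hy⟩ := hy
    refine ⟨R₁ ∪ R₂, h₁.union h₂, fun R hR H _ hH => ?_⟩
    simp only [smul_add, Finset.sum_add_distrib]
    rw [hx R (Set.subset_union_left.trans hR) H hH, hy R (Set.subset_union_right.trans hR) H hH,
      add_zero]
  | smul c x _ hx =>
    obtain ⟨R₁, h₁, hx⟩ := hx
    refine ⟨R₁, h₁, fun R hR H _ hH => ?_⟩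
    simp only [smul_comm _ c]
    rw [← Finset.smul_sum, hx R hR H hH, smul_zero]

theorem Tame.exists_sum_eq_zero (hG : Tame G) (hM : IsSmooth k G M) {T : Set Ψ} (hT : T.Finite)
    {z : M} (hz : z ∈ coinvKer k G M T) : ∃ (H : Subgroup G) (_ : Fintype H), H ≤ stab G T ∧
      ∑ h : H, MonoidAlgebra.single (h : G) (1 : k) • z = 0 := by
  obtain ⟨R, hR, h⟩ := exists_sum_eq_zero_of_mem_coinvKer hM hz
  obtain ⟨H, hH, hr⟩ := hG.exists_realizesPartialMaps hT hR
  have := Fintype.ofFinite H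
  exact ⟨H, this, hr.1, h R subset_rfl H hr⟩

omit [IsScalarTower k (MonoidAlgebra k G) M] in
theorem invariant_of_le_ker {T : Set Ψ} {l : M →ₗ[k] k} (hl : coinvKer k G M T ≤ LinearMap.ker l)
    (g : G) (hg : g ∈ stab G T) (m : M) : l (MonoidAlgebra.single g (1 : k) • m) = l m := by
  rw [← sub_eq_zero, ← map_sub]
  exact hl (Submodule.subset_span ⟨g, hg, m, rfl⟩)

variable [CharZero k]

/-- An invariant vector survives in the coinvariants: otherwise its sum over a finite group H, which
is |H| m, would vanish, contrary to characteristic zero. -/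
theorem Tame.exists_functional_ne_zero (hG : Tame G) (hM : IsSmooth k G M) {T : Set Ψ}
    (hT : T.Finite) {m : M} (hm : m ≠ 0)
    (hfix : ∀ g ∈ stab G T, MonoidAlgebra.single g (1 : k) • m = m) :
    ∃ l : M →ₗ[k] k, (∀ g ∈ stab G T, ∀ m, l (MonoidAlgebra.single g (1 : k) • m) = l m) ∧
      l m ≠ 0 := by
  have hnot : m ∉ coinvKer k G M T := by
    intro h
    obtain ⟨H, _, hH, hsum⟩ := hG.exists_sum_eq_zero hM hT h
    rw [Finset.sum_congr rfl fun (h : H) _ => hfix h.1 (hH h.2), Finset.sum_const, Finset.card_univ,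
      ← Nat.cast_smul_eq_nsmul k, smul_eq_zero] at hsum
    exact hsum.elim (Nat.cast_ne_zero.2 Fintype.card_ne_zero) hm
  obtain ⟨l, hl, hker⟩ := Submodule.exists_le_ker_of_notMem hnot
  exact ⟨l, invariant_of_le_ker hker, hl⟩

/-- Exactness of coinvariants in the form needed: if i m dies in the coinvariants of N, its sum over
a finite group H is zero. Injectivity of i gives the same for m, whence |H| l(m) = 0. -/
theorem Tame.exists_functional_extending (hG : Tame G) {N : Type*}
    [AddCommGroup N] [Module (MonoidAlgebra k G) N] [Module k N]
    [IsScalarTower k (MonoidAlgebra k G) N] {T : Set Ψ} (hT : T.Finite)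
    (hN : IsSmooth k G N) (i : M →ₗ[MonoidAlgebra k G] N) (hi : Function.Injective i)
    (l : M →ₗ[k] k) (hl : ∀ g ∈ stab G T, ∀ m, l (MonoidAlgebra.single g (1 : k) • m) = l m) :
    ∃ l' : N →ₗ[k] k, (∀ g ∈ stab G T, ∀ m, l' (MonoidAlgebra.single g (1 : k) • m) = l' m) ∧
      ∀ m, l' (i m) = l m := by
  let f : M →ₗ[k] N ⧸ coinvKer k G N T := (coinvKer k G N T).mkQ ∘ₗ i.restrictScalars k
  have hker : LinearMap.ker f ≤ LinearMap.ker l := by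
    intro m hm
    have hm' : i m ∈ coinvKer k G N T := (Submodule.Quotient.mk_eq_zero _).1 hm
    obtain ⟨H, _, hH, hsum⟩ := hG.exists_sum_eq_zero hN hT hm'
    have hsum' : ∑ h : H, MonoidAlgebra.single (h : G) (1 : k) • m = 0 := by
      apply hi
      rw [map_zero, map_sum, ← hsum]
      exact Finset.sum_congr rfl fun h _ => map_smul i _ m
    have := congrArg l hsum'
    rw [map_zero, map_sum, Finset.sum_congr rfl fun (h : H) _ => hl h.1 (hH h.2) m, Finset.sum_const,
      Finset.card_univ, nsmul_eq_mul, mul_eq_zero] at this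
    exact this.resolve_left (Nat.cast_ne_zero.2 Fintype.card_ne_zero)
  -- By the kernel inclusion, l factors through M → N_{G_T}, and linear functionals extend from the
  -- image.
  have hmem : l ∈ LinearMap.range f.dualMap := by
    rw [LinearMap.range_dualMap_eq_dualAnnihilator_ker, Submodule.mem_dualAnnihilator]
    exact fun w hw => hker hw
  obtain ⟨l₁, hl₁⟩ := hmem
  refine ⟨l₁ ∘ₗ (coinvKer k G N T).mkQ, invariant_of_le_ker fun n hn => ?_,
    fun m => LinearMap.congr_fun hl₁ m⟩
  change l₁ (Submodule.Quotient.mk n) = 0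
  rw [(Submodule.Quotient.mk_eq_zero _).2 hn, map_zero]

-- Frobenius reciprocity: x ↦ l(x⁻¹ m) is a smooth function on G/G_T, so it is the expansion of a
-- unique family. Uniqueness makes the resulting map linear and equivariant.
omit [CharZero k] in
theorem Tame.exists_hom_of_functional (hG : Tame G) (hM : IsSmooth k G M) {T : Set Ψ}
    (hT : FinClosed G T) [Fintype (ClosedSub G T)] (l : M →ₗ[k] k)
    (hl : ∀ g ∈ stab G T, ∀ m, l (MonoidAlgebra.single g (1 : k) • m) = l m) :
    ∃ F : M →ₗ[MonoidAlgebra k G] (∀ K : ClosedSub G T, PermModule k (stab G K.1)),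
      ∀ m x, expand k T (F m) x = l (MonoidAlgebra.single x⁻¹ (1 : k) • m) := by
  have hcomm : SMulCommClass k (MonoidAlgebra k G) M := IsScalarTower.to_smulCommClass
  have hex : ∀ m : M, ∃ p : ∀ K : ClosedSub G T, PermModule k (stab G K.1), ∀ x,
      expand k T p x = l (MonoidAlgebra.single x⁻¹ (1 : k) • m) := by
    intro m
    obtain ⟨S, hS⟩ := hM m
    obtain ⟨p, hp⟩ := hG.exists_expand_eq S.finite_toSet hT
      (fun x => l (MonoidAlgebra.single x⁻¹ (1 : k) • m)) (fun g hg x => by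
        rw [mul_inv_rev, ← mul_one (1 : k), single_mul_smul, mul_one, hS _ (inv_mem hg)])
      (fun h hh x => by
        rw [mul_inv_rev, ← mul_one (1 : k), single_mul_smul, mul_one, hl _ (inv_mem hh)])
    exact ⟨p, congrFun hp⟩
  choose F hF using hex
  have hinj := hG.expand_injective (k := k) hT
  refine ⟨{ toFun := F, map_add' := fun m n => hinj ?_, map_smul' := fun a m => ?_ }, hF⟩
  · ext x
    rw [map_add, Pi.add_apply, hF, hF, hF, smul_add, map_add]
  · have hadd : ∀ m n, F (m + n) = F m + F n := fun m n => hinj <| by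
      ext x
      rw [map_add, Pi.add_apply, hF, hF, hF, smul_add, map_add]
    change F (a • m) = a • F m
    induction a using MonoidAlgebra.induction_linear with
    | zero =>
      rw [zero_smul, zero_smul]
      exact add_eq_left.1 ((hadd 0 0).symm.trans (by rw [add_zero]))
    | add a b ha hb => rw [add_smul, add_smul, hadd, ha, hb]
    | single g c =>
      refine hinj (funext fun x => ?_)
      have h1 : (MonoidAlgebra.single g c : MonoidAlgebra k G) • F m =
          c • MonoidAlgebra.single g (1 : k) • F m := by
        ext K
        exact single_smul_eq g c (F m K)
      rw [h1, map_smul, Pi.smul_apply, expand_smul, hF, hF, single_smul_eq g c m, smul_comm _ c,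
        map_smul, ← single_mul_smul, mul_inv_rev, inv_inv, mul_one]

end Module

theorem isSmooth_permModule (T : Set Ψ) (hT : T.Finite) :
    IsSmooth k G (PermModule k (stab G T)) := by
  intro p
  induction p using PermModule.induction with
  | zero => exact ⟨∅, fun g _ => smul_zero _⟩
  | add p q hp hq =>
    classical
    obtain ⟨S, hS⟩ := hp
    obtain ⟨S', hS'⟩ := hq
    refine ⟨S ∪ S', fun g hg => ?_⟩
    rw [smul_add, hS g (stab_anti (by simp) hg), hS' g (stab_anti (by simp) hg)]
  | single x c =>
    induction x using QuotientGroup.induction_on with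
    | H x =>
      classical
      refine ⟨(hT.image fun t => x • t).toFinset, fun g hg => ?_⟩
      rw [left_smul_single, one_mul]
      refine congrArg (PermModule.single k _ · c) (coset_eq_iff.2 fun t ht => ?_)
      refine (mul_smul g x t).trans ?_
      exact mem_stab.1 hg _ (by
        rw [Set.Finite.coe_toFinset]
        exact ⟨t, ht, rfl⟩)

variable [CharZero k] {M : Type*} [AddCommGroup M] [Module (MonoidAlgebra k G) M]

/-- The modules `k⟨G/G_T⟩` cogenerate the category of smooth modules. -/
theorem Tame.exists_hom_ne_zero (hG : Tame G) (hM : IsSmooth k G M) {m : M} (hm : m ≠ 0) :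
    ∃ T, FinClosed G T ∧ ∃ f : M →ₗ[MonoidAlgebra k G] PermModule k (stab G T), f m ≠ 0 := by
  let _ : Module k M := Module.compHom M (algebraMap k (MonoidAlgebra k G))
  have _ : IsScalarTower k (MonoidAlgebra k G) M := ⟨fun c a m => by
    rw [Algebra.smul_def, mul_smul]
    rfl⟩
  obtain ⟨S, hS⟩ := hM m
  obtain ⟨D, hD, -, hst⟩ := hG.exists_finClosed S.finite_toSet
  have := finite_closedSub (G := G) hD.1
  have := Fintype.ofFinite (ClosedSub G D)
  obtain ⟨l, hl, hlm⟩ := hG.exists_functional_ne_zero hM hD.1 hm (hst ▸ hS)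
  obtain ⟨F, hF⟩ := hG.exists_hom_of_functional hM hD l hl
  -- The value at x = 1 of the function attached to m is l m.
  have hFm : F m ≠ 0 := fun h => hlm <| by
    have := hF m 1
    rw [h, map_zero, inv_one, ← MonoidAlgebra.one_def, one_smul] at this
    exact this.symm
  obtain ⟨K, hK⟩ := Function.ne_iff.1 hFm
  exact ⟨K.1, K.2.1, LinearMap.proj K ∘ₗ F, hK⟩

/-- The modules `k⟨G/G_T⟩` are injective. -/
theorem Tame.exists_extension (hG : Tame G) {T : Set Ψ} (hT : FinClosed G T)
    {N : Type*} [AddCommGroup N] [Module (MonoidAlgebra k G) N] (hN : IsSmooth k G N)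
    (i : M →ₗ[MonoidAlgebra k G] N) (hi : Function.Injective i)
    (f : M →ₗ[MonoidAlgebra k G] PermModule k (stab G T)) :
    ∃ h : N →ₗ[MonoidAlgebra k G] PermModule k (stab G T), h ∘ₗ i = f := by
  let _ : Module k M := Module.compHom M (algebraMap k (MonoidAlgebra k G))
  have _ : IsScalarTower k (MonoidAlgebra k G) M := ⟨fun c a m => by
    rw [Algebra.smul_def, mul_smul]
    rfl⟩
  let _ : Module k N := Module.compHom N (algebraMap k (MonoidAlgebra k G))
  have _ : IsScalarTower k (MonoidAlgebra k G) N := ⟨fun c a m => by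
    rw [Algebra.smul_def, mul_smul]
    rfl⟩
  have := finite_closedSub (G := G) hT.1
  have := Fintype.ofFinite (ClosedSub G T)
  classical
  -- The coefficient of f at the base coset. It is G_T-invariant and determines f, so extending f
  -- amounts to extending this functional.
  let l : M →ₗ[k] k := LinearMap.proj ((1 : G) : G ⧸ stab G T) ∘ₗ PermModule.coeff ∘ₗ
    f.restrictScalars k
  have hlx : ∀ (x : G) (m : M), l (MonoidAlgebra.single x⁻¹ (1 : k) • m) =
      PermModule.coeff (f m) (x : G ⧸ stab G T) := by
    intro x m
    change PermModule.coeff (f (MonoidAlgebra.single x⁻¹ (1 : k) • m)) _ = _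
    rw [map_smul, coeff_smul, inv_inv]
    exact congrArg _ (congrArg QuotientGroup.mk (mul_one x))
  obtain ⟨l', hl', hll⟩ := hG.exists_functional_extending hT.1 hN i hi l (fun g hg m => by
    have h1 := hlx g⁻¹ m
    have h2 := hlx 1 m
    rw [inv_inv] at h1
    rw [inv_one, ← MonoidAlgebra.one_def, one_smul] at h2
    rw [h1, h2]
    exact congrArg _ (QuotientGroup.eq.2 (by simpa using hg)))
  obtain ⟨F, hF⟩ := hG.exists_hom_of_functional hN hT l' hl'
  let K : ClosedSub G T := ⟨T, hT, subset_rfl⟩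
  refine ⟨LinearMap.proj K ∘ₗ F, LinearMap.ext fun m => ?_⟩
  -- Both families have the function x ↦ (coefficient of f m at x) as expansion, so they agree by
  -- `Tame.expand_injective`. The component at T therefore extends f.
  have : F (i m) = Pi.single K (f m) := by
    apply hG.expand_injective hT
    ext x
    rw [hF, ← map_smul, hll, hlx, expand_apply, Finset.sum_eq_single K]
    · rw [Pi.single_eq_same]
    · intro K' _ hK'
      rw [Pi.single_eq_of_ne hK', map_zero]
      rfl
    · simp
  change F (i m) K = f m
  rw [this, Pi.single_eq_same]

end Averaging

/-! ### Morphisms between permutation modules -/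

section Morphisms

open scoped Pointwise

variable {R : Type*} [CommRing R] {Ψ : Type v} {G : Subgroup (Equiv.Perm Ψ)} {T T' : Set Ψ}

theorem single_coset_invariant {x : G} (hx : x • T' ⊆ T) (c : R) :
    ∀ g ∈ stab G T, MonoidAlgebra.single g (1 : R) •
      PermModule.single R (stab G T') (x : G ⧸ stab G T') c =
      PermModule.single R (stab G T') (x : G ⧸ stab G T') c := by
  intro g hg
  rw [left_smul_single, one_mul]
  refine congrArg (PermModule.single R _ · c) (coset_eq_iff.2 fun t ht => ?_)
  exact (mul_smul g x t).trans (mem_stab.1 hg _ (hx ⟨t, ht, rfl⟩))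

variable (R) in
/-- The morphism `R⟨G/G_T⟩ → R⟨G/G_{T'}⟩`, `[y] ↦ [y x]`, where `x(T') ⊆ T`. -/
def translate (x : G) (hx : x • T' ⊆ T) :
    PermModule R (stab G T) →ₗ[MonoidAlgebra R G] PermModule R (stab G T') :=
  PermModule.lift (PermModule.single R _ (x : G ⧸ stab G T') 1) (single_coset_invariant hx 1)

theorem translate_single (x : G) (hx : x • T' ⊆ T) (y : G) (c : R) :
    translate R x hx (PermModule.single R _ (y : G ⧸ stab G T) c) =
      PermModule.single R _ ((y * x : G) : G ⧸ stab G T') c := by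
  refine (PermModule.lift_single _ _ _ _).trans ?_
  rw [left_smul_single, mul_one]
  rfl

/-- Each translation is restriction to the subset x(T') of T followed by an isomorphism. Questions
about kernels thus reduce to restrictions. -/
theorem translate_eq_comp (x : G) (hx : x • T' ⊆ T) :
    translate R x hx = translate R (T := x • T') x subset_rfl ∘ₗ
      translate R (1 : G) ((one_smul G (x • T')).trans_subset hx) := by
  refine PermModule.hom_ext ?_
  simp only [LinearMap.comp_apply, translate_single, one_mul]

/-- The support of an invariant element is finite and stable under G_T, while a point x t outside T
would have an infinite G_T-orbit. -/
theorem Tame.smul_subset_of_invariant (hG : Tame G) (hT : FinClosed G T) (hT' : T'.Finite)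
    {p : PermModule R (stab G T')}
    (hp : ∀ g ∈ stab G T, MonoidAlgebra.single g (1 : R) • p = p) {x : G}
    (hx : PermModule.coeff p (x : G ⧸ stab G T') ≠ 0) : x • T' ⊆ T := by
  rintro _ ⟨t, ht, rfl⟩
  by_contra hxt
  refine hG.infinite_orbit hT hxt (Set.Finite.subset
    (p.support.finite_toSet.biUnion fun z _ => hT'.image fun y => z.out • y) ?_)
  rintro _ ⟨g, hg, rfl⟩
  refine Set.mem_biUnion (x := ((g * x : G) : G ⧸ stab G T')) (PermModule.mem_support.2 ?_)
    ⟨t, ht, ?_⟩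
  · rw [← hp g hg, coeff_smul]
    convert hx using 2
    exact congrArg QuotientGroup.mk (inv_mul_cancel_left g x)
  · beta_reduce
    rw [← mul_smul]
    exact coset_eq_iff.1 (QuotientGroup.out_eq' _) t ht

theorem PermModule.eq_sum (p : PermModule R (stab G T)) :
    p = ∑ z ∈ p.support, PermModule.single R _ ((z.out : G) : G ⧸ stab G T) (coeff p z) := by
  conv_lhs => rw [← Finsupp.sum_single (show (G ⧸ stab G T) →₀ R from p)]
  exact Finset.sum_congr rfl fun z _ =>
    congrArg (PermModule.single R _ · (coeff p z)) (QuotientGroup.out_eq' z).symm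

/-- A morphism is determined by the image of the base coset, which is G_T-invariant and so supported
on cosets x with x(T') ⊆ T. Hence the morphism is a linear combination of translations. -/
theorem Tame.hom_apply_eq_zero (hG : Tame G) (hT : FinClosed G T) (hT' : T'.Finite)
    {v : PermModule R (stab G T)} (hv : ∀ (x : G) (hx : x • T' ⊆ T), translate R x hx v = 0)
    (π : PermModule R (stab G T) →ₗ[MonoidAlgebra R G] PermModule R (stab G T')) : π v = 0 := by
  set p := π (PermModule.single R _ ((1 : G) : G ⧸ stab G T) 1) with hp
  have hinv : ∀ g ∈ stab G T, MonoidAlgebra.single g (1 : R) • p = p := fun g hg => by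
    rw [hp, ← map_smul, PermModule.single_one_invariant g hg]
  have hsub : ∀ z ∈ p.support, (z.out : G) • T' ⊆ T := fun z hz =>
    hG.smul_subset_of_invariant hT hT' hinv (by
      have := PermModule.mem_support.1 hz
      rwa [QuotientGroup.out_eq'])
  let ψ : p.support → (PermModule R (stab G T) →ₗ[MonoidAlgebra R G] PermModule R (stab G T')) :=
    fun z => PermModule.lift (PermModule.single R _ (z.1.out : G ⧸ stab G T') (PermModule.coeff p z))
      (single_coset_invariant (hsub z z.2) _)
  have hπ : π = ∑ z, ψ z := by
    refine PermModule.hom_ext ?_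
    rw [← hp, LinearMap.sum_apply]
    conv_lhs => rw [PermModule.eq_sum p, ← Finset.sum_attach]
    refine Finset.sum_congr rfl fun z _ => ?_
    refine Eq.trans ?_ (PermModule.lift_single _ _ _ _).symm
    rw [← MonoidAlgebra.one_def, one_smul]
  have hψ : ∀ z (w : PermModule R (stab G T)),
      ψ z w = PermModule.coeff p z • translate R z.1.out (hsub z z.2) w := by
    intro z w
    induction w using PermModule.induction with
    | zero => rw [map_zero, map_zero, smul_zero]
    | add w w' h h' => rw [map_add, map_add, smul_add, h, h']
    | single y c =>
      induction y using QuotientGroup.induction_on with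
      | H y =>
        rw [translate_single]
        refine (PermModule.lift_single _ _ _ _).trans ?_
        rw [left_smul_single]
        refine Eq.trans ?_ (Finsupp.smul_single _ _ _).symm
        rw [smul_eq_mul, mul_comm]
        rfl
  rw [hπ, LinearMap.sum_apply]
  exact Finset.sum_eq_zero fun z _ => by rw [hψ, hv, smul_zero]

variable (R G T) in
/-- The common kernel of all morphisms from `R⟨G/G_T⟩` to `R⟨G/G_{T'}⟩` for closed `T' ⊊ T`. -/
def commonKer : Submodule (MonoidAlgebra R G) (PermModule R (stab G T)) :=
  ⨅ (T' : Set Ψ) (_ : FinClosed G T' ∧ T' ⊂ T)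
    (π : PermModule R (stab G T) →ₗ[MonoidAlgebra R G] PermModule R (stab G T')),
    LinearMap.ker π

theorem mem_commonKer {v : PermModule R (stab G T)} :
    v ∈ commonKer R G T ↔ ∀ T', FinClosed G T' → T' ⊂ T →
      ∀ π : PermModule R (stab G T) →ₗ[MonoidAlgebra R G] PermModule R (stab G T'), π v = 0 := by
  simp [commonKer, Submodule.mem_iInf]

/-- Every morphism is a combination of translations, and each of these factors through the
restriction to some proper closed subset x(T'). -/
theorem Tame.mem_commonKer_iff (hG : Tame G) (hT : FinClosed G T)
    {v : PermModule R (stab G T)} :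
    v ∈ commonKer R G T ↔ ∀ (T' : Set Ψ) (_ : FinClosed G T') (h : T' ⊂ T),
      translate R (1 : G) ((one_smul G T').trans_subset h.1) v = 0 := by
  rw [mem_commonKer]
  refine ⟨fun h T' h1 h2 => h T' h1 h2 _, fun h T' h1 h2 π => ?_⟩
  refine hG.hom_apply_eq_zero hT h1.1 (fun x hx => ?_) π
  have hss : x • T' ⊂ T := hx.ssubset_of_ne fun he => by
    have := Set.ncard_lt_ncard h2 hT.1
    rw [← he, ncard_smul] at this
    exact lt_irrefl _ this
  rw [translate_eq_comp, LinearMap.comp_apply, h _ (h1.smul x) hss, map_zero]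

/-- Translations along a proper x(T') ⊊ T kill v, so a morphism that does not must involve a
translation with x(T') = T. -/
theorem Tame.exists_smul_eq (hG : Tame G) (hT : FinClosed G T) (hT' : FinClosed G T')
    {v : PermModule R (stab G T)} (hv : v ∈ commonKer R G T)
    {π : PermModule R (stab G T) →ₗ[MonoidAlgebra R G] PermModule R (stab G T')} (hπ : π v ≠ 0) :
    ∃ x : G, x • T' = T := by
  by_contra! hne
  refine hπ (hG.hom_apply_eq_zero hT hT'.1 (fun x hx => ?_) π)
  have h0 := (hG.mem_commonKer_iff hT).1 hv _ (hT'.smul x) (hx.ssubset_of_ne (hne x))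
  rw [translate_eq_comp, LinearMap.comp_apply, h0, map_zero]

theorem Tame.exists_smul_subset (hG : Tame G) (hT : FinClosed G T) (hT' : T'.Finite)
    {π : PermModule R (stab G T) →ₗ[MonoidAlgebra R G] PermModule R (stab G T')} (hπ : π ≠ 0) :
    ∃ x : G, x • T' ⊆ T := by
  by_contra! hne
  exact hπ (LinearMap.ext fun v => hG.hom_apply_eq_zero hT hT' (fun x hx => (hne x hx).elim) π)

/-- `G`-endomorphisms of `R⟨G/G_T⟩` come from the group algebra of `Aut(T)`. -/
theorem Tame.exists_smul_of_endomorphism (hG : Tame G) (hT : FinClosed G T)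
    (π : PermModule R (stab G T) →ₗ[MonoidAlgebra R G] PermModule R (stab G T)) :
    ∃ e : MonoidAlgebra R (AutT G T), ∀ v, π v = e • v := by
  set p := π (PermModule.single R _ ((1 : G) : G ⧸ stab G T) 1) with hp
  have hinv : ∀ g ∈ stab G T, MonoidAlgebra.single g (1 : R) • p = p := fun g hg => by
    rw [hp, ← map_smul, PermModule.single_one_invariant g hg]
  -- Here x(T) ⊆ T forces x(T) = T by counting, so x normalizes G_T. The inverse appears because [n]
  -- acts by right multiplication by n⁻¹.
  have hN : ∀ z ∈ p.support, (z.out : G)⁻¹ ∈ Subgroup.normalizer (stab G T : Set G) := fun z hz =>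
    inv_mem <| (mem_normalizer_iff hT).2 <| smul_eq_of_subset hT.1 <|
      hG.smul_subset_of_invariant hT hT.1 hinv (by
        have := PermModule.mem_support.1 hz
        rwa [QuotientGroup.out_eq'])
  refine ⟨∑ z : p.support, MonoidAlgebra.single ((⟨_, hN z z.2⟩ :
    Subgroup.normalizer (stab G T : Set G)) : AutT G T) (PermModule.coeff p z), fun v => ?_⟩
  refine LinearMap.congr_fun (g := Module.toModuleEnd (MonoidAlgebra R G)
    (S := MonoidAlgebra R (AutT G T)) (PermModule R (stab G T)) _) (PermModule.hom_ext ?_) v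
  rw [← hp, Module.toModuleEnd_apply, DistribSMul.toLinearMap_apply, Finset.sum_smul]
  conv_lhs => rw [PermModule.eq_sum p, ← Finset.sum_attach]
  refine Finset.sum_congr rfl fun z _ => ?_
  rw [right_smul_single, mul_one, inv_inv, one_mul]

theorem coeff_smul_single_one (e : MonoidAlgebra R (AutT G T))
    (n : Subgroup.normalizer (stab G T : Set G)) :
    PermModule.coeff (e • PermModule.single R _ ((1 : G) : G ⧸ stab G T) 1) ((n : G) : G ⧸ stab G T) =
      e.coeff ((n : AutT G T)⁻¹) := by
  classical
  induction e using MonoidAlgebra.induction_linear with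
  | zero => rw [zero_smul, map_zero]; rfl
  | add e f he hf => rw [add_smul, map_add, Pi.add_apply, he, hf]; rfl
  | single w c =>
    induction w using QuotientGroup.induction_on with
    | H m =>
      rw [right_smul_single, PermModule.coeff_single, MonoidAlgebra.coeff_single,
        Finsupp.single_apply, one_mul, mul_one]
      congr 1
      rw [← inv_inj (a := (m : AutT G T)), inv_inv, eq_iff_iff, ← QuotientGroup.mk_inv,
        QuotientGroup.eq, QuotientGroup.eq]
      rfl

theorem eq_zero_of_smul_single_one_eq_zero {e : MonoidAlgebra R (AutT G T)}
    (he : e • PermModule.single R _ ((1 : G) : G ⧸ stab G T) 1 = 0) : e = 0 := by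
  ext w
  induction w using QuotientGroup.induction_on with
  | H n =>
    have := coeff_smul_single_one e n⁻¹
    rw [he, map_zero, QuotientGroup.mk_inv, inv_inv] at this
    exact this.symm

theorem smul_mem_commonKer (e : MonoidAlgebra R (AutT G T)) {v : PermModule R (stab G T)}
    (hv : v ∈ commonKer R G T) : e • v ∈ commonKer R G T := by
  rw [mem_commonKer] at hv ⊢
  exact fun T' h1 h2 π => hv T' h1 h2 (π ∘ₗ Module.toModuleEnd (MonoidAlgebra R G) _ e)

end Morphisms

/-! ### The comparison of `k ⊗ V_T` with the common kernel over `k` -/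

section ChangeOfCoefficients

open scoped Pointwise

variable {R R' : Type*} [CommRing R] [CommRing R']

/-- The map `R⟨G/H⟩ → R'⟨G/H⟩` induced by an additive map of the coefficients. -/
def mapCoeff {G : Type*} [Group G] {H : Subgroup G} (φ : R →+ R') :
    PermModule R H →+ PermModule R' H :=
  Finsupp.mapRange.addMonoidHom φ

section

variable {G : Type*} [Group G] {H : Subgroup G}

theorem mapCoeff_single (φ : R →+ R') (x : G ⧸ H) (c : R) :
    mapCoeff φ (PermModule.single R H x c) = PermModule.single R' H x (φ c) :=
  Finsupp.mapRange_single (hf := map_zero φ)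

theorem coeff_mapCoeff (φ : R →+ R') (p : PermModule R H) (x : G ⧸ H) :
    PermModule.coeff (mapCoeff φ p) x = φ (PermModule.coeff p x) := rfl

theorem mapCoeff_injective {φ : R →+ R'} (hφ : Function.Injective φ) :
    Function.Injective (mapCoeff (H := H) φ) :=
  Finsupp.mapRange_injective φ (map_zero φ) hφ

theorem exists_nat_smul_eq_mapCoeff (p : PermModule ℚ H) :
    ∃ (n : ℕ) (q : PermModule ℤ H), n ≠ 0 ∧ n • p = mapCoeff (Int.castAddHom ℚ) q := by
  induction p using PermModule.induction with
  | zero => exact ⟨1, 0, one_ne_zero, by rw [smul_zero, map_zero]⟩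
  | add p p' hp hp' =>
    obtain ⟨n, q, hn, h⟩ := hp
    obtain ⟨n', q', hn', h'⟩ := hp'
    refine ⟨n * n', n' • q + n • q', mul_ne_zero hn hn', ?_⟩
    rw [map_add, map_nsmul, map_nsmul, ← h, ← h', smul_add, smul_smul, smul_smul, mul_comm n']
  | single x c =>
    refine ⟨c.den, PermModule.single ℤ H x c.num, c.den_nz, ?_⟩
    rw [mapCoeff_single]
    refine (Finsupp.smul_single c.den x c).trans ?_
    have : c.den • c = Int.castAddHom ℚ c.num := by
      rw [nsmul_eq_mul, Rat.den_mul_eq_num]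
      rfl
    rw [this]
    rfl

end

variable {Ψ : Type v} {G : Subgroup (Equiv.Perm Ψ)} {T : Set Ψ}

theorem translate_mapCoeff (φ : R →+ R') {T' : Set Ψ} (x : G) (hx : x • T' ⊆ T)
    (p : PermModule R (stab G T)) :
    translate R' x hx (mapCoeff φ p) = mapCoeff φ (translate R x hx p) := by
  induction p using PermModule.induction with
  | zero => simp only [map_zero]
  | add p q hp hq => simp only [map_add, hp, hq]
  | single y c =>
    induction y using QuotientGroup.induction_on with
    | H y => rw [mapCoeff_single, translate_single, translate_single, mapCoeff_single]

theorem Tame.mapCoeff_mem_commonKer (hG : Tame G) (hT : FinClosed G T) (φ : R →+ R')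
    {p : PermModule R (stab G T)} (hp : p ∈ commonKer R G T) :
    mapCoeff φ p ∈ commonKer R' G T := by
  rw [hG.mem_commonKer_iff hT] at hp ⊢
  intro T' h1 h2
  rw [translate_mapCoeff, hp T' h1 h2, map_zero]

theorem Tame.mem_commonKer_of_mapCoeff_mem (hG : Tame G) (hT : FinClosed G T) {φ : R →+ R'}
    (hφ : Function.Injective φ) {p : PermModule R (stab G T)}
    (hp : mapCoeff φ p ∈ commonKer R' G T) : p ∈ commonKer R G T := by
  rw [hG.mem_commonKer_iff hT] at hp ⊢
  intro T' h1 h2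
  have := hp T' h1 h2
  rw [translate_mapCoeff, ← map_zero (mapCoeff φ)] at this
  exact mapCoeff_injective hφ this

/-- The restrictions whose common kernel is taken have integral coefficients, so the kernel commutes
with extension of scalars. Concretely, coefficients are expanded in a ℚ-basis of k and denominators
are cleared. -/
theorem Tame.vField_eq {k : Type u} [Field k] [CharZero k] (hG : Tame G) (hT : FinClosed G T) :
    VField k G T = commonKer k G T := by
  refine le_antisymm (Submodule.span_le.2 ?_) fun v hv => ?_
  · rintro _ ⟨p, hp, rfl⟩
    exact hG.mapCoeff_mem_commonKer hT (Int.castAddHom k) hp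
  · let b := Module.Basis.ofVectorSpace ℚ k
    let c : Module.Basis.ofVectorSpaceIndex ℚ k → k →+ ℚ := fun j => (b.coord j).toAddMonoidHom
    classical
    let s : Finset (Module.Basis.ofVectorSpaceIndex ℚ k) :=
      v.support.biUnion fun x => (b.repr (PermModule.coeff v x)).support
    have hsum : v = ∑ j ∈ s, b j • mapCoeff (algebraMap ℚ k : ℚ →+ k) (mapCoeff (c j) v) := by
      refine PermModule.ext fun x => ?_
      rw [map_sum, Finset.sum_apply]
      simp only [map_smul, Pi.smul_apply, coeff_mapCoeff]
      conv_lhs => rw [← b.linearCombination_repr (PermModule.coeff v x)]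
      rw [Finsupp.linearCombination_apply, Finsupp.sum_of_support_subset (s := s)]
      · refine Finset.sum_congr rfl fun j _ => ?_
        rw [Algebra.smul_def, smul_eq_mul, mul_comm]
        rfl
      · by_cases hx : PermModule.coeff v x = 0
        · rw [hx, map_zero]
          exact Finset.empty_subset _
        · exact Finset.subset_biUnion_of_mem
            (fun x => (b.repr (PermModule.coeff v x)).support) (PermModule.mem_support.2 hx)
      · intro j _
        exact zero_smul _ _
    rw [hsum]
    refine sum_mem fun j _ => ?_
    have hj := hG.mapCoeff_mem_commonKer hT (c j) hv
    obtain ⟨n, q, hn, hq⟩ := exists_nat_smul_eq_mapCoeff (mapCoeff (c j) v)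
    have hqmem : q ∈ VInt G T := by
      refine hG.mem_commonKer_of_mapCoeff_mem hT (φ := Int.castAddHom ℚ) Int.cast_injective ?_
      rw [← hq]
      exact nsmul_mem hj n
    have hval : b j • mapCoeff (algebraMap ℚ k : ℚ →+ k) (mapCoeff (c j) v) =
        (b j * (n : k)⁻¹) • intToField k (stab G T) q := by
      have h1 : intToField k (stab G T) q = (n : k) •
          mapCoeff (algebraMap ℚ k : ℚ →+ k) (mapCoeff (c j) v) := by
        rw [Nat.cast_smul_eq_nsmul, ← map_nsmul, hq]
        refine PermModule.ext fun x => ?_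
        rw [coeff_mapCoeff, coeff_mapCoeff]
        exact (map_intCast (algebraMap ℚ k) _).symm
      rw [h1, smul_smul, inv_mul_cancel_right₀ (Nat.cast_ne_zero.2 hn)]
    rw [hval, ← algebraMap_smul (MonoidAlgebra k G)]
    exact Submodule.smul_mem _ _ (Submodule.subset_span ⟨q, hqmem, rfl⟩)

end ChangeOfCoefficients

/-! ### The socle and the length of `k⟨G/G_T⟩` -/

section Socle

open scoped Pointwise

variable {k : Type u} [Field k] {Ψ : Type v} {G : Subgroup (Equiv.Perm Ψ)} {T : Set Ψ}

/-! ### Closure properties of smooth modules. -/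

section SmoothClosure

variable {M N : Type*} [AddCommGroup M] [Module (MonoidAlgebra k G) M] [AddCommGroup N]
  [Module (MonoidAlgebra k G) N]

theorem IsSmooth.of_injective (hN : IsSmooth k G N) (f : M →ₗ[MonoidAlgebra k G] N)
    (hf : Function.Injective f) : IsSmooth k G M := fun m => by
  obtain ⟨S, hS⟩ := hN (f m)
  exact ⟨S, fun g hg => hf (by rw [map_smul, hS g hg])⟩

theorem IsSmooth.of_surjective (hM : IsSmooth k G M) (f : M →ₗ[MonoidAlgebra k G] N)
    (hf : Function.Surjective f) : IsSmooth k G N := fun n => by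
  obtain ⟨m, rfl⟩ := hf n
  obtain ⟨S, hS⟩ := hM m
  exact ⟨S, fun g hg => by rw [← map_smul, hS g hg]⟩

theorem IsSmooth.submodule (hM : IsSmooth k G M) (L : Submodule (MonoidAlgebra k G) M) :
    IsSmooth k G L :=
  hM.of_injective L.subtype L.subtype_injective

theorem IsSmooth.quotient (hM : IsSmooth k G M) (L : Submodule (MonoidAlgebra k G) M) :
    IsSmooth k G (M ⧸ L) :=
  hM.of_surjective L.mkQ L.mkQ_surjective

theorem IsSmooth.pi {ι : Type*} [Finite ι] {X : ι → Type*} [∀ i, AddCommGroup (X i)]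
    [∀ i, Module (MonoidAlgebra k G) (X i)] (hX : ∀ i, IsSmooth k G (X i)) :
    IsSmooth k G (∀ i, X i) := fun x => by
  classical
  have := Fintype.ofFinite ι
  choose S hS using fun i => hX i (x i)
  refine ⟨Finset.univ.biUnion S, fun g hg => funext fun i => hS i g (stab_anti ?_ hg)⟩
  exact Finset.coe_subset.2 (Finset.subset_biUnion_of_mem S (Finset.mem_univ i))

theorem IsSmooth.prod (hM : IsSmooth k G M) (hN : IsSmooth k G N) : IsSmooth k G (M × N) :=
  fun x => by
  classical
  obtain ⟨S, hS⟩ := hM x.1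
  obtain ⟨S', hS'⟩ := hN x.2
  exact ⟨S ∪ S', fun g hg => Prod.ext (hS g (stab_anti (by simp) hg))
    (hS' g (stab_anti (by simp) hg))⟩

end SmoothClosure

/-- The proper closed subsets of `T`. -/
def ProperClosedSub (G : Subgroup (Equiv.Perm Ψ)) (T : Set Ψ) : Type v :=
  {K : Set Ψ // FinClosed G K ∧ K ⊂ T}

theorem finite_properClosedSub (hT : T.Finite) : Finite (ProperClosedSub G T) :=
  (hT.finite_subsets.subset fun _ h => h.2.1 :
    {K : Set Ψ | FinClosed G K ∧ K ⊂ T}.Finite).to_subtype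

variable (k G T) in
/-- The product of the projections `k⟨G/G_T⟩ → k⟨G/G_K⟩` over all proper closed subsets `K`. -/
def restrictions : PermModule k (stab G T) →ₗ[MonoidAlgebra k G]
    (∀ K : ProperClosedSub G T, PermModule k (stab G K.1)) :=
  LinearMap.pi fun K => translate k (1 : G) ((one_smul G K.1).trans_subset K.2.2.1)

theorem Tame.ker_restrictions (hG : Tame G) (hT : FinClosed G T) :
    LinearMap.ker (restrictions k G T) = commonKer k G T := by
  ext v
  rw [LinearMap.mem_ker, hG.mem_commonKer_iff hT]
  exact ⟨fun h T' h1 h2 => congrFun h ⟨T', h1, h2⟩, fun h => funext fun K => h K.1 K.2.1 K.2.2⟩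

theorem isSmooth_pi_proper (hT : FinClosed G T) :
    IsSmooth k G (∀ K : ProperClosedSub G T, PermModule k (stab G K.1)) :=
  have := finite_properClosedSub (G := G) hT.1
  IsSmooth.pi fun K => isSmooth_permModule K.1 K.2.1.1

/-- A non-zero morphism on the factor of K would give x(T) ⊆ K, which |K| < |T| forbids. -/
theorem Tame.hom_pi_proper_eq_zero (hG : Tame G) (hT : FinClosed G T)
    (f : (∀ K : ProperClosedSub G T, PermModule k (stab G K.1)) →ₗ[MonoidAlgebra k G]
      PermModule k (stab G T)) : f = 0 := by
  classical
  have := finite_properClosedSub (G := G) hT.1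
  refine LinearMap.pi_ext' fun K => ?_
  rw [LinearMap.zero_comp]
  by_contra h
  obtain ⟨x, hx⟩ := hG.exists_smul_subset K.2.1 hT.1 h
  have h1 := Set.ncard_le_ncard hx K.2.1.1
  have h2 := Set.ncard_lt_ncard K.2.2 hT.1
  rw [ncard_smul] at h1
  exact absurd h1 h2.not_ge

variable [CharZero k]

/-- Since k⟨G/G_T⟩ is injective, f extends to the product, where every such morphism vanishes. -/
theorem Tame.hom_eq_zero_of_injective (hG : Tame G) (hT : FinClosed G T) {M : Type*}
    [AddCommGroup M] [Module (MonoidAlgebra k G) M]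
    (i : M →ₗ[MonoidAlgebra k G] (∀ K : ProperClosedSub G T, PermModule k (stab G K.1)))
    (hi : Function.Injective i) (f : M →ₗ[MonoidAlgebra k G] PermModule k (stab G T)) : f = 0 := by
  obtain ⟨h, rfl⟩ := hG.exists_extension hT (isSmooth_pi_proper hT) i hi f
  rw [hG.hom_pi_proper_eq_zero hT h, LinearMap.zero_comp]

/-- A submodule N meeting the common kernel trivially embeds by restrictions into the product over
proper closed sets, so its inclusion into k⟨G/G_T⟩ is zero. -/
theorem Tame.isEssential_commonKer (hG : Tame G) (hT : FinClosed G T) :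
    IsEssential (commonKer k G T) := by
  intro N hN
  have h0 := hG.hom_eq_zero_of_injective hT (restrictions k G T ∘ₗ N.subtype) (by
    rw [← LinearMap.ker_eq_bot, LinearMap.ker_comp, hG.ker_restrictions hT, Submodule.eq_bot_iff]
    intro x hx
    exact Subtype.ext ((Submodule.eq_bot_iff _).1 hN x ⟨hx, x.2⟩))
    N.subtype
  rw [Submodule.eq_bot_iff]
  exact fun x hx => LinearMap.congr_fun h0 ⟨x, hx⟩

/-- Multiplication by such an e factors through the image of the restrictions and is therefore zero.
Its value at the base coset then recovers e = 0. -/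
theorem Tame.eq_zero_of_smul_commonKer (hG : Tame G) (hT : FinClosed G T)
    {e : MonoidAlgebra k (AutT G T)} (he : ∀ v ∈ commonKer k G T, e • v = 0) : e = 0 := by
  let f : PermModule k (stab G T) →ₗ[MonoidAlgebra k G] PermModule k (stab G T) :=
    Module.toModuleEnd (MonoidAlgebra k G) _ e
  have hle : LinearMap.ker (restrictions k G T) ≤ LinearMap.ker f := by
    rw [hG.ker_restrictions hT]
    exact fun v hv => he v hv
  have h0 := hG.hom_eq_zero_of_injective hT
    ((LinearMap.ker (restrictions k G T)).liftQ (restrictions k G T) le_rfl)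
    (by rw [← LinearMap.ker_eq_bot]; exact Submodule.ker_liftQ_eq_bot _ _ _ le_rfl)
    ((LinearMap.ker (restrictions k G T)).liftQ f hle)
  exact eq_zero_of_smul_single_one_eq_zero
    (LinearMap.congr_fun h0 (Submodule.Quotient.mk (PermModule.single k _ ((1 : G) : G ⧸ stab G T) 1)))

/-- Cogeneration gives a morphism to some k⟨G/G_{T'}⟩ that kills N and not v. As v lies in the
common kernel, T' is conjugate to T, so after an identification the morphism becomes an endomorphism
and comes from k⟨Aut(T)⟩. -/
theorem Tame.exists_separating (hG : Tame G) (hT : FinClosed G T)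
    (N : Submodule (MonoidAlgebra k G) (PermModule k (stab G T))) {v : PermModule k (stab G T)}
    (hv : v ∈ commonKer k G T) (hvN : v ∉ N) :
    ∃ e : MonoidAlgebra k (AutT G T), (∀ n ∈ N, e • n = 0) ∧ e • v ≠ 0 := by
  obtain ⟨T', hT', f, hf⟩ := hG.exists_hom_ne_zero ((isSmooth_permModule T hT.1).quotient N)
    (m := Submodule.Quotient.mk v) (by rwa [ne_eq, Submodule.Quotient.mk_eq_zero])
  obtain ⟨x, rfl⟩ := hG.exists_smul_eq hT hT' hv (π := f ∘ₗ N.mkQ) hf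
  have hx : x⁻¹ • x • T' ⊆ T' := (inv_smul_smul x T').subset
  have hinv : translate k x subset_rfl ∘ₗ translate k x⁻¹ hx = LinearMap.id := by
    refine PermModule.hom_ext ?_
    simp only [LinearMap.comp_apply, translate_single, one_mul, inv_mul_cancel, LinearMap.id_apply]
  obtain ⟨e, he⟩ := hG.exists_smul_of_endomorphism hT (translate k x⁻¹ hx ∘ₗ f ∘ₗ N.mkQ)
  refine ⟨e, fun n hn => ?_, fun h0 => hf ?_⟩
  · rw [← he, LinearMap.comp_apply, LinearMap.comp_apply, Submodule.mkQ_apply,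
      (Submodule.Quotient.mk_eq_zero N).2 hn, map_zero, map_zero]
  · rw [← he] at h0
    have := LinearMap.congr_fun hinv (f (Submodule.Quotient.mk v))
    rw [LinearMap.id_apply, LinearMap.comp_apply] at this
    rw [← this]
    exact (congrArg _ h0).trans (map_zero _)

/-- The annihilator in the group algebra of `Aut(T)` of a submodule of `k⟨G/G_T⟩`. -/
def weylAnnihilator (N : Submodule (MonoidAlgebra k G) (PermModule k (stab G T))) :
    Ideal (MonoidAlgebra k (AutT G T)) where
  carrier := {e | ∀ n ∈ N, e • n = 0}
  add_mem' ha hb n hn := by rw [add_smul, ha n hn, hb n hn, add_zero]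
  zero_mem' n _ := zero_smul _ n
  smul_mem' c e he n hn := by rw [smul_eq_mul, mul_smul, he n hn, smul_zero]

/-- By `Tame.exists_separating`, a submodule of the common kernel is recovered from its annihilator.
Chain conditions thereby pass from left ideals to submodules. -/
theorem Tame.strictAnti_weylAnnihilator (hG : Tame G) (hT : FinClosed G T) :
    StrictAnti fun N : Submodule (MonoidAlgebra k G) (commonKer k G T) =>
      weylAnnihilator (N.map (commonKer k G T).subtype) := by
  have hanti : Antitone fun N : Submodule (MonoidAlgebra k G) (commonKer k G T) =>
      weylAnnihilator (N.map (commonKer k G T).subtype) :=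
    fun N N' h e he n hn => he n (Submodule.map_mono h hn)
  refine hanti.strictAnti_of_injective fun N N' h => ?_
  have key : ∀ N N' : Submodule (MonoidAlgebra k G) (commonKer k G T),
      weylAnnihilator (N.map (commonKer k G T).subtype) =
        weylAnnihilator (N'.map (commonKer k G T).subtype) → N ≤ N' := by
    intro N N' h v hv
    by_contra hvN
    obtain ⟨e, he, hev⟩ := hG.exists_separating hT (N'.map (commonKer k G T).subtype) v.2
      (fun ⟨w, hw, hwv⟩ => hvN (Subtype.ext hwv ▸ hw))
    exact hev ((h.symm ▸ he : e ∈ weylAnnihilator (N.map (commonKer k G T).subtype)) v ⟨v, hv, rfl⟩)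
  exact le_antisymm (key N N' h) (key N' N h.symm)

/-- Maschke's theorem, as Aut(T) is finite. -/
theorem isSemisimpleRing_autT (hT : FinClosed G T) :
    IsSemisimpleRing (MonoidAlgebra k (AutT G T)) := by
  have := finite_autT hT
  have : NeZero (Nat.card (AutT G T) : k) := ⟨Nat.cast_ne_zero.2 Nat.card_pos.ne'⟩
  infer_instance

theorem Tame.isFiniteLength_commonKer (hG : Tame G) (hT : FinClosed G T) :
    IsFiniteLength (MonoidAlgebra k G) (commonKer k G T) := by
  have := isSemisimpleRing_autT (k := k) hT
  have h := hG.strictAnti_weylAnnihilator (k := k) hT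
  have h1 : WellFoundedGT (Ideal (MonoidAlgebra k (AutT G T))) := inferInstance
  have h2 : WellFoundedLT (Ideal (MonoidAlgebra k (AutT G T))) := inferInstance
  exact isFiniteLength_iff_isNoetherian_isArtinian.2
    ⟨isNoetherian_iff'.2 h.wellFoundedGT, h.wellFoundedLT⟩

/-- The annihilator of N is generated by an idempotent ε. Then N is the kernel of ε on the common
kernel, and the image of ε is a complement, stable under G because the two actions commute. -/
theorem Tame.isSemisimpleModule_commonKer (hG : Tame G) (hT : FinClosed G T) :
    IsSemisimpleModule (MonoidAlgebra k G) (commonKer k G T) := by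
  have := isSemisimpleRing_autT (k := k) hT
  refine (isSemisimpleModule_iff _ _).2 ⟨fun N => ?_⟩
  obtain ⟨ε, hε, hI⟩ := IsSemisimpleRing.ideal_eq_span_idempotent
    (weylAnnihilator (N.map (commonKer k G T).subtype))
  have hN : ∀ v : commonKer k G T, v ∈ N ↔ ε • (v : PermModule k (stab G T)) = 0 := by
    intro v
    constructor
    · intro hv
      have hmem : ε ∈ weylAnnihilator (N.map (commonKer k G T).subtype) :=
        hI ▸ Ideal.mem_span_singleton_self ε
      exact hmem v ⟨v, hv, rfl⟩
    · intro hv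
      by_contra hvN
      obtain ⟨e, he, hev⟩ := hG.exists_separating hT (N.map (commonKer k G T).subtype) v.2
        (fun ⟨w, hw, hwv⟩ => hvN (Subtype.ext hwv ▸ hw))
      have hmem : e ∈ Ideal.span {ε} := hI ▸ he
      obtain ⟨a, rfl⟩ := Ideal.mem_span_singleton'.1 hmem
      exact hev (by rw [mul_smul, hv, smul_zero])
  let N' : Submodule (MonoidAlgebra k G) (commonKer k G T) :=
    { carrier := {v | ε • (v : PermModule k (stab G T)) = v}
      add_mem' := fun {a b} ha hb => by
        change ε • ((a : PermModule k (stab G T)) + b) = a + b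
        rw [smul_add, ha, hb]
      zero_mem' := smul_zero _
      smul_mem' := fun a v hv => by
        change ε • a • (v : PermModule k (stab G T)) = a • v
        rw [smul_comm, hv] }
  refine ⟨N', disjoint_iff.2 ?_, codisjoint_iff.2 ?_⟩
  · rw [Submodule.eq_bot_iff]
    rintro v ⟨h1, h2⟩
    exact Subtype.ext (h2.symm.trans ((hN v).1 h1))
  · rw [Submodule.eq_top_iff']
    intro v
    let w : commonKer k G T := ⟨ε • v, smul_mem_commonKer ε v.2⟩
    have hw : ε • (w : PermModule k (stab G T)) = w := by
      change ε • ε • (v : PermModule k (stab G T)) = ε • v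
      rw [smul_smul, hε.eq]
    refine Submodule.mem_sup.2 ⟨v - w, (hN _).2 ?_, w, hw, sub_add_cancel v w⟩
    change ε • ((v : PermModule k (stab G T)) - w) = 0
    rw [smul_sub, hw]
    exact sub_self _

/-- Induction on |T|: the kernel of the restrictions is the common kernel, and their target is a
finite product of modules of smaller sets. -/
theorem Tame.isFiniteLength_permModule (hG : Tame G) (hT : FinClosed G T) :
    IsFiniteLength (MonoidAlgebra k G) (PermModule k (stab G T)) := by
  induction hn : T.ncard using Nat.strong_induction_on generalizing T with
  | _ n ih =>
    have hK : ∀ K : ProperClosedSub G T,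
        IsFiniteLength (MonoidAlgebra k G) (PermModule k (stab G K.1)) := fun K =>
      ih _ (hn ▸ Set.ncard_lt_ncard K.2.2 hT.1) K.2.1 rfl
    have := finite_properClosedSub (G := G) hT.1
    have hV := isFiniteLength_iff_isNoetherian_isArtinian.1 (hG.isFiniteLength_commonKer (k := k) hT)
    have := hV.1
    have := hV.2
    have (K : ProperClosedSub G T) := (isFiniteLength_iff_isNoetherian_isArtinian.1 (hK K)).1
    have (K : ProperClosedSub G T) := (isFiniteLength_iff_isNoetherian_isArtinian.1 (hK K)).2
    have hex : LinearMap.range (commonKer k G T).subtype = LinearMap.ker (restrictions k G T) := by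
      rw [Submodule.range_subtype, hG.ker_restrictions hT]
    exact isFiniteLength_iff_isNoetherian_isArtinian.2
      ⟨isNoetherian_of_range_eq_ker _ _ hex, isArtinian_of_range_eq_ker _ _ hex⟩

/-- A generator fixed by G_D is the image of the base coset of k⟨G/G_D⟩, so M is a quotient of a
finite product of such modules. -/
theorem Tame.isFiniteLength_of_fg (hG : Tame G) {M : Type*} [AddCommGroup M]
    [Module (MonoidAlgebra k G) M] [Module.Finite (MonoidAlgebra k G) M] (hM : IsSmooth k G M) :
    IsFiniteLength (MonoidAlgebra k G) M := by
  obtain ⟨s, hs⟩ := Module.Finite.fg_top (R := MonoidAlgebra k G) (M := M)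
  choose S hS using hM
  choose D hD hSD hst using fun m : M => hG.exists_finClosed (S m).finite_toSet
  let f : ∀ m : M, PermModule k (stab G (D m)) →ₗ[MonoidAlgebra k G] M := fun m =>
    PermModule.lift m (by rw [hst]; exact hS m)
  have hf := fun m => isFiniteLength_iff_isNoetherian_isArtinian.1
    (hG.isFiniteLength_permModule (k := k) (hD m))
  have (m : M) := (hf m).1
  have (m : M) := (hf m).2
  let F : (∀ m : s, PermModule k (stab G (D m))) →ₗ[MonoidAlgebra k G] M :=
    ∑ m : s, f m ∘ₗ LinearMap.proj m
  refine IsFiniteLength.of_surjective (f := F)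
    (isFiniteLength_iff_isNoetherian_isArtinian.2 ⟨inferInstance, inferInstance⟩) ?_
  rw [← LinearMap.range_eq_top, eq_top_iff, ← hs, Submodule.span_le]
  intro m hm
  classical
  refine ⟨Pi.single ⟨m, hm⟩ (PermModule.single k _ ((1 : G) : G ⧸ stab G (D m)) 1), ?_⟩
  rw [LinearMap.sum_apply, Finset.sum_eq_single (⟨m, hm⟩ : s)]
  · rw [LinearMap.comp_apply, LinearMap.proj_apply, Pi.single_eq_same]
    refine (PermModule.lift_single _ _ _ _).trans ?_
    rw [← MonoidAlgebra.one_def, one_smul]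
  · intro m' _ hm'
    rw [LinearMap.comp_apply, LinearMap.proj_apply, Pi.single_eq_of_ne hm', map_zero]
  · simp

end Socle

/-! ### Essential and semisimple submodules -/

section Essential

variable {A : Type*} [Ring A] {M : Type*} [AddCommGroup M] [Module A M]

/-- A complement of N ∩ S in S meets N trivially, so it is zero. -/
theorem IsEssential.semisimple_le {N S : Submodule A M} (hN : IsEssential N)
    (hS : IsSemisimpleModule A S) : S ≤ N := by
  obtain ⟨C, hC⟩ := exists_isCompl (N.comap S.subtype)
  have h0 : C.map S.subtype = ⊥ := by
    refine hN _ ((Submodule.eq_bot_iff _).2 ?_)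
    rintro _ ⟨hx, ⟨c, hc, rfl⟩⟩
    have : c ∈ N.comap S.subtype ⊓ C := ⟨hx, hc⟩
    rw [hC.inf_eq_bot, Submodule.mem_bot] at this
    rw [this, map_zero]
  replace h0 : C = ⊥ :=
    Submodule.map_injective_of_injective S.subtype_injective (h0.trans (Submodule.map_bot _).symm)
  have htop : N.comap S.subtype = ⊤ := by rw [← hC.sup_eq_top, h0, sup_bot_eq]
  exact fun x hx => (htop ▸ Submodule.mem_top : (⟨x, hx⟩ : S) ∈ N.comap S.subtype)

theorem IsEssential.isLeast_isGreatest {N : Submodule A M} (hN : IsEssential N)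
    (hS : IsSemisimpleModule A N) :
    IsLeast {N' | IsEssential N'} N ∧
      IsGreatest {N' : Submodule A M | IsSemisimpleModule A N'} N :=
  ⟨⟨hN, fun _ h => h.semisimple_le hS⟩, ⟨hS, fun _ h => hN.semisimple_le h⟩⟩

theorem IsEssential.le_of_isSimpleModule {N S : Submodule A M} (hN : IsEssential N)
    (hS : IsSimpleModule A S) : S ≤ N :=
  hN.semisimple_le inferInstance

/-- The sum of all simple submodules works, as in an Artinian module every non-zero submodule
contains a simple one. -/
theorem exists_isEssential_isSemisimple [IsArtinian A M] :
    ∃ N : Submodule A M, IsEssential N ∧ IsSemisimpleModule A N := by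
  refine ⟨⨆ m ∈ {m : Submodule A M | IsSimpleModule A m}, m, fun N' h => ?_,
    isSemisimpleModule_biSup_of_isSemisimpleModule_submodule fun m hm => ?_⟩
  · by_contra hne
    obtain ⟨a, ha, haN⟩ := (eq_bot_or_exists_atom_le N').resolve_left hne
    refine ha.1 (le_bot_iff.1 (h ▸ le_inf ?_ haN))
    exact le_biSup (fun m : Submodule A M => m) (isSimpleModule_iff_isAtom.2 ha)
  · have : IsSimpleModule A m := hm
    infer_instance

/-- A simple essential submodule lies in every non-zero submodule, so two of these cannot be
complementary. -/
theorem IsEssential.isIndecomposable {N : Submodule A M} (hN : IsEssential N)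
    (hS : IsSimpleModule A N) : IsIndecomposable A M := by
  have hne : N ≠ ⊥ := (isSimpleModule_iff_isAtom.1 hS).1
  refine ⟨?_, fun L L' hL => ?_⟩
  · obtain ⟨x, -, hx⟩ := N.exists_mem_ne_zero_of_ne_bot hne
    exact ⟨⟨x, 0, hx⟩⟩
  · by_contra! hcon
    have key : ∀ L : Submodule A M, L ≠ ⊥ → N ≤ L := fun L hL =>
      inf_eq_left.1 (((isSimpleModule_iff_isAtom.1 hS).le_iff.1 inf_le_left).resolve_left
        fun h => hL (hN L h))
    exact hne (le_bot_iff.1 (hL.inf_eq_bot ▸ le_inf (key L hcon.1) (key L' hcon.2)))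

variable {M' : Type*} [AddCommGroup M'] [Module A M']

theorem IsEssential.injective_of_comp {N : Submodule A M} (hN : IsEssential N) {f : M →ₗ[A] M'}
    (hf : Function.Injective (f ∘ₗ N.subtype)) : Function.Injective f := by
  rw [← LinearMap.ker_eq_bot]
  refine hN _ ((Submodule.eq_bot_iff _).2 fun x ⟨hx, hfx⟩ => ?_)
  exact congrArg Subtype.val (hf (a₁ := ⟨x, hx⟩) (a₂ := 0) (by simpa using hfx))

/-- Simple essential submodules correspond to each other under isomorphisms. -/
theorem IsEssential.nonempty_linearEquiv {N : Submodule A M} (hN : IsEssential N)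
    (hS : IsSimpleModule A N) {N' : Submodule A M'} (hN' : IsEssential N')
    (hS' : IsSimpleModule A N') (e : M ≃ₗ[A] M') : Nonempty (N ≃ₗ[A] N') := by
  have h1 : N.map (e : M →ₗ[A] M') ≤ N' :=
    hN'.le_of_isSimpleModule ((e.submoduleMap N).isSimpleModule_iff.1 hS)
  have h2 : N'.map (e.symm : M' →ₗ[A] M) ≤ N :=
    hN.le_of_isSimpleModule ((e.symm.submoduleMap N').isSimpleModule_iff.1 hS')
  have h3 : N.map (e : M →ₗ[A] M') = N' := by
    refine le_antisymm h1 fun x hx => ⟨e.symm x, h2 ⟨x, hx, rfl⟩, ?_⟩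
    exact e.apply_symm_apply x
  exact ⟨(e.submoduleMap N).trans (LinearEquiv.ofEq _ _ h3)⟩

end Essential

/-! ### Morphisms from simple modules over a commuting semisimple ring -/

section Bimodule

variable {E A P : Type*} [Ring E] [Ring A] [AddCommGroup P] [Module E P] [Module A P]
  [SMulCommClass E A P] {Γ Γ' : Type*} [AddCommGroup Γ] [Module E Γ] [AddCommGroup Γ'] [Module E Γ']

/-- The simple module Γ is projective over a semisimple ring, so the surjection e ↦ e γ₀ splits. The
splitting makes Hom_E(Γ, P) a direct summand of P as an A-module. -/
theorem exists_section [IsSemisimpleRing E] [IsSimpleModule E Γ] {γ₀ : Γ} (h : γ₀ ≠ 0) :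
    ∃ ι : Γ →ₗ[E] E, ∀ γ, ι γ • γ₀ = γ := by
  obtain ⟨ι, hι⟩ := IsSemisimpleModule.lifting_property (LinearMap.toSpanSingleton E Γ γ₀)
    (IsSimpleModule.toSpanSingleton_surjective E h) (LinearMap.id (M := Γ))
  exact ⟨ι, fun γ => LinearMap.congr_fun hι γ⟩

variable (A P) in
/-- The evaluation morphism `Hom_E(Γ, P) → P`. -/
def evalAt (γ : Γ) : (Γ →ₗ[E] P) →ₗ[A] P where
  toFun f := f γ
  map_add' _ _ := rfl
  map_smul' _ _ := rfl

variable (A P) in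
/-- The morphism `P → Hom_E(Γ, P)` corresponding to a morphism `Γ → E`. -/
def smulHom (ι : Γ →ₗ[E] E) : P →ₗ[A] (Γ →ₗ[E] P) where
  toFun p := (LinearMap.toSpanSingleton E P p) ∘ₗ ι
  map_add' _ _ := LinearMap.ext fun _ => smul_add _ _ _
  map_smul' a p := LinearMap.ext fun γ => smul_comm (ι γ) a p

variable (E Γ) in
/-- The morphisms `Γ → P` with values in `V`. -/
def homInto (V : Submodule A P) : Submodule A (Γ →ₗ[E] P) where
  carrier := {f | ∀ x, f x ∈ V}
  add_mem' hf hg x := add_mem (hf x) (hg x)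
  zero_mem' _ := zero_mem _
  smul_mem' a _ hf x := Submodule.smul_mem _ a (hf x)

theorem smulHom_apply_apply {γ₀ : Γ} {ι : Γ →ₗ[E] E} (hι : ∀ γ, ι γ • γ₀ = γ) (f : Γ →ₗ[E] P) :
    smulHom A P ι (f γ₀) = f :=
  LinearMap.ext fun γ => (map_smul f (ι γ) γ₀).symm.trans (congrArg f (hι γ))

variable {V : Submodule A P}

theorem smulHom_mem_homInto (hV : ∀ (e : E), ∀ v ∈ V, e • v ∈ V) (ι : Γ →ₗ[E] E) {v : P}
    (hv : v ∈ V) : smulHom A P ι v ∈ homInto E Γ V := fun γ => hV (ι γ) v hv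

variable [IsSemisimpleRing E] [IsSimpleModule E Γ]

theorem evalAt_injective {γ₀ : Γ} (h : γ₀ ≠ 0) : Function.Injective (evalAt (E := E) A P γ₀) := by
  obtain ⟨ι, hι⟩ := exists_section (E := E) h
  intro f g hfg
  rw [← smulHom_apply_apply (A := A) hι f, ← smulHom_apply_apply (A := A) hι g]
  exact congrArg _ hfg

/-- Evaluation at γ₀ embeds Hom_E(Γ, P) in P. A map f lies in Hom_E(Γ, V) as soon as f(γ₀) lies in
V, because f(γ) = ι(γ) f(γ₀). -/
theorem homInto_isEssential (hV : ∀ (e : E), ∀ v ∈ V, e • v ∈ V) (hess : IsEssential V) :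
    IsEssential (homInto E Γ V) := by
  have := IsSimpleModule.nontrivial E Γ
  obtain ⟨γ₀, hγ₀⟩ := exists_ne (0 : Γ)
  obtain ⟨ι, hι⟩ := exists_section (E := E) hγ₀
  intro N hN
  have hinj := evalAt_injective (A := A) (P := P) (E := E) hγ₀
  have h0 : N.map (evalAt A P γ₀) = ⊥ := by
    refine hess _ ((Submodule.eq_bot_iff _).2 ?_)
    rintro _ ⟨hx, ⟨f, hf, rfl⟩⟩
    have hfV : f ∈ homInto E Γ V := by
      rw [← smulHom_apply_apply (A := A) hι f]
      exact smulHom_mem_homInto hV ι hx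
    have : f ∈ homInto E Γ V ⊓ N := ⟨hfV, hf⟩
    rw [hN, Submodule.mem_bot] at this
    rw [this, map_zero]
  exact Submodule.map_injective_of_injective hinj (h0.trans (Submodule.map_bot _).symm)

/-- Fullness of Γ ↦ Hom_E(Γ, V): composed with the retractions, φ becomes an endomorphism of V,
which is the action of some e in E. Then φ is precomposition with γ ↦ ι'(γ) e γ₀. -/
theorem exists_precomp [IsSimpleModule E Γ'] (hV : ∀ (e : E), ∀ v ∈ V, e • v ∈ V)
    (hend : ∀ f : V →ₗ[A] P, (∀ v, f v ∈ V) → ∃ e : E, ∀ v, f v = e • (v : P))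
    (φ : homInto E Γ V →ₗ[A] (homInto E Γ' V)) :
    ∃ ψ : Γ' →ₗ[E] Γ, ∀ f, (φ f : Γ' →ₗ[E] P) = (f : Γ →ₗ[E] P) ∘ₗ ψ := by
  have := IsSimpleModule.nontrivial E Γ
  have := IsSimpleModule.nontrivial E Γ'
  obtain ⟨γ₀, hγ₀⟩ := exists_ne (0 : Γ)
  obtain ⟨ι, hι⟩ := exists_section (E := E) hγ₀
  obtain ⟨γ₁, hγ₁⟩ := exists_ne (0 : Γ')
  obtain ⟨ι', hι'⟩ := exists_section (E := E) hγ₁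
  obtain ⟨e, he⟩ := hend (evalAt A P γ₁ ∘ₗ (homInto E Γ' V).subtype ∘ₗ φ ∘ₗ
    ((smulHom A P ι ∘ₗ V.subtype).codRestrict (homInto E Γ V)
      fun v => smulHom_mem_homInto hV ι v.2)) fun v => (φ _).2 γ₁
  have key : ∀ f, (φ f : Γ' →ₗ[E] P) γ₁ = e • (f : Γ →ₗ[E] P) γ₀ := by
    intro f
    rw [← he ⟨(f : Γ →ₗ[E] P) γ₀, f.2 γ₀⟩]
    have : (⟨smulHom A P ι ((f : Γ →ₗ[E] P) γ₀), smulHom_mem_homInto hV ι (f.2 γ₀)⟩ :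
        homInto E Γ V) = f := Subtype.ext (smulHom_apply_apply hι _)
    exact congrArg (fun f => (φ f : Γ' →ₗ[E] P) γ₁) this.symm
  refine ⟨(LinearMap.toSpanSingleton E Γ (e • γ₀)) ∘ₗ ι', fun f => LinearMap.ext fun γ => ?_⟩
  rw [← smulHom_apply_apply (A := A) hι' (φ f : Γ' →ₗ[E] P), key]
  change ι' γ • e • (f : Γ →ₗ[E] P) γ₀ = (f : Γ →ₗ[E] P) (ι' γ • e • γ₀)
  rw [map_smul, map_smul]

theorem homInto_nontrivial (hV : ∀ (e : E), ∀ v ∈ V, e • v ∈ V)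
    (hfaith : ∀ e : E, (∀ v ∈ V, e • v = 0) → e = 0) :
    Nontrivial (homInto E Γ V) := by
  have := IsSimpleModule.nontrivial E Γ
  obtain ⟨γ₀, hγ₀⟩ := exists_ne (0 : Γ)
  obtain ⟨ι, hι⟩ := exists_section (E := E) hγ₀
  rw [Submodule.nontrivial_iff_ne_bot, Submodule.ne_bot_iff]
  by_contra! hcon
  refine hγ₀ ?_
  rw [← hι γ₀, hfaith (ι γ₀) fun v hv => ?_, zero_smul]
  exact LinearMap.congr_fun (hcon _ (smulHom_mem_homInto hV ι hv)) γ₀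

theorem homInto_isSemisimple (hss : IsSemisimpleModule A V) :
    IsSemisimpleModule A (homInto E Γ V) := by
  have := IsSimpleModule.nontrivial E Γ
  obtain ⟨γ₀, hγ₀⟩ := exists_ne (0 : Γ)
  refine IsSemisimpleModule.of_injective ((evalAt A P γ₀ ∘ₗ (homInto E Γ V).subtype).codRestrict V
    fun f => f.2 γ₀) fun f g hfg => Subtype.ext (evalAt_injective (A := A) hγ₀ ?_)
  exact congrArg Subtype.val hfg

/-- By semisimplicity a submodule N has a projection, which is precomposition with an endomorphism ψ
of Γ. Schur's lemma makes ψ zero or bijective, so N is zero or everything. -/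
theorem homInto_isSimple (hss : IsSemisimpleModule A V) (hV : ∀ (e : E), ∀ v ∈ V, e • v ∈ V)
    (hend : ∀ f : V →ₗ[A] P, (∀ v, f v ∈ V) → ∃ e : E, ∀ v, f v = e • (v : P))
    (hfaith : ∀ e : E, (∀ v ∈ V, e • v = 0) → e = 0) :
    IsSimpleModule A (homInto E Γ V) := by
  have hs := homInto_isSemisimple (E := E) (Γ := Γ) hss
  have hn := homInto_nontrivial (E := E) (Γ := Γ) hV hfaith
  refine (isSimpleModule_iff _ _).2 ⟨fun N => ?_⟩
  obtain ⟨N', hN'⟩ := exists_isCompl N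
  obtain ⟨ψ, hψ⟩ := exists_precomp hV hend (N.subtype ∘ₗ N.projectionOnto N' hN')
  rcases LinearMap.bijective_or_eq_zero ψ with hb | h0
  · right
    have hN0 : N' = ⊥ := by
      rw [Submodule.eq_bot_iff]
      intro f hf
      refine Subtype.ext (LinearMap.ext fun γ => ?_)
      obtain ⟨γ', rfl⟩ := hb.2 γ
      have h1 := LinearMap.congr_fun (hψ f) γ'
      have h2 : N.projectionOnto N' hN' f = 0 :=
        (Submodule.projectionOnto_apply_eq_zero_iff hN').2 hf
      rw [LinearMap.comp_apply, h2, map_zero] at h1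
      exact h1.symm
    rw [← hN'.sup_eq_top, hN0, sup_bot_eq]
  · left
    rw [Submodule.eq_bot_iff]
    intro f hf
    have h1 := hψ f
    have h2 := Submodule.projectionOnto_apply_left hN' ⟨f, hf⟩
    rw [LinearMap.comp_apply] at h1
    simp only at h2
    rw [h2, h0, LinearMap.comp_zero] at h1
    exact Subtype.ext h1

theorem nonempty_linearEquiv_of_homInto [IsSimpleModule E Γ']
    (hV : ∀ (e : E), ∀ v ∈ V, e • v ∈ V)
    (hend : ∀ f : V →ₗ[A] P, (∀ v, f v ∈ V) → ∃ e : E, ∀ v, f v = e • (v : P))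
    (hfaith : ∀ e : E, (∀ v ∈ V, e • v = 0) → e = 0)
    (φ : homInto E Γ V ≃ₗ[A] (homInto E Γ' V)) :
    Nonempty (Γ ≃ₗ[E] Γ') := by
  have hn := homInto_nontrivial (A := A) (E := E) (Γ := Γ) hV hfaith
  obtain ⟨ψ, hψ⟩ := exists_precomp hV hend φ.toLinearMap
  rcases LinearMap.bijective_or_eq_zero ψ with hb | h0
  · exact ⟨(LinearEquiv.ofBijective ψ hb).symm⟩
  · obtain ⟨f, hf⟩ := exists_ne (0 : homInto E Γ V)
    refine (hf (φ.injective ?_)).elim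
    rw [map_zero]
    refine Subtype.ext ((hψ f).trans ?_)
    rw [h0, LinearMap.comp_zero]
    rfl

omit [IsSemisimpleRing E] in
/-- A simple submodule of `V` is isomorphic to `Hom_E(I, V)` for some simple left ideal `I`. -/
theorem exists_ideal_linearEquiv_homInto [IsSemisimpleRing E] (hss : IsSemisimpleModule A V)
    (hV : ∀ (e : E), ∀ v ∈ V, e • v ∈ V)
    (hend : ∀ f : V →ₗ[A] P, (∀ v, f v ∈ V) → ∃ e : E, ∀ v, f v = e • (v : P))
    (hfaith : ∀ e : E, (∀ v ∈ V, e • v = 0) → e = 0) {W : Type*} [AddCommGroup W] [Module A W]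
    [IsSimpleModule A W] (i : W →ₗ[A] P) (hi : i ≠ 0) (hiV : ∀ w, i w ∈ V) :
    ∃ I : Ideal E, IsSimpleModule E I ∧
      Nonempty (W ≃ₗ[A] (homInto E I V)) := by
  obtain ⟨w, hw⟩ : ∃ w, i w ≠ 0 := by
    by_contra! h
    exact hi (LinearMap.ext h)
  -- The simple left ideals generate E. If all of them killed i w, so would 1.
  have hex : ∃ I : Ideal E, IsSimpleModule E I ∧ ∃ x ∈ I, x • i w ≠ 0 := by
    by_contra! hcon
    have htop : sSup {I : Ideal E | IsSimpleModule E I} ≤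
        LinearMap.ker (LinearMap.toSpanSingleton E P (i w)) :=
      sSup_le fun I hI x hx => hcon I hI x hx
    rw [IsSemisimpleModule.sSup_simples_eq_top] at htop
    have := htop (Submodule.mem_top (x := (1 : E)))
    rw [LinearMap.mem_ker, LinearMap.toSpanSingleton_apply, one_smul] at this
    exact hw this
  obtain ⟨I, hI, x, hx, hxw⟩ := hex
  have hsimple := homInto_isSimple (E := E) (Γ := I) hss hV hend hfaith
  let φ : W →ₗ[A] (homInto E I V) :=
    (smulHom A P I.subtype ∘ₗ i).codRestrict (homInto E I V)
      fun w => smulHom_mem_homInto hV _ (hiV w)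
  have hφ : φ ≠ 0 := fun h => hxw (by
    have h1 := congrArg Subtype.val (LinearMap.congr_fun h w)
    exact LinearMap.congr_fun h1 ⟨x, hx⟩)
  exact ⟨I, hI, ⟨LinearEquiv.ofBijective φ (LinearMap.bijective_of_ne_zero hφ)⟩⟩

end Bimodule

/-! ### The modules `S_{T,α}` and `V_{T,α}` -/

section Hulls

open scoped Pointwise

variable {k : Type u} [Field k] [CharZero k] {Ψ : Type v} {G : Subgroup (Equiv.Perm Ψ)} {T : Set Ψ}

theorem Tame.vMod_eq (hG : Tame G) (hT : FinClosed G T) (Γ : Type*) [AddCommGroup Γ]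
    [Module (MonoidAlgebra k (AutT G T)) Γ] :
    VMod k G T Γ = homInto (MonoidAlgebra k (AutT G T)) Γ (commonKer k G T) := by
  rw [← hG.vField_eq hT]
  rfl

/-- Injectivity of k⟨G/G_T⟩ extends f to an endomorphism of the whole module. This is the hypothesis
`hend` of the bimodule lemmas. -/
theorem Tame.exists_smul_of_hom (hG : Tame G) (hT : FinClosed G T)
    (f : commonKer k G T →ₗ[MonoidAlgebra k G] PermModule k (stab G T)) :
    ∃ e : MonoidAlgebra k (AutT G T), ∀ v, f v = e • (v : PermModule k (stab G T)) := by
  obtain ⟨h, rfl⟩ := hG.exists_extension hT (isSmooth_permModule T hT.1)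
    (commonKer k G T).subtype (Submodule.subtype_injective _) f
  obtain ⟨e, he⟩ := hG.exists_smul_of_endomorphism hT h
  exact ⟨e, fun v => he v⟩

section

variable (Γ : Type*) [AddCommGroup Γ] [Module (MonoidAlgebra k (AutT G T)) Γ]
  [IsSimpleModule (MonoidAlgebra k (AutT G T)) Γ]

theorem Tame.isSimpleModule_vMod (hG : Tame G) (hT : FinClosed G T) :
    IsSimpleModule (MonoidAlgebra k G) (VMod k G T Γ) := by
  have := isSemisimpleRing_autT (k := k) hT
  rw [hG.vMod_eq hT]
  exact homInto_isSimple (hG.isSemisimpleModule_commonKer hT) (fun e _ => smul_mem_commonKer e)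
    (fun f _ => hG.exists_smul_of_hom hT f) fun _ => hG.eq_zero_of_smul_commonKer hT

theorem Tame.isEssential_vMod (hG : Tame G) (hT : FinClosed G T) :
    IsEssential (VMod k G T Γ) := by
  have := isSemisimpleRing_autT (k := k) hT
  rw [hG.vMod_eq hT]
  exact homInto_isEssential (fun e _ => smul_mem_commonKer e) (hG.isEssential_commonKer hT)

theorem Tame.isIndecomposable_sMod (hG : Tame G) (hT : FinClosed G T) :
    IsIndecomposable (MonoidAlgebra k G) (SMod k G T Γ) :=
  (hG.isEssential_vMod Γ hT).isIndecomposable (hG.isSimpleModule_vMod Γ hT)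

/-- Smoothness and injectivity of S_{T,α} are inherited from k⟨G/G_T⟩ through this retraction. -/
theorem exists_retraction_sMod (hT : FinClosed G T) :
    ∃ (i : SMod k G T Γ →ₗ[MonoidAlgebra k G] PermModule k (stab G T))
      (r : PermModule k (stab G T) →ₗ[MonoidAlgebra k G] SMod k G T Γ), ∀ f, r (i f) = f := by
  have := isSemisimpleRing_autT (k := k) hT
  have := IsSimpleModule.nontrivial (MonoidAlgebra k (AutT G T)) Γ
  obtain ⟨γ₀, hγ₀⟩ := exists_ne (0 : Γ)
  obtain ⟨ι, hι⟩ := exists_section (E := MonoidAlgebra k (AutT G T)) hγ₀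
  exact ⟨evalAt _ _ γ₀, smulHom _ _ ι, smulHom_apply_apply hι⟩

theorem isSmooth_sMod (hT : FinClosed G T) : IsSmooth k G (SMod k G T Γ) := by
  obtain ⟨i, r, h⟩ := exists_retraction_sMod (k := k) Γ hT
  exact (isSmooth_permModule T hT.1).of_injective i (Function.LeftInverse.injective h)

end

theorem Tame.isInjectiveSmooth_sMod (hG : Tame G) (hT : FinClosed G T) (Γ : Type (max u v))
    [AddCommGroup Γ] [Module (MonoidAlgebra k (AutT G T)) Γ]
    [IsSimpleModule (MonoidAlgebra k (AutT G T)) Γ] : IsInjectiveSmooth k G (SMod k G T Γ) := by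
  refine ⟨isSmooth_sMod Γ hT, fun X Y _ _ _ _ _ hY i f hi => ?_⟩
  obtain ⟨j, r, h⟩ := exists_retraction_sMod (k := k) Γ hT
  obtain ⟨g, hg⟩ := hG.exists_extension hT hY i hi (j ∘ₗ f)
  refine ⟨r ∘ₗ g, LinearMap.ext fun x => ?_⟩
  have := LinearMap.congr_fun hg x
  simp only [LinearMap.comp_apply] at this ⊢
  rw [this, h]

-- The image of an injective module is a direct summand, and an indecomposable module has no proper
-- non-zero one.
omit [CharZero k] in
theorem IsInjectiveSmooth.bijective_of_injective {E M : Type (max u v)} [AddCommGroup E]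
    [Module (MonoidAlgebra k G) E] [AddCommGroup M] [Module (MonoidAlgebra k G) M]
    (hE : IsInjectiveSmooth k G E) [Nontrivial E] (hM : IsSmooth k G M)
    (hM' : IsIndecomposable (MonoidAlgebra k G) M) (j : E →ₗ[MonoidAlgebra k G] M)
    (hj : Function.Injective j) : Function.Bijective j := by
  obtain ⟨h, hh⟩ := hE.2 E M hE.1 hM j LinearMap.id hj
  have hhj : ∀ x, h (j x) = x := LinearMap.congr_fun hh
  have hc : IsCompl (LinearMap.range j) (LinearMap.ker h) := by
    refine ⟨disjoint_iff.2 ((Submodule.eq_bot_iff _).2 ?_), codisjoint_iff.2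
      (Submodule.eq_top_iff'.2 fun m => ?_)⟩
    · rintro _ ⟨⟨x, rfl⟩, hx⟩
      have hx' : h (j x) = 0 := hx
      rw [hhj] at hx'
      rw [hx', map_zero]
    · refine Submodule.mem_sup.2 ⟨j (h m), ⟨_, rfl⟩, m - j (h m), ?_, add_sub_cancel _ _⟩
      rw [LinearMap.mem_ker, map_sub, hhj, sub_self]
  have hker : LinearMap.ker h = ⊥ := (hM'.2 _ _ hc).resolve_left fun h0 => by
    obtain ⟨x, hx⟩ := exists_ne (0 : E)
    exact hx (hj (by rw [map_zero]; exact (Submodule.eq_bot_iff _).1 h0 _ ⟨x, rfl⟩))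
  refine ⟨hj, fun m => ⟨h m, ?_⟩⟩
  rw [← sub_eq_zero]
  refine (Submodule.eq_bot_iff _).1 hker _ ?_
  rw [LinearMap.mem_ker, map_sub, hhj, sub_self]

-- The map is f ↦ τ ∘ f ∘ φ⁻¹, where τ is right translation by x⁻¹. Injectivity suffices, as an
-- injection between indecomposable injective modules is an isomorphism.
omit [CharZero k] in
theorem Transforms.exists_injective {x : G} {T' : Set Ψ} (hT : FinClosed G T)
    (hT' : FinClosed G T') {Γ : Type*}
    [AddCommGroup Γ] [Module (MonoidAlgebra k (AutT G T)) Γ] {Γ' : Type*} [AddCommGroup Γ']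
    [Module (MonoidAlgebra k (AutT G T')) Γ'] (h : Transforms k G x T T' Γ Γ') :
    ∃ j : SMod k G T Γ →ₗ[MonoidAlgebra k G] SMod k G T' Γ', Function.Injective j := by
  obtain ⟨hx, φ, hφ⟩ := h
  have hx₁ : x⁻¹ • T' = T := by rw [inv_smul_eq_iff]; exact hx.symm
  let τ := translate k x⁻¹ hx₁.subset
  have hτ : Function.Injective τ := by
    refine Function.LeftInverse.injective (g := translate k x (show x • T ⊆ T' from hx.subset)) ?_
    have hid : translate k x (show x • T ⊆ T' from hx.subset) ∘ₗ τ = LinearMap.id := by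
      refine PermModule.hom_ext ?_
      simp only [τ, LinearMap.comp_apply, translate_single, one_mul, inv_mul_cancel,
        LinearMap.id_apply]
    exact LinearMap.congr_fun hid
  have hτe : ∀ (c : k) (n : Subgroup.normalizer (stab G T : Set G))
      (n' : Subgroup.normalizer (stab G T' : Set G)), (n' : G) = x * n * x⁻¹ → ∀ p,
      τ (MonoidAlgebra.single (n : AutT G T) c • p) =
        MonoidAlgebra.single (n' : AutT G T') c • τ p := by
    intro c n n' hn p
    induction p using PermModule.induction with
    | zero => simp only [smul_zero, map_zero]
    | add p q hp hq => rw [smul_add, map_add, map_add, smul_add, hp, hq]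
    | single y d =>
      induction y using QuotientGroup.induction_on with
      | H y =>
        rw [right_smul_single, translate_single, translate_single, right_smul_single, hn]
        congr 2
        group
  have hlin : ∀ (f : SMod k G T Γ) (e' : MonoidAlgebra k (AutT G T')) (γ' : Γ'),
      τ (f (φ.symm (e' • γ'))) = e' • τ (f (φ.symm γ')) := by
    intro f e' γ'
    induction e' using MonoidAlgebra.induction_linear with
    | zero => simp only [zero_smul, map_zero]
    | add a b ha hb => simp only [add_smul, map_add, ha, hb]
    | single w c =>
      induction w using QuotientGroup.induction_on with
      | H n' =>
        have hn : x⁻¹ * n' * x ∈ Subgroup.normalizer (stab G T : Set G) := by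
          rw [mem_normalizer_iff hT, mul_smul, mul_smul, show x • T = T' from hx,
            (mem_normalizer_iff hT').1 n'.2, hx₁]
        have hn' : (n' : G) = x * ((⟨_, hn⟩ : Subgroup.normalizer (stab G T : Set G)) : G) * x⁻¹ := by
          simp [mul_assoc]
        rw [← hτe c ⟨_, hn⟩ n' hn', ← map_smul]
        congr 2
        rw [AddEquiv.symm_apply_eq, hφ c _ n' hn', AddEquiv.apply_symm_apply]
  let j₀ : SMod k G T Γ → SMod k G T' Γ' := fun f =>
    { toFun := fun γ' => τ (f (φ.symm γ'))
      map_add' := fun a b => by rw [map_add, map_add, map_add]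
      map_smul' := hlin f }
  let j : SMod k G T Γ →ₗ[MonoidAlgebra k G] SMod k G T' Γ' :=
    { toFun := j₀
      map_add' := fun f g => LinearMap.ext fun γ' => map_add τ _ _
      map_smul' := fun a f => LinearMap.ext fun γ' => map_smul τ a _ }
  refine ⟨j, fun f g hfg => LinearMap.ext fun γ => hτ ?_⟩
  have : τ (f (φ.symm (φ γ))) = τ (g (φ.symm (φ γ))) := LinearMap.congr_fun hfg (φ γ)
  rwa [AddEquiv.symm_apply_apply] at this

omit [CharZero k] in
/-- Conjugation of modules over `k⟨Aut(T)⟩`. -/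
theorem exists_transforms (hT : FinClosed G T) {T' : Set Ψ} (hT' : FinClosed G T') {x : G}
    (hx : x • T = T') (Γ' : Type*) [AddCommGroup Γ'] [Module (MonoidAlgebra k (AutT G T')) Γ']
    (hΓ' : IsSimpleModule (MonoidAlgebra k (AutT G T')) Γ') :
    ∃ (_ : Module (MonoidAlgebra k (AutT G T)) Γ'),
      IsSimpleModule (MonoidAlgebra k (AutT G T)) Γ' ∧ Transforms k G x T T' Γ' Γ' := by
  have hconj : ∀ n : Subgroup.normalizer (stab G T : Set G),
      x * n * x⁻¹ ∈ Subgroup.normalizer (stab G T' : Set G) := fun n => by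
    rw [mem_normalizer_iff hT', mul_smul, mul_smul, ← hx, inv_smul_smul,
      (mem_normalizer_iff hT).1 n.2]
  let c₀ : Subgroup.normalizer (stab G T : Set G) →* Subgroup.normalizer (stab G T' : Set G) :=
    { toFun := fun n => ⟨_, hconj n⟩
      map_one' := Subtype.ext (by simp)
      map_mul' := fun a b => Subtype.ext (by simp [mul_assoc]) }
  let c : AutT G T →* AutT G T' := QuotientGroup.map _ _ c₀ (by
    intro n hn
    have := conj_mem_stab (g := x) (show (n : G) ∈ stab G T from hn)
    rw [hx] at this
    exact this)
  have hc : Function.Surjective c := by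
    intro w
    induction w using QuotientGroup.induction_on with
    | H n' =>
      have hn : x⁻¹ * n' * x ∈ Subgroup.normalizer (stab G T : Set G) := by
        rw [mem_normalizer_iff hT, mul_smul, mul_smul, hx, (mem_normalizer_iff hT').1 n'.2, ← hx,
          inv_smul_smul]
      refine ⟨((⟨_, hn⟩ : Subgroup.normalizer (stab G T : Set G)) : AutT G T), ?_⟩
      exact congrArg QuotientGroup.mk (Subtype.ext (show x * (x⁻¹ * n' * x) * x⁻¹ = n' by group))
  let σ : MonoidAlgebra k (AutT G T) →+* MonoidAlgebra k (AutT G T') :=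
    MonoidAlgebra.mapDomainRingHom k c
  have hσ : ∀ w (d : k), σ (MonoidAlgebra.single w d) = MonoidAlgebra.single (c w) d := fun w d =>
    MonoidAlgebra.mapDomain_single
  have hσs : Function.Surjective σ := by
    intro a
    induction a using MonoidAlgebra.induction_linear with
    | zero => exact ⟨0, map_zero σ⟩
    | add a b ha hb =>
      obtain ⟨a, rfl⟩ := ha
      obtain ⟨b, rfl⟩ := hb
      exact ⟨a + b, map_add σ a b⟩
    | single w d =>
      obtain ⟨w, rfl⟩ := hc w
      exact ⟨_, hσ w d⟩
  have : RingHomSurjective σ := ⟨hσs⟩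
  -- The twisted module structure has the same submodules, since σ is surjective, so simplicity is
  -- preserved.
  let m : Module (MonoidAlgebra k (AutT G T)) Γ' := Module.compHom Γ' σ
  refine ⟨m, ?_, hx, AddEquiv.refl Γ', ?_⟩
  · let l : Γ' →ₛₗ[σ] Γ' :=
      { toFun := id, map_add' := fun _ _ => rfl, map_smul' := fun _ _ => rfl }
    exact (LinearMap.isSimpleModule_iff_of_bijective l Function.bijective_id).2 hΓ'
  · intro d n n' hn γ
    change σ (MonoidAlgebra.single (n : AutT G T) d) • γ = _
    rw [hσ]
    have : c (n : AutT G T) = (n' : AutT G T') := congrArg QuotientGroup.mk (Subtype.ext hn.symm)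
    rw [this]
    rfl

end Hulls

/-! ### Classification of simple and of indecomposable injective modules -/

section Classification

open scoped Pointwise

variable {k : Type u} [Field k] [CharZero k] {Ψ : Type v} {G : Subgroup (Equiv.Perm Ψ)}
  {T T' : Set Ψ}

theorem IsIndecomposable.nontrivial {A : Type*} [Ring A] {M : Type*} [AddCommGroup M] [Module A M]
    (h : IsIndecomposable A M) : Nontrivial M := h.1

section

variable {Γ : Type (max u v)} [AddCommGroup Γ] [Module (MonoidAlgebra k (AutT G T)) Γ]
  [IsSimpleModule (MonoidAlgebra k (AutT G T)) Γ]
  {Γ' : Type (max u v)} [AddCommGroup Γ'] [Module (MonoidAlgebra k (AutT G T')) Γ']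
  [IsSimpleModule (MonoidAlgebra k (AutT G T')) Γ']

theorem Tame.sMod_linearEquiv_of_transforms (hG : Tame G) (hT : FinClosed G T)
    (hT' : FinClosed G T') {x : G} (h : Transforms k G x T T' Γ Γ') :
    Nonempty (SMod k G T Γ ≃ₗ[MonoidAlgebra k G] SMod k G T' Γ') := by
  obtain ⟨j, hj⟩ := h.exists_injective hT hT'
  have := (hG.isIndecomposable_sMod (k := k) Γ hT).nontrivial
  exact ⟨LinearEquiv.ofBijective j ((hG.isInjectiveSmooth_sMod hT Γ).bijective_of_injective
    (isSmooth_sMod Γ' hT') (hG.isIndecomposable_sMod Γ' hT') j hj)⟩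

theorem Tame.vMod_linearEquiv_of_sMod (hG : Tame G) (hT : FinClosed G T)
    (hT' : FinClosed G T') (e : SMod k G T Γ ≃ₗ[MonoidAlgebra k G] SMod k G T' Γ') :
    Nonempty (VMod k G T Γ ≃ₗ[MonoidAlgebra k G] VMod k G T' Γ') :=
  (hG.isEssential_vMod Γ hT).nonempty_linearEquiv (hG.isSimpleModule_vMod Γ hT)
    (hG.isEssential_vMod Γ' hT') (hG.isSimpleModule_vMod Γ' hT') e

/-- An isomorphism e produces a morphism k⟨G/G_T⟩ → k⟨G/G_{T'}⟩ that is non-zero on the common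
kernel, so T and T' are conjugate. After transporting Γ' to T, the bimodule lemmas compare two
modules over the same algebra. -/
theorem Tame.exists_transforms_of_vMod (hG : Tame G) (hT : FinClosed G T)
    (hT' : FinClosed G T') (e : VMod k G T Γ ≃ₗ[MonoidAlgebra k G] VMod k G T' Γ') :
    ∃ x : G, Transforms k G x T T' Γ Γ' := by
  have hssT := isSemisimpleRing_autT (k := k) hT
  have hssT' := isSemisimpleRing_autT (k := k) hT'
  obtain ⟨x, hx⟩ : ∃ x : G, x • T = T' := by
    have := IsSimpleModule.nontrivial (MonoidAlgebra k (AutT G T)) Γ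
    have := IsSimpleModule.nontrivial (MonoidAlgebra k (AutT G T')) Γ'
    obtain ⟨γ₀, hγ₀⟩ := exists_ne (0 : Γ)
    obtain ⟨ι, hι⟩ := exists_section (E := MonoidAlgebra k (AutT G T)) hγ₀
    obtain ⟨γ₁, hγ₁⟩ := exists_ne (0 : Γ')
    have hmem : ∀ v : commonKer k G T, smulHom (MonoidAlgebra k G) _ ι (v : PermModule k (stab G T)) ∈
        VMod k G T Γ := fun v => by
      rw [hG.vMod_eq hT]
      exact smulHom_mem_homInto (fun e _ => smul_mem_commonKer e) ι v.2
    let r : commonKer k G T →ₗ[MonoidAlgebra k G] VMod k G T Γ :=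
      (smulHom (MonoidAlgebra k G) _ ι ∘ₗ (commonKer k G T).subtype).codRestrict _ hmem
    let g : commonKer k G T →ₗ[MonoidAlgebra k G] PermModule k (stab G T') :=
      evalAt _ _ γ₁ ∘ₗ (VMod k G T' Γ').subtype ∘ₗ e.toLinearMap ∘ₗ r
    obtain ⟨h, hh⟩ := hG.exists_extension hT' (isSmooth_permModule T hT.1)
      (commonKer k G T).subtype (Submodule.subtype_injective _) g
    have hsV := hG.isSimpleModule_vMod (k := k) Γ hT
    have := IsSimpleModule.nontrivial (MonoidAlgebra k G) (VMod k G T Γ)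
    obtain ⟨f, hf⟩ := exists_ne (0 : VMod k G T Γ)
    have hfV : (f : SMod k G T Γ) γ₀ ∈ commonKer k G T := (hG.vMod_eq hT Γ).le f.2 γ₀
    have hrf : r ⟨_, hfV⟩ = f := Subtype.ext (smulHom_apply_apply (A := MonoidAlgebra k G) hι _)
    have hgf : h ((f : SMod k G T Γ) γ₀) ≠ 0 := by
      intro h0
      have h1 : g ⟨_, hfV⟩ = 0 := (LinearMap.congr_fun hh ⟨_, hfV⟩).symm.trans h0
      have h2 : evalAt (MonoidAlgebra k G) (PermModule k (stab G T')) γ₁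
          (e (r ⟨_, hfV⟩) : SMod k G T' Γ') = 0 := h1
      rw [hrf] at h2
      have h3 := evalAt_injective (E := MonoidAlgebra k (AutT G T')) hγ₁
        (h2.trans (map_zero (evalAt (MonoidAlgebra k G) (PermModule k (stab G T')) γ₁)).symm)
      exact hf (e.injective (Subtype.ext h3 |>.trans (map_zero e).symm))
    obtain ⟨x, hx⟩ := hG.exists_smul_eq hT hT' hfV hgf
    exact ⟨x⁻¹, by rw [← hx, inv_smul_smul]⟩
  -- From here Γ' also carries a conjugated k⟨Aut(T)⟩-structure. Composing e with the resulting
  -- isomorphism reduces to the case of a single T.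
  obtain ⟨m, hm, htr⟩ := exists_transforms (k := k) hT hT' hx Γ' inferInstance
  obtain ⟨e'⟩ := hG.sMod_linearEquiv_of_transforms hT hT' htr
  obtain ⟨e''⟩ := hG.vMod_linearEquiv_of_sMod hT hT' e'
  have e₀ := e.trans e''.symm
  rw [hG.vMod_eq hT, hG.vMod_eq hT] at e₀
  obtain ⟨ψ⟩ := nonempty_linearEquiv_of_homInto (fun e _ => smul_mem_commonKer e)
    (fun f _ => hG.exists_smul_of_hom hT f) (fun _ => hG.eq_zero_of_smul_commonKer hT) e₀
  obtain ⟨h1, φ, hφ⟩ := htr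
  refine ⟨x, h1, ψ.toAddEquiv.trans φ, fun c n n' hn γ => ?_⟩
  exact (congrArg φ (map_smul ψ _ γ)).trans (hφ c n n' hn (ψ γ))

end

/-- The image is simple, so it lies in the essential common kernel, where
`exists_ideal_linearEquiv_homInto` applies. -/
theorem Tame.exists_vMod_of_hom (hG : Tame G) (hT : FinClosed G T) {W : Type*} [AddCommGroup W]
    [Module (MonoidAlgebra k G) W] [IsSimpleModule (MonoidAlgebra k G) W]
    {f : W →ₗ[MonoidAlgebra k G] PermModule k (stab G T)} (hf : f ≠ 0) :
    ∃ I : Ideal (MonoidAlgebra k (AutT G T)), IsSimpleModule (MonoidAlgebra k (AutT G T)) I ∧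
      Nonempty (W ≃ₗ[MonoidAlgebra k G] VMod k G T I) := by
  have := isSemisimpleRing_autT (k := k) hT
  have hle : LinearMap.range f ≤ commonKer k G T :=
    (hG.isEssential_commonKer hT).le_of_isSimpleModule
      ((LinearEquiv.ofInjective f (LinearMap.injective_of_ne_zero hf)).isSimpleModule_iff.1
        inferInstance)
  obtain ⟨I, hI, h⟩ := exists_ideal_linearEquiv_homInto (hG.isSemisimpleModule_commonKer hT)
    (fun e _ => smul_mem_commonKer e) (fun f _ => hG.exists_smul_of_hom hT f)
    (fun _ => hG.eq_zero_of_smul_commonKer hT) f hf fun w => hle ⟨w, rfl⟩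
  exact ⟨I, hI, by rwa [hG.vMod_eq hT]⟩

theorem Tame.exists_vMod (hG : Tame G) {W : Type*} [AddCommGroup W]
    [Module (MonoidAlgebra k G) W] [IsSimpleModule (MonoidAlgebra k G) W]
    (hW : IsSmooth k G W) :
    ∃ (T : Set Ψ) (Γ : Type (max u v)) (_ : AddCommGroup Γ)
      (_ : Module (MonoidAlgebra k (AutT G T)) Γ), FinClosed G T ∧
      IsSimpleModule (MonoidAlgebra k (AutT G T)) Γ ∧
      Nonempty (W ≃ₗ[MonoidAlgebra k G] VMod k G T Γ) := by
  have := IsSimpleModule.nontrivial (MonoidAlgebra k G) W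
  obtain ⟨w, hw⟩ := exists_ne (0 : W)
  obtain ⟨T, hT, f, hf⟩ := hG.exists_hom_ne_zero hW hw
  obtain ⟨I, hI, h⟩ := hG.exists_vMod_of_hom hT (f := f) fun h => hf (by rw [h]; rfl)
  exact ⟨T, I, _, _, hT, hI, h⟩

/-- A cyclic smooth module has finite length, so it contains a simple submodule even when M itself
is large. -/
theorem Tame.exists_simple_submodule (hG : Tame G) {M : Type*} [AddCommGroup M]
    [Module (MonoidAlgebra k G) M] [Nontrivial M] (hM : IsSmooth k G M) :
    ∃ W : Submodule (MonoidAlgebra k G) M, IsSimpleModule (MonoidAlgebra k G) W := by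
  obtain ⟨m, hm⟩ := exists_ne (0 : M)
  let N := Submodule.span (MonoidAlgebra k G) {m}
  have hfl := hG.isFiniteLength_of_fg (hM.submodule N)
  have := (isFiniteLength_iff_isNoetherian_isArtinian.1 hfl).2
  have hN : (⊤ : Submodule (MonoidAlgebra k G) N) ≠ ⊥ := fun h => hm <| by
    have : (⟨m, Submodule.mem_span_singleton_self m⟩ : N) ∈ (⊥ : Submodule _ N) :=
      h ▸ Submodule.mem_top
    exact congrArg Subtype.val ((Submodule.mem_bot _).1 this)
  obtain ⟨a, ha, -⟩ := (eq_bot_or_exists_atom_le (⊤ : Submodule (MonoidAlgebra k G) N)).resolve_left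
    hN
  exact ⟨a.map N.subtype, (a.equivMapOfInjective _ N.subtype_injective).isSimpleModule_iff.1
    (isSimpleModule_iff_isAtom.2 ha)⟩

omit [CharZero k] in
/-- An embedding of an essential submodule of an injective module into an indecomposable injective
module extends to an isomorphism. -/
theorem IsInjectiveSmooth.exists_linearEquiv {E E' : Type (max u v)} [AddCommGroup E]
    [Module (MonoidAlgebra k G) E] [AddCommGroup E'] [Module (MonoidAlgebra k G) E']
    (hE : IsInjectiveSmooth k G E) [Nontrivial E] (hE' : IsInjectiveSmooth k G E')
    (hE'i : IsIndecomposable (MonoidAlgebra k G) E') {N : Submodule (MonoidAlgebra k G) E}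
    (hN : IsEssential N) (j : N →ₗ[MonoidAlgebra k G] E') (hj : Function.Injective j) :
    ∃ e : E ≃ₗ[MonoidAlgebra k G] E', ∀ x : N, e x = j x := by
  obtain ⟨h, rfl⟩ := hE'.2 N E (hE.1.submodule N) hE.1 N.subtype j N.subtype_injective
  exact ⟨LinearEquiv.ofBijective h
    (hE.bijective_of_injective hE'.1 hE'i h (hN.injective_of_comp hj)), fun _ => rfl⟩

/-- A simple submodule of E is some V_{T,α}. Its embedding in E extends to the hull S_{T,α}, and the
extension is an isomorphism because E is indecomposable. -/
theorem Tame.exists_sMod (hG : Tame G) {E : Type (max u v)} [AddCommGroup E]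
    [Module (MonoidAlgebra k G) E] (hE : IsInjectiveSmooth k G E)
    (hEi : IsIndecomposable (MonoidAlgebra k G) E) :
    ∃ (T : Set Ψ) (Γ : Type (max u v)) (_ : AddCommGroup Γ)
      (_ : Module (MonoidAlgebra k (AutT G T)) Γ), FinClosed G T ∧
      IsSimpleModule (MonoidAlgebra k (AutT G T)) Γ ∧
      Nonempty (E ≃ₗ[MonoidAlgebra k G] SMod k G T Γ) := by
  have := hEi.nontrivial
  obtain ⟨W, hW⟩ := hG.exists_simple_submodule hE.1
  obtain ⟨T, Γ, _, _, hT, hΓ, ⟨e⟩⟩ := hG.exists_vMod (hE.1.submodule W)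
  have := (hG.isIndecomposable_sMod (k := k) Γ hT).nontrivial
  obtain ⟨e', -⟩ := (hG.isInjectiveSmooth_sMod hT Γ).exists_linearEquiv hE hEi
    (hG.isEssential_vMod Γ hT) (W.subtype ∘ₗ e.symm.toLinearMap)
    (W.subtype_injective.comp e.symm.injective)
  exact ⟨T, Γ, _, _, hT, hΓ, ⟨e'.symm⟩⟩

omit [CharZero k] in
theorem translate_one_surjective (h : T' ⊆ T) :
    Function.Surjective (translate k (1 : G) ((one_smul G T').trans_subset h)) := by
  intro p
  induction p using PermModule.induction with
  | zero => exact ⟨0, map_zero _⟩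
  | add p q hp hq =>
    obtain ⟨p, rfl⟩ := hp
    obtain ⟨q, rfl⟩ := hq
    exact ⟨p + q, map_add _ _ _⟩
  | single y c =>
    induction y using QuotientGroup.induction_on with
    | H y => exact ⟨PermModule.single k _ (y : G ⧸ stab G T) c, by rw [translate_single, mul_one]⟩

/-- For a simple subquotient W of k⟨G/G_T⟩, a non-zero map W → k⟨G/G_{T'}⟩ extends by injectivity to
a non-zero morphism from k⟨G/G_T⟩, so some x(T') lies in T. Conversely, restriction to T' is
surjective, so submodules of k⟨G/G_{T'}⟩ are subquotients. -/
theorem Tame.isSubquotient_iff (hG : Tame G) (hT : FinClosed G T) (W : Type*) [AddCommGroup W]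
    [Module (MonoidAlgebra k G) W] :
    (IsSimpleModule (MonoidAlgebra k G) W ∧
      ∃ (N : Submodule (MonoidAlgebra k G) (PermModule k (stab G T)))
        (N' : Submodule (MonoidAlgebra k G) N), Nonempty (W ≃ₗ[MonoidAlgebra k G] (N ⧸ N'))) ↔
    ∃ (T' : Set Ψ) (Γ : Type (max u v)) (_ : AddCommGroup Γ)
      (_ : Module (MonoidAlgebra k (AutT G T')) Γ), FinClosed G T' ∧ T' ⊆ T ∧
      IsSimpleModule (MonoidAlgebra k (AutT G T')) Γ ∧
      Nonempty (W ≃ₗ[MonoidAlgebra k G] VMod k G T' Γ) := by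
  have hsm : IsSmooth k G (PermModule k (stab G T)) := isSmooth_permModule T hT.1
  constructor
  · rintro ⟨hW, N, N', ⟨e⟩⟩
    have hWs : IsSmooth k G W := ((hsm.submodule N).quotient N').of_injective e.toLinearMap
      e.injective
    have := IsSimpleModule.nontrivial (MonoidAlgebra k G) W
    obtain ⟨w, hw⟩ := exists_ne (0 : W)
    obtain ⟨T', hT', f, hf⟩ := hG.exists_hom_ne_zero hWs hw
    obtain ⟨h, hh⟩ := hG.exists_extension hT' hsm N.subtype N.subtype_injective
      (f ∘ₗ e.symm.toLinearMap ∘ₗ N'.mkQ)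
    have hne : h ≠ 0 := by
      rintro rfl
      obtain ⟨n, hn⟩ := N'.mkQ_surjective (e w)
      refine hf ?_
      have := LinearMap.congr_fun hh n
      simp only [LinearMap.comp_apply, hn, LinearMap.zero_apply] at this
      rw [this]
      simp
    obtain ⟨x, hx⟩ := hG.exists_smul_subset hT hT'.1 hne
    have hx' : x⁻¹ • x • T' ⊆ T' := (inv_smul_smul x T').subset
    have hinv : translate k x subset_rfl ∘ₗ translate k x⁻¹ hx' = LinearMap.id := by
      refine PermModule.hom_ext ?_
      simp only [LinearMap.comp_apply, translate_single, one_mul, inv_mul_cancel,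
        LinearMap.id_apply]
    -- T' is only conjugate to a subset of T, so W is moved along the isomorphism to the module of
    -- x(T').
    obtain ⟨I, hI, h⟩ := hG.exists_vMod_of_hom (hT'.smul x) (f := translate k x⁻¹ hx' ∘ₗ f)
      fun h0 => hf (by
        rw [← LinearMap.id_apply (R := MonoidAlgebra k G) (f w), ← hinv, LinearMap.comp_apply,
          ← LinearMap.comp_apply (translate k x⁻¹ hx'), h0, LinearMap.zero_apply, map_zero])
    exact ⟨x • T', I, _, _, hT'.smul x, hx, hI, h⟩
  · rintro ⟨T', Γ, _, _, hT', hsub, hΓ, ⟨e⟩⟩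
    refine ⟨e.isSimpleModule_iff.2 (hG.isSimpleModule_vMod Γ hT'), ?_⟩
    obtain ⟨i₀, r, hr⟩ := exists_retraction_sMod (k := k) Γ hT'
    let i : W →ₗ[MonoidAlgebra k G] PermModule k (stab G T') :=
      i₀ ∘ₗ (VMod k G T' Γ).subtype ∘ₗ e.toLinearMap
    have hi : Function.Injective i :=
      (Function.LeftInverse.injective hr).comp (Subtype.val_injective.comp e.injective)
    let ρ := translate k (1 : G) ((one_smul G T').trans_subset hsub)
    let N := (LinearMap.range i).comap ρ
    let π : N →ₗ[MonoidAlgebra k G] LinearMap.range i :=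
      (ρ ∘ₗ N.subtype).codRestrict _ fun n => n.2
    have hπ : Function.Surjective π := by
      rintro ⟨p, hp⟩
      obtain ⟨q, rfl⟩ := translate_one_surjective hsub p
      exact ⟨⟨q, hp⟩, rfl⟩
    exact ⟨N, LinearMap.ker π,
      ⟨(LinearEquiv.ofInjective i hi).trans (π.quotKerEquivOfSurjective hπ).symm⟩⟩

end Classification

/-! ### Compact objects -/

section DirectLimit

variable {A : Type*} [Ring A] {ι : Type*} [DecidableEq ι] [Preorder ι] [IsDirectedOrder ι]
  [Nonempty ι] {M : ι → Type*} [∀ i, AddCommGroup (M i)] [∀ i, Module A (M i)]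
  {f : ∀ i j, i ≤ j → M i →ₗ[A] M j}

omit [Nonempty ι] in
theorem exists_map_eq_zero [DirectedSystem M (f · · ·)] {L : Type*} [AddCommGroup L] [Module A L]
    {i : ι} (g : L →ₗ[A] M i) {K : Submodule A L} (hK : K.FG)
    (hg : ∀ z ∈ K, Module.DirectLimit.of A ι M f i (g z) = 0) :
    ∃ (j : ι) (hij : i ≤ j), ∀ z ∈ K, f i j hij (g z) = 0 := by
  induction K, hK using Submodule.fg_induction with
  | singleton x =>
    obtain ⟨j, hij, h⟩ := Module.DirectLimit.of.zero_exact
      (hg x (Submodule.mem_span_singleton_self x))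
    refine ⟨j, hij, fun z hz => ?_⟩
    obtain ⟨a, rfl⟩ := Submodule.mem_span_singleton.1 hz
    rw [map_smul, map_smul, h, smul_zero]
  | sup K₁ K₂ _ _ h₁ h₂ =>
    obtain ⟨j₁, hj₁, h₁⟩ := h₁ fun z hz => hg z (Submodule.mem_sup_left hz)
    obtain ⟨j₂, hj₂, h₂⟩ := h₂ fun z hz => hg z (Submodule.mem_sup_right hz)
    obtain ⟨j, h₁j, h₂j⟩ := exists_ge_ge j₁ j₂
    refine ⟨j, hj₁.trans h₁j, fun z hz => ?_⟩
    obtain ⟨z₁, hz₁, z₂, hz₂, rfl⟩ := Submodule.mem_sup.1 hz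
    rw [map_add, map_add, ← DirectedSystem.map_map' f hj₁ h₁j, h₁ _ hz₁,
      ← DirectedSystem.map_map' f hj₂ h₂j, h₂ _ hz₂, map_zero, map_zero, add_zero]

/-- L approximates the graph of φ at a finite stage. It need not be a graph, since relations of N
may hold only in the limit. -/
theorem exists_fg_graph {X : Type*} [AddCommGroup X] [Module A X]
    (φ : X →ₗ[A] Module.DirectLimit M f) {N : Submodule A X} (hN : N.FG) :
    ∃ (i : ι) (L : Submodule A (X × M i)), L.FG ∧ L.map (LinearMap.fst A X (M i)) = N ∧
      ∀ z ∈ L, Module.DirectLimit.of A ι M f i z.2 = φ z.1 := by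
  induction N, hN using Submodule.fg_induction with
  | singleton x =>
    obtain ⟨i, m, hm⟩ := Module.DirectLimit.exists_of (φ x)
    refine ⟨i, Submodule.span A {(x, m)}, Submodule.fg_span_singleton _, ?_, fun z hz => ?_⟩
    · rw [Submodule.map_span, Set.image_singleton]
      rfl
    · obtain ⟨a, rfl⟩ := Submodule.mem_span_singleton.1 hz
      rw [Prod.smul_mk, map_smul, map_smul, hm]
  | sup N₁ N₂ _ _ h₁ h₂ =>
    obtain ⟨i₁, L₁, hL₁, rfl, h₁⟩ := h₁
    obtain ⟨i₂, L₂, hL₂, rfl, h₂⟩ := h₂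
    obtain ⟨i, hi₁, hi₂⟩ := exists_ge_ge i₁ i₂
    refine ⟨i, L₁.map (LinearMap.prodMap LinearMap.id (f i₁ i hi₁)) ⊔
      L₂.map (LinearMap.prodMap LinearMap.id (f i₂ i hi₂)), (hL₁.map _).sup (hL₂.map _), ?_, ?_⟩
    · rw [Submodule.map_sup, ← Submodule.map_comp, ← Submodule.map_comp]
      rfl
    · intro z hz
      obtain ⟨_, ⟨z₁, hz₁, rfl⟩, _, ⟨z₂, hz₂, rfl⟩, rfl⟩ := Submodule.mem_sup.1 hz
      simp only [LinearMap.prodMap_apply, Prod.mk_add_mk, LinearMap.id_apply, map_add,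
        Module.DirectLimit.of_f]
      rw [h₁ _ hz₁, h₂ _ hz₂]

end DirectLimit

/-! ### Compact objects as finitely generated smooth modules. -/

section Spectrum

variable {k : Type u} [Field k] {Ψ : Type v} {G : Subgroup (Equiv.Perm Ψ)}

/-- X is the direct limit of its finitely generated submodules, so its identity factors through one
of them. -/
theorem IsCompactSmooth.finite {X : Type (max u v)} [AddCommGroup X] [Module (MonoidAlgebra k G) X]
    (hX : IsCompactSmooth k G X) : Module.Finite (MonoidAlgebra k G) X := by
  classical
  obtain ⟨N, ψ, hψ⟩ := (hX.2 {N : Submodule (MonoidAlgebra k G) X // N.FG} (fun N => N.1)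
    (Module.fgSystem _ X) fun N => hX.1.submodule N.1).1
    (Module.fgSystem.equiv (MonoidAlgebra k G) X).symm.toLinearMap
  have htop : N.1 = ⊤ := by
    refine Submodule.eq_top_iff'.2 fun x => ?_
    have h1 : Module.fgSystem.equiv (MonoidAlgebra k G) X
        (Module.DirectLimit.of _ _ _ (Module.fgSystem _ X) N (ψ x)) = x := by
      rw [← LinearEquiv.eq_symm_apply]
      exact (LinearMap.congr_fun hψ x).symm
    have h2 := LinearMap.congr_fun (Module.fgSystem.equiv_comp_of N) (ψ x)
    rw [← h1]
    exact h2 ▸ (ψ x).2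
  exact ⟨htop ▸ N.2⟩

variable [CharZero k]

/-- The approximate graph L is finitely generated and smooth, hence Noetherian. So the kernel of L →
X is finitely generated and dies at a later stage, where L becomes the graph of a morphism on X. -/
theorem Tame.isCompactSmooth (hG : Tame G) {X : Type (max u v)} [AddCommGroup X]
    [Module (MonoidAlgebra k G) X] (hX : IsSmooth k G X)
    (hfg : Module.Finite (MonoidAlgebra k G) X) : IsCompactSmooth k G X := by
  refine ⟨hX, fun ι _ _ _ _ M _ _ f _ hM => ⟨fun φ => ?_, fun i ψ h => ?_⟩⟩
  · obtain ⟨i, L, hL, hLX, hφ⟩ := exists_fg_graph φ hfg.fg_top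
    have hLf : Module.Finite (MonoidAlgebra k G) L := Module.Finite.iff_fg.2 hL
    have := (isFiniteLength_iff_isNoetherian_isArtinian.1
      (hG.isFiniteLength_of_fg ((hX.prod (hM i)).submodule L))).1
    let p : L →ₗ[MonoidAlgebra k G] X := LinearMap.fst _ X (M i) ∘ₗ L.subtype
    have hp : Function.Surjective p := fun x => by
      obtain ⟨z, hz, rfl⟩ := hLX.ge (Submodule.mem_top (x := x))
      exact ⟨⟨z, hz⟩, rfl⟩
    let q : L →ₗ[MonoidAlgebra k G] M i := LinearMap.snd _ X (M i) ∘ₗ L.subtype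
    have hq : ∀ z, Module.DirectLimit.of _ ι M f i (q z) = φ (p z) := fun z => hφ z z.2
    obtain ⟨j, hij, hj⟩ := exists_map_eq_zero (f := f) q (IsNoetherian.noetherian (LinearMap.ker p))
      fun z hz => by rw [hq, LinearMap.mem_ker.1 hz, map_zero]
    refine ⟨j, (LinearMap.ker p).liftQ (f i j hij ∘ₗ q) hj ∘ₗ
      (p.quotKerEquivOfSurjective hp).symm.toLinearMap, LinearMap.ext fun x => ?_⟩
    obtain ⟨z, rfl⟩ := hp x
    have hz : (p.quotKerEquivOfSurjective hp).symm (p z) = Submodule.Quotient.mk z := by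
      rw [LinearEquiv.symm_apply_eq]
      rfl
    simp only [LinearMap.comp_apply, LinearEquiv.coe_coe, hz]
    exact (hq z).symm.trans Module.DirectLimit.of_f.symm
  · obtain ⟨j, hij, hj⟩ := exists_map_eq_zero (f := f) ψ hfg.fg_top
      fun z _ => LinearMap.congr_fun h z
    exact ⟨j, hij, LinearMap.ext fun x => hj x Submodule.mem_top⟩

/-! ### Simple submodules of indecomposable injective modules -/

omit [Field k] [CharZero k] in
theorem IsEssential.map_linearEquiv {A : Type*} [Ring A] {M M' : Type*} [AddCommGroup M]
    [Module A M] [AddCommGroup M'] [Module A M'] {N : Submodule A M} (hN : IsEssential N)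
    (e : M ≃ₗ[A] M') : IsEssential (N.map (e : M →ₗ[A] M')) := by
  intro L hL
  have h1 : L.map (e.symm : M' →ₗ[A] M) = ⊥ := by
    refine hN _ ((Submodule.eq_bot_iff _).2 ?_)
    rintro _ ⟨hx, ⟨y, hy, rfl⟩⟩
    have : y ∈ N.map (e : M →ₗ[A] M') ⊓ L := ⟨⟨_, hx, e.apply_symm_apply y⟩, hy⟩
    rw [hL, Submodule.mem_bot] at this
    rw [this, map_zero]
  exact Submodule.map_injective_of_injective e.symm.injective (h1.trans (Submodule.map_bot _).symm)

theorem Tame.exists_simple_essential (hG : Tame G) {E : Type (max u v)} [AddCommGroup E]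
    [Module (MonoidAlgebra k G) E] (hE : IsInjectiveSmooth k G E)
    (hEi : IsIndecomposable (MonoidAlgebra k G) E) :
    ∃ N : Submodule (MonoidAlgebra k G) E, IsSimpleModule (MonoidAlgebra k G) N ∧
      IsEssential N := by
  obtain ⟨T, Γ, _, _, hT, hΓ, ⟨e⟩⟩ := hG.exists_sMod hE hEi
  exact ⟨_, (e.symm.submoduleMap _).isSimpleModule_iff.1 (hG.isSimpleModule_vMod Γ hT),
    (hG.isEssential_vMod Γ hT).map_linearEquiv e.symm⟩

/-- The image is simple, so it is contained in, and equal to, the simple essential submodule of E.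
-/
theorem Tame.isEssential_range (hG : Tame G) {E : Type (max u v)} [AddCommGroup E]
    [Module (MonoidAlgebra k G) E] (hE : IsInjectiveSmooth k G E)
    (hEi : IsIndecomposable (MonoidAlgebra k G) E) {W : Type*} [AddCommGroup W]
    [Module (MonoidAlgebra k G) W] [IsSimpleModule (MonoidAlgebra k G) W]
    {f : W →ₗ[MonoidAlgebra k G] E} (hf : f ≠ 0) : IsEssential (LinearMap.range f) := by
  obtain ⟨N, hN, hNe⟩ := hG.exists_simple_essential hE hEi
  have hs : IsSimpleModule (MonoidAlgebra k G) (LinearMap.range f) :=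
    (LinearEquiv.ofInjective f (LinearMap.injective_of_ne_zero hf)).isSimpleModule_iff.1
      inferInstance
  rwa [((isSimpleModule_iff_isAtom.1 hN).le_iff_eq (isSimpleModule_iff_isAtom.1 hs).1).1
    (hNe.le_of_isSimpleModule hs)]

/-- Indecomposable injective modules admitting non-zero morphisms from the same simple module are
isomorphic. -/
theorem Tame.linearEquiv_of_hom (hG : Tame G) {E E' : IndecInjective k G} {W : Type*}
    [AddCommGroup W] [Module (MonoidAlgebra k G) W] [IsSimpleModule (MonoidAlgebra k G) W]
    {f : W →ₗ[MonoidAlgebra k G] E.1.carrier} (hf : f ≠ 0)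
    {f' : W →ₗ[MonoidAlgebra k G] E'.1.carrier} (hf' : f' ≠ 0) :
    Nonempty (E.1.carrier ≃ₗ[MonoidAlgebra k G] E'.1.carrier) := by
  have := E.2.2.nontrivial
  obtain ⟨e, -⟩ := E.2.1.exists_linearEquiv E'.2.1 E'.2.2 (hG.isEssential_range E.2.1 E.2.2 hf)
    (f' ∘ₗ (LinearEquiv.ofInjective f (LinearMap.injective_of_ne_zero hf)).symm.toLinearMap)
    ((LinearMap.injective_of_ne_zero hf').comp (LinearEquiv.injective _))
  exact ⟨e⟩

omit [CharZero k] in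
theorem mk_eq_mk_iff {E E' : IndecInjective k G} : GabrielSpectrum.mk E = GabrielSpectrum.mk E' ↔
    Nonempty (E.1.carrier ≃ₗ[MonoidAlgebra k G] E'.1.carrier) :=
  Quotient.eq

/-! ### The topology of the Gabriel spectrum -/

/-- Induction on length: a non-zero map is non-zero on the submodule or factors through the simple
quotient, and the quotient accounts for at most one point of the spectrum. -/
theorem Tame.finite_setOf_hom_ne_zero (hG : Tame G) {M : Type*} [AddCommGroup M]
    [Module (MonoidAlgebra k G) M] (hM : IsFiniteLength (MonoidAlgebra k G) M) :
    {p : GabrielSpectrum k G | ∃ E : IndecInjective k G, GabrielSpectrum.mk E = p ∧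
      ∃ f : M →ₗ[MonoidAlgebra k G] E.1.carrier, f ≠ 0}.Finite := by
  induction hM with
  | of_subsingleton =>
    refine Set.finite_empty.subset ?_
    rintro _ ⟨E, rfl, f, hf⟩
    exact hf (Subsingleton.elim _ _)
  | @of_simple_quotient M _ _ N _ _ ih =>
    have hsub : {p : GabrielSpectrum k G | ∃ E : IndecInjective k G, GabrielSpectrum.mk E = p ∧
        ∃ f : (M ⧸ N) →ₗ[MonoidAlgebra k G] E.1.carrier, f ≠ 0}.Subsingleton := by
      rintro _ ⟨E, rfl, f, hf⟩ _ ⟨E', rfl, f', hf'⟩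
      exact mk_eq_mk_iff.2 (hG.linearEquiv_of_hom hf hf')
    refine (ih.union hsub.finite).subset ?_
    rintro _ ⟨E, rfl, f, hf⟩
    by_cases h : f ∘ₗ N.subtype = 0
    · refine Or.inr ⟨E, rfl, N.liftQ f fun x hx => LinearMap.congr_fun h ⟨x, hx⟩, fun h0 => hf ?_⟩
      rw [← N.liftQ_mkQ f fun x hx => LinearMap.congr_fun h ⟨x, hx⟩, h0, LinearMap.zero_comp]
    · exact Or.inl ⟨E, rfl, _, h⟩

theorem Tame.finite_compl_homVanishing (hG : Tame G) {X : SmoothModule k G}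
    (hX : IsCompactSmooth k G X.carrier) : (homVanishing X)ᶜ.Finite := by
  have := hX.finite
  refine (hG.finite_setOf_hom_ne_zero (hG.isFiniteLength_of_fg X.smooth)).subset fun p hp => ?_
  by_contra h
  exact hp fun E hE f => by_contra fun hf => h ⟨E, hE, f, hf⟩

theorem Tame.finite_compl_of_isOpen (hG : Tame G) {U : Set (GabrielSpectrum k G)} (hU : IsOpen U)
    (hne : U.Nonempty) : Uᶜ.Finite := by
  induction hU with
  | basic s hs =>
    obtain ⟨X, hX, rfl⟩ := hs
    exact hG.finite_compl_homVanishing hX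
  | univ => simp
  | inter s t _ _ hs ht =>
    rw [Set.compl_inter]
    exact (hs hne.left).union (ht hne.right)
  | sUnion S _ ih =>
    obtain ⟨x, s, hs, hx⟩ := hne
    exact (ih s hs ⟨x, hx⟩).subset (Set.compl_subset_compl.2 (Set.subset_sUnion_of_mem hs))

/-- The simple essential submodule N of E is a compact object, and E is the only point to which it
maps non-trivially. So [N] is the complement of that point. -/
theorem Tame.t1Space (hG : Tame G) : T1Space (GabrielSpectrum k G) := by
  refine ⟨fun p => ?_⟩
  obtain ⟨E, rfl⟩ : ∃ E, GabrielSpectrum.mk E = p := Quotient.exists_rep p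
  obtain ⟨N, hN, -⟩ := hG.exists_simple_essential E.2.1 E.2.2
  have hNs := E.2.1.1.submodule N
  have hne : N.subtype ≠ 0 := fun h => (isSimpleModule_iff_isAtom.1 hN).1 <| by
    rw [← N.range_subtype, h, LinearMap.range_zero]
  have heq : {GabrielSpectrum.mk E}ᶜ = homVanishing ⟨N, hNs⟩ := by
    ext p
    refine ⟨?_, ?_⟩
    · rintro hp E' rfl f
      by_contra hf
      exact hp (mk_eq_mk_iff.2 (hG.linearEquiv_of_hom hf hne))
    · rintro hp rfl
      exact hne (hp E rfl N.subtype)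
  refine ⟨?_⟩
  rw [heq]
  exact TopologicalSpace.isOpen_generateFrom_of_mem
    ⟨_, hG.isCompactSmooth hNs inferInstance, rfl⟩

theorem Tame.isOpen_iff (hG : Tame G) (U : Set (GabrielSpectrum k G)) :
    IsOpen U ↔ (U.Nonempty → Uᶜ.Finite) := by
  refine ⟨hG.finite_compl_of_isOpen, fun h => ?_⟩
  have := hG.t1Space (k := k)
  rcases U.eq_empty_or_nonempty with rfl | hne
  · exact isOpen_empty
  · exact isClosed_compl_iff.1 (h hne).isClosed

/-! ### Injective hulls of simple modules -/

/-- A non-zero morphism from a simple module is injective, and its image in an indecomposable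
injective module is automatically essential. -/
theorem Tame.isInjectiveHull_iff (hG : Tame G) {W : SimpleSmooth k G} {E : IndecInjective k G} :
    IsInjectiveHull W.1 E.1 ↔
      ∃ f : W.1.carrier →ₗ[MonoidAlgebra k G] E.1.carrier, f ≠ 0 := by
  have := W.2
  constructor
  · rintro ⟨-, i, hi, -⟩
    have := IsSimpleModule.nontrivial (MonoidAlgebra k G) W.1.carrier
    obtain ⟨w, hw⟩ := exists_ne (0 : W.1.carrier)
    exact ⟨i, fun h => hw (hi (by rw [h]; rfl))⟩
  · rintro ⟨f, hf⟩
    exact ⟨E.2.1, f, LinearMap.injective_of_ne_zero hf, hG.isEssential_range E.2.1 E.2.2 hf⟩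

theorem Tame.exists_isInjectiveHull (hG : Tame G) (W : SimpleSmooth k G) :
    ∃ E : IndecInjective k G, IsInjectiveHull W.1 E.1 := by
  have := W.2
  obtain ⟨T, Γ, _, _, hT, hΓ, ⟨e⟩⟩ := hG.exists_vMod W.1.smooth
  let E : IndecInjective k G := ⟨⟨SMod k G T Γ, isSmooth_sMod Γ hT⟩,
    hG.isInjectiveSmooth_sMod hT Γ, hG.isIndecomposable_sMod Γ hT⟩
  refine ⟨E, E.2.1, (VMod k G T Γ).subtype ∘ₗ e.toLinearMap,
    (Submodule.subtype_injective _).comp e.injective, ?_⟩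
  rw [LinearEquiv.range_comp, Submodule.range_subtype]
  exact hG.isEssential_vMod Γ hT

theorem Tame.exists_equiv_isInjectiveHull (hG : Tame G) :
    ∃ e : SimpleClass k G ≃ GabrielSpectrum k G, ∀ (W : SimpleSmooth k G) (E : IndecInjective k G),
      e (SimpleClass.mk W) = GabrielSpectrum.mk E ↔ IsInjectiveHull W.1 E.1 := by
  choose hull hhull using hG.exists_isInjectiveHull (k := k)
  let e : SimpleClass k G → GabrielSpectrum k G := fun q => GabrielSpectrum.mk (hull q.out)
  have he : ∀ (W : SimpleSmooth k G) (E : IndecInjective k G),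
      e (SimpleClass.mk W) = GabrielSpectrum.mk E ↔ IsInjectiveHull W.1 E.1 := by
    intro W E
    obtain ⟨eW⟩ : Nonempty ((SimpleClass.mk W).out.1.carrier ≃ₗ[MonoidAlgebra k G] W.1.carrier) :=
      Quotient.exact (SimpleClass.mk W).out_eq
    have hs := (SimpleClass.mk W).out.2
    have hh := hG.isInjectiveHull_iff.1 (hhull (SimpleClass.mk W).out)
    have hcomp : IsInjectiveHull W.1 E.1 ↔ ∃ f : (SimpleClass.mk W).out.1.carrier
        →ₗ[MonoidAlgebra k G] E.1.carrier, f ≠ 0 := by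
      rw [hG.isInjectiveHull_iff]
      constructor
      · rintro ⟨f, hf⟩
        exact ⟨f ∘ₗ eW.toLinearMap, fun h => hf <| LinearMap.ext fun x => by
          simpa using LinearMap.congr_fun h (eW.symm x)⟩
      · rintro ⟨f, hf⟩
        exact ⟨f ∘ₗ eW.symm.toLinearMap, fun h => hf <| LinearMap.ext fun x => by
          simpa using LinearMap.congr_fun h (eW x)⟩
    obtain ⟨i, hi⟩ := hh
    rw [hcomp]
    refine mk_eq_mk_iff.trans ⟨?_, ?_⟩
    · rintro ⟨e'⟩
      exact ⟨e'.toLinearMap ∘ₗ i, fun h => hi <| LinearMap.ext fun x => e'.injective <| by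
        simpa using LinearMap.congr_fun h x⟩
    · rintro ⟨f, hf⟩
      exact hG.linearEquiv_of_hom hi hf
  refine ⟨Equiv.ofBijective e ⟨fun q q' h => ?_, fun p => ?_⟩, he⟩
  · obtain ⟨W, rfl⟩ : ∃ W, SimpleClass.mk W = q := Quotient.exists_rep q
    obtain ⟨W', rfl⟩ : ∃ W, SimpleClass.mk W = q' := Quotient.exists_rep q'
    obtain ⟨E, hE⟩ : ∃ E, GabrielSpectrum.mk E = e (SimpleClass.mk W) := Quotient.exists_rep _
    obtain ⟨-, i, hi, hie⟩ := (he W E).1 hE.symm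
    obtain ⟨-, i', hi', hie'⟩ := (he W' E).1 (h.symm.trans hE.symm)
    let j := LinearEquiv.ofInjective i hi
    let j' := LinearEquiv.ofInjective i' hi'
    -- Both simple modules embed in E as simple essential submodules, and these correspond to each
    -- other under the identity of E.
    obtain ⟨e₀⟩ := hie.nonempty_linearEquiv (j.isSimpleModule_iff.1 W.2) hie'
      (j'.isSimpleModule_iff.1 W'.2) (LinearEquiv.refl _ _)
    exact Quotient.sound ⟨j.trans (e₀.trans j'.symm)⟩
  · obtain ⟨E, rfl⟩ : ∃ E, GabrielSpectrum.mk E = p := Quotient.exists_rep p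
    obtain ⟨N, hN, hNe⟩ := hG.exists_simple_essential E.2.1 E.2.2
    refine ⟨SimpleClass.mk ⟨⟨N, E.2.1.1.submodule N⟩, hN⟩,
      (he _ E).2 ⟨E.2.1, N.subtype, N.subtype_injective, ?_⟩⟩
    rwa [Submodule.range_subtype]

end Spectrum

end SmoothRep

end

theorem mainTheorem8 {k : Type u} [Field k] [CharZero k]
    {Ψ : Type v} [Countable Ψ] [Infinite Ψ]
    (G : Subgroup (Equiv.Perm Ψ)) (hG : SmoothRep.IsAutGroupFixingFinite G) :
    -- the Gabriel spectrum is cofinite: the non-empty open sets are those with finite complement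
    (∀ U : Set (SmoothRep.GabrielSpectrum k G), IsOpen U ↔ (U.Nonempty → Uᶜ.Finite)) ∧
    -- the modules `V_{T,α}` are smooth and simple
    (∀ (T : Set Ψ), SmoothRep.FinClosed G T →
      ∀ (Γ : Type (max u v)) [AddCommGroup Γ] [Module (MonoidAlgebra k (SmoothRep.AutT G T)) Γ],
        IsSimpleModule (MonoidAlgebra k (SmoothRep.AutT G T)) Γ →
        SmoothRep.IsSmooth k G (SmoothRep.VMod k G T Γ) ∧
        IsSimpleModule (MonoidAlgebra k G) (SmoothRep.VMod k G T Γ)) ∧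
    -- the modules `k ⊗ V_T` are semisimple
    (∀ (T : Set Ψ), SmoothRep.FinClosed G T →
      IsSemisimpleModule (MonoidAlgebra k G) (SmoothRep.VField k G T)) ∧
    -- isomorphisms between the modules `V_{T,α}`, and between the modules `S_{T,α}`
    (∀ (T T' : Set Ψ), SmoothRep.FinClosed G T → SmoothRep.FinClosed G T' →
      ∀ (Γ : Type (max u v)) [AddCommGroup Γ] [Module (MonoidAlgebra k (SmoothRep.AutT G T)) Γ]
        (Γ' : Type (max u v)) [AddCommGroup Γ'] [Module (MonoidAlgebra k (SmoothRep.AutT G T')) Γ'],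
        IsSimpleModule (MonoidAlgebra k (SmoothRep.AutT G T)) Γ →
        IsSimpleModule (MonoidAlgebra k (SmoothRep.AutT G T')) Γ' →
        (Nonempty (SmoothRep.VMod k G T Γ ≃ₗ[MonoidAlgebra k G] SmoothRep.VMod k G T' Γ') ↔
          ∃ g : G, SmoothRep.Transforms k G g T T' Γ Γ') ∧
        (Nonempty (SmoothRep.SMod k G T Γ ≃ₗ[MonoidAlgebra k G] SmoothRep.SMod k G T' Γ') ↔
          ∃ g : G, SmoothRep.Transforms k G g T T' Γ Γ')) ∧
    -- any simple smooth module is isomorphic to some `V_{T,α}`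
    (∀ (W : Type (max u v)) [AddCommGroup W] [Module (MonoidAlgebra k G) W],
      SmoothRep.IsSmooth k G W → IsSimpleModule (MonoidAlgebra k G) W →
      ∃ (T : Set Ψ) (Γ : Type (max u v)) (_ : AddCommGroup Γ)
        (_ : Module (MonoidAlgebra k (SmoothRep.AutT G T)) Γ),
        SmoothRep.FinClosed G T ∧
        IsSimpleModule (MonoidAlgebra k (SmoothRep.AutT G T)) Γ ∧
        Nonempty (W ≃ₗ[MonoidAlgebra k G] SmoothRep.VMod k G T Γ)) ∧
    -- in a module of finite length, the smallest essential submodule exists and coincides with the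
    -- largest semisimple submodule
    (∀ (M : Type (max u v)) [AddCommGroup M] [Module (MonoidAlgebra k G) M],
      IsFiniteLength (MonoidAlgebra k G) M →
      ∃ N : Submodule (MonoidAlgebra k G) M,
        IsLeast {N' | SmoothRep.IsEssential N'} N ∧
        IsGreatest {N' : Submodule (MonoidAlgebra k G) M |
          IsSemisimpleModule (MonoidAlgebra k G) N'} N) ∧
    -- the module `k⟨G/G_T⟩` has finite length and its socle is `k ⊗ V_T`
    (∀ (T : Set Ψ), SmoothRep.FinClosed G T →
      IsFiniteLength (MonoidAlgebra k G) (SmoothRep.PermModule k (SmoothRep.stab G T)) ∧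
      IsLeast {N' | SmoothRep.IsEssential N'} (SmoothRep.VField k G T) ∧
      IsGreatest {N' : Submodule (MonoidAlgebra k G)
            (SmoothRep.PermModule k (SmoothRep.stab G T)) |
          IsSemisimpleModule (MonoidAlgebra k G) N'} (SmoothRep.VField k G T)) ∧
    -- `S_{T,α}` is an injective hull of `V_{T,α}` in the smooth category, and is indecomposable
    (∀ (T : Set Ψ), SmoothRep.FinClosed G T →
      ∀ (Γ : Type (max u v)) [AddCommGroup Γ] [Module (MonoidAlgebra k (SmoothRep.AutT G T)) Γ],
        IsSimpleModule (MonoidAlgebra k (SmoothRep.AutT G T)) Γ →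
        SmoothRep.IsInjectiveSmooth k G (SmoothRep.SMod k G T Γ) ∧
        SmoothRep.IsEssential (SmoothRep.VMod k G T Γ) ∧
        SmoothRep.IsIndecomposable (MonoidAlgebra k G) (SmoothRep.SMod k G T Γ)) ∧
    -- any indecomposable injective smooth module is isomorphic to some `S_{T,α}`
    (∀ (E : Type (max u v)) [AddCommGroup E] [Module (MonoidAlgebra k G) E],
      SmoothRep.IsInjectiveSmooth k G E → SmoothRep.IsIndecomposable (MonoidAlgebra k G) E →
      ∃ (T : Set Ψ) (Γ : Type (max u v)) (_ : AddCommGroup Γ)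
        (_ : Module (MonoidAlgebra k (SmoothRep.AutT G T)) Γ),
        SmoothRep.FinClosed G T ∧
        IsSimpleModule (MonoidAlgebra k (SmoothRep.AutT G T)) Γ ∧
        Nonempty (E ≃ₗ[MonoidAlgebra k G] SmoothRep.SMod k G T Γ)) ∧
    -- the simple subquotients of `k⟨G/G_T⟩` are, up to isomorphism, the `V_{T',α}` with `T' ⊆ T`
    (∀ (T : Set Ψ), SmoothRep.FinClosed G T →
      ∀ (W : Type (max u v)) [AddCommGroup W] [Module (MonoidAlgebra k G) W],
        (IsSimpleModule (MonoidAlgebra k G) W ∧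
          ∃ (N : Submodule (MonoidAlgebra k G) (SmoothRep.PermModule k (SmoothRep.stab G T)))
            (N' : Submodule (MonoidAlgebra k G) N),
            Nonempty (W ≃ₗ[MonoidAlgebra k G] (N ⧸ N'))) ↔
        ∃ (T' : Set Ψ) (Γ : Type (max u v)) (_ : AddCommGroup Γ)
          (_ : Module (MonoidAlgebra k (SmoothRep.AutT G T')) Γ),
          SmoothRep.FinClosed G T' ∧ T' ⊆ T ∧
          IsSimpleModule (MonoidAlgebra k (SmoothRep.AutT G T')) Γ ∧
          Nonempty (W ≃ₗ[MonoidAlgebra k G] SmoothRep.VMod k G T' Γ)) ∧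
    -- passing to injective hulls is a bijection from the isomorphism classes of simple smooth
    -- modules to the isomorphism classes of indecomposable injective smooth modules
    (∃ e : SmoothRep.SimpleClass k G ≃ SmoothRep.GabrielSpectrum k G,
      ∀ (W : SmoothRep.SimpleSmooth k G) (E : SmoothRep.IndecInjective k G),
        e (SmoothRep.SimpleClass.mk W) = SmoothRep.GabrielSpectrum.mk E ↔
          SmoothRep.IsInjectiveHull W.1 E.1) := by
  have hGt := hG.tame
  refine ⟨hGt.isOpen_iff, fun T hT Γ _ _ hΓ => ⟨(SmoothRep.isSmooth_sMod Γ hT).submodule _,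
    hGt.isSimpleModule_vMod Γ hT⟩, fun T hT => ?_, fun T T' hT hT' Γ _ _ Γ' _ _ hΓ hΓ' =>
    ⟨⟨fun ⟨e⟩ => hGt.exists_transforms_of_vMod hT hT' e, fun ⟨g, hg⟩ => ?_⟩, ⟨fun ⟨e⟩ => ?_,
      fun ⟨g, hg⟩ => hGt.sMod_linearEquiv_of_transforms hT hT' hg⟩⟩,
    fun W _ _ hW hWs => hGt.exists_vMod hW, fun M _ _ hM => ?_, fun T hT =>
    ⟨hGt.isFiniteLength_permModule hT, ?_⟩, fun T hT Γ _ _ hΓ => ⟨hGt.isInjectiveSmooth_sMod hT Γ,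
      hGt.isEssential_vMod Γ hT, hGt.isIndecomposable_sMod Γ hT⟩,
    fun E _ _ hE hEi => hGt.exists_sMod hE hEi, fun T hT W _ _ => hGt.isSubquotient_iff hT W,
    hGt.exists_equiv_isInjectiveHull⟩
  · rw [hGt.vField_eq hT]
    exact hGt.isSemisimpleModule_commonKer hT
  · obtain ⟨e⟩ := hGt.sMod_linearEquiv_of_transforms hT hT' hg
    exact hGt.vMod_linearEquiv_of_sMod hT hT' e
  · obtain ⟨e'⟩ := hGt.vMod_linearEquiv_of_sMod hT hT' e
    exact hGt.exists_transforms_of_vMod hT hT' e'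
  · have := (isFiniteLength_iff_isNoetherian_isArtinian.1 hM).2
    obtain ⟨N, hN, hS⟩ := SmoothRep.exists_isEssential_isSemisimple (A := MonoidAlgebra k G) (M := M)
    exact ⟨N, hN.isLeast_isGreatest hS⟩
  · rw [hGt.vField_eq hT]
    exact (hGt.isEssential_commonKer hT).isLeast_isGreatest (hGt.isSemisimpleModule_commonKer hT)
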